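/- Let $\Sigma$ be a smooth complete fan in $\mathbb R^n$ with primitive ray generators $v_1,\dots,v_p\in\mathbb Z^n$, and let $\lambda_1,\dots,\lambda_p\in\mathbb R$ be such that the toric ($\mathbb R$-)divisor $\sum_k\lambda_kD_k$ is ample, i.e. for every maximal cone $\sigma$ there is $m_\sigma\in\mathbb R^n$ with $\langle v_i,m_\sigma\rangle=-\lambda_i$ if $v_i\in\sigma$ and $\langle v_k,m_\sigma\rangle>-\lambda_k$ if $v_k\notin\sigma$. (The case of the Hori–Vafa mirror in normalized form is $v_i=e_i$, $\lambda_i=0$ for $i\le n$.) Put $\chi_k(x)=\lambda_k+\langle v_k,x\rangle$ and let $$F_{j}=\{x\in\mathbb R^n : \chi_k(x)\ge 0 \text{ for all } k,\ \chi_j(x)=0\}$$ be the facet dual to $v_j$. For $t>0$ let $$W(z)=1+\sum_{k=1}^p t^{\lambda_k}z^{v_k},\qquad Y^t=\{(z,u,v)\in(\mathbb C^*)^n\times\mathbb C^2 : uv=W(z)\}.$$ Let $\operatorname{Log}(z)=(\log|z_1|,\dots,\log|z_n|)$, $\operatorname{Log}_t=\operatorname{Log}/\log t$, $\mu_0(z,u,v)=(\operatorname{Log}(z),\tfrac12|u|^2,\tfrac12|v|^2)$,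 and let $$\omega_0=\sum_i\frac{dz_i\wedge d\bar z_i}{|z_i|^2}+du\wedge d\bar u+dv\wedge d\bar v$$ be the standard symplectic form on $(\mathbb C^*)^n\times\mathbb C^2$ (up to the constant factor $-2\sqrt{-1}$). For $U\subset\mathbb R^n$ and $R>0$ write $B_t(R,U)=\mu_0^{-1}\big((\log t\cdot U)\times[0,R]^2\big)$. Write $A\Subset B$ if the closure of $A$ is compact and contained in $B$. Then for each $j$ there are open sets $U_j''\Subset U_j'\Subset U_j$ in $\mathbb R^n$, with $U_j''$ containing a nonempty relatively open subset of $F_j$, such that for all sufficiently small $t>0$ there are real numbers $R>R'>R''$ with $$R''>\max\Big\{\tfrac12\sup_{z\in\operatorname{Log}_t^{-1}(U_j)}\Big(1+\sum_{k=1}^p|t^{\lambda_k}z^{v_k}|\Big),\,1\Big\}$$ (the supremum being finite), and smooth cutoff functions $\tau:\mathbb C^2\to[0,1]$ and $\rho:(\mathbb C^*)^n\to[0,1]$, where $\tau=1$ if $\tfrac12|u|^2,\tfrac12|v|^2\le R''$, $\tau=0$ unless $\tfrac12|u|^2,\tfrac12|v|^2\le R'$, $\rho=1$ on $\operatorname{Log}_t^{-1}(U_j'')$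 and $\rho=0$ off $\operatorname{Log}_t^{-1}(U_j')$, such that, setting $$Y^t_j=Y^t\cap B_t(R,U_j),\qquad Y^t_{j,\mathrm{simple}}=\Big\{uv=W(z)-\tau(u,v)\rho(z)\sum_{k\ne j}t^{\lambda_k}z^{v_k}\Big\}\cap B_t(R,U_j),$$ the following hold. 1. $Y^t_j$ and $Y^t_{j,\mathrm{simple}}$ are smooth submanifolds (with boundary) of $(\mathbb C^*)^n\times\mathbb C^2$ of real codimension two on which $\omega_0$ restricts to symplectic forms, and there is a symplectomorphism $\Phi_j:Y^t_j\to Y^t_{j,\mathrm{simple}}$ for these induced forms. 2. $Y^t_{j,\mathrm{simple}}\cap B_t(R'',U_j'')=\{uv=1+t^{\lambda_j}z^{v_j}\}\cap B_t(R'',U_j'')$. 3. $\Phi_j$ is the identity on $Y^t_j\setminus B_t(R',U_j')$. 4. For every $x\in U_j\cap F_j$ the set $(x+\mathbb R v_j)\cap\operatorname{Log}_t\big(\{z : (z,0,0)\in Y^t_{j,\mathrm{simple}}\}\big)$ is nonempty and connected. -/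

import Mathlib

open Set
open scoped ContDiff Pointwise

noncomputable section

namespace HoriVafa

/-! ### The toric data -/

/-- The rational polyhedral cone spanned by the vectors `ray i`, `i ∈ σ`. -/
def coneOf {n p : ℕ} (ray : Fin p → Fin n → ℤ) (σ : Finset (Fin p)) : Set (Fin n → ℝ) :=
  {x | ∃ c : Fin p → ℝ, (∀ i, 0 ≤ c i) ∧ (∀ i, i ∉ σ → c i = 0) ∧
    x = ∑ i, c i • (fun l => (ray i l : ℝ))}

/-- A smooth complete fan in `ℝⁿ` with `p` rays, given by the primitive generators of its rays and
by the sets of rays of its maximal cones: the generators of each maximal cone are a `ℤ`-basis of the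
lattice, the maximal cones cover `ℝⁿ`, and two of them meet along their common face. -/
structure SmoothCompleteFan (n p : ℕ) where
  ray : Fin p → Fin n → ℤ
  maxCones : Finset (Finset (Fin p))
  linInd : ∀ σ ∈ maxCones, LinearIndependent ℤ (fun i : σ => ray i)
  spans : ∀ σ ∈ maxCones, Submodule.span ℤ (ray '' (σ : Set (Fin p))) = ⊤
  covers : ∀ x : Fin n → ℝ, ∃ σ ∈ maxCones, x ∈ coneOf ray σ
  inter : ∀ σ ∈ maxCones, ∀ σ' ∈ maxCones, coneOf ray σ ∩ coneOf ray σ' = coneOf ray (σ ∩ σ')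
  ray_mem : ∀ j, ∃ σ ∈ maxCones, j ∈ σ

/-- The pairing `⟨v, x⟩` of a lattice vector with a point of `ℝⁿ`. -/
def pairing {n : ℕ} (v : Fin n → ℤ) (x : Fin n → ℝ) : ℝ := ∑ i, (v i : ℝ) * x i

/-- The toric divisor `∑ lam j • D j` is ample: its support function is strictly convex, that is,
for each maximal cone `σ` the linear function agreeing with it on `σ` is strictly on one side of it
at the other ray generators. -/
def SmoothCompleteFan.IsAmple {n p : ℕ} (fan : SmoothCompleteFan n p) (lam : Fin p → ℝ) : Prop :=
  ∀ σ ∈ fan.maxCones, ∃ m : Fin n → ℝ,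
    (∀ i ∈ σ, pairing (fan.ray i) m = -lam i) ∧ ∀ k, k ∉ σ → -lam k < pairing (fan.ray k) m

/-- `χ_j(x) = λ_j + ⟨v_j, x⟩`. -/
def chi {n p : ℕ} (fan : SmoothCompleteFan n p) (lam : Fin p → ℝ) (j : Fin p)
    (x : Fin n → ℝ) : ℝ := lam j + pairing (fan.ray j) x

/-- The polytope `{x | χ_k(x) ≥ 0 for all k}`. -/
def polytope {n p : ℕ} (fan : SmoothCompleteFan n p) (lam : Fin p → ℝ) : Set (Fin n → ℝ) :=
  {x | ∀ k, 0 ≤ chi fan lam k x}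

/-- The facet of the polytope dual to the ray `j`. -/
def facet {n p : ℕ} (fan : SmoothCompleteFan n p) (lam : Fin p → ℝ) (j : Fin p) :
    Set (Fin n → ℝ) :=
  {x | x ∈ polytope fan lam ∧ chi fan lam j x = 0}

/-! ### The ambient space `(ℂ^*)ⁿ × ℂ²` -/

/-- Points `(z, u, v)` of `ℂⁿ × ℂ²`; the space `(ℂ^*)ⁿ × ℂ²` is the open subset `z ∈ torus n`. -/
abbrev Ambient (n : ℕ) : Type := (Fin n → ℂ) × ℂ × ℂ

/-- The complex torus `(ℂ^*)ⁿ`. -/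
def torus (n : ℕ) : Set (Fin n → ℂ) := {z | ∀ i, z i ≠ 0}

/-- `Log(z) = (log |z_1|, …, log |z_n|)`. -/
def logMap {n : ℕ} (z : Fin n → ℂ) : Fin n → ℝ := fun i => Real.log ‖z i‖

/-- `Log_t = Log / log t`. -/
def logMapT {n : ℕ} (t : ℝ) (z : Fin n → ℂ) : Fin n → ℝ := (Real.log t)⁻¹ • logMap z

/-- The moment map `(z, u, v) ↦ (Log z, |u|²/2, |v|²/2)`. -/
def momentMap {n : ℕ} (q : Ambient n) : (Fin n → ℝ) × ℝ × ℝ :=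
  (logMap q.1, ‖q.2.1‖ ^ 2 / 2, ‖q.2.2‖ ^ 2 / 2)

/-- The subset `μ₀⁻¹((log t · U) × [0,R]²)` of `(ℂ^*)ⁿ × ℂ²`. -/
def box {n : ℕ} (t R : ℝ) (U : Set (Fin n → ℝ)) : Set (Ambient n) :=
  {q | q.1 ∈ torus n ∧ momentMap q ∈ (Real.log t • U) ×ˢ (Icc 0 R ×ˢ Icc 0 R)}

/-- The form `ω₀ = ∑ dz_i ∧ dz̄_i / |z_i|² + du ∧ dū + dv ∧ dv̄` at the point `q`. It is `-2√-1` times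
a real symplectic form. -/
def omega {n : ℕ} (q ξ η : Ambient n) : ℂ :=
  (∑ i, (ξ.1 i * star (η.1 i) - η.1 i * star (ξ.1 i)) / ((‖q.1 i‖ : ℂ) ^ 2)) +
    (ξ.2.1 * star η.2.1 - η.2.1 * star ξ.2.1) + (ξ.2.2 * star η.2.2 - η.2.2 * star ξ.2.2)

/-- The tangent space at `q` of a subset `S` of the ambient space (the usual one if `S` is a
submanifold, with or without boundary). -/
def tangentAt {n : ℕ} (S : Set (Ambient n)) (q : Ambient n) : Submodule ℝ (Ambient n) :=
  Submodule.span ℝ (tangentConeAt ℝ S q)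

/-- `S` is a smooth submanifold of `(ℂ^*)ⁿ × ℂ²` of real codimension two, possibly with boundary, on
which `ω₀` induces a symplectic form: near each of its points it is the set `{F = 0, g ≤ 0}` where
`dF` is onto and, at a boundary point `g = 0`, `(dF, dg)` is onto; the restriction of
`ω₀` to each tangent space is nondegenerate. -/
def IsSymplecticSubmanifold {n : ℕ} (S : Set (Ambient n)) : Prop :=
  ∀ q ∈ S, q.1 ∈ torus n ∧
    (∃ (V : Set (Ambient n)) (F : Ambient n → ℂ) (g : Ambient n → ℝ),
      IsOpen V ∧ q ∈ V ∧ ContDiffOn ℝ ∞ F V ∧ ContDiffOn ℝ ∞ g V ∧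
      S ∩ V = {x | x ∈ V ∧ F x = 0 ∧ g x ≤ 0} ∧
      Function.Surjective (fderiv ℝ F q) ∧
      (g q = 0 → Function.Surjective ((fderiv ℝ F q).prod (fderiv ℝ g q)))) ∧
    ∀ ξ ∈ tangentAt S q, (∀ η ∈ tangentAt S q, omega q ξ η = 0) → ξ = 0

/-- `Φ` restricts to a symplectomorphism from `S` to `T`, with the forms induced by `ω₀`: a
diffeomorphism (smooth with a smooth inverse) with `Φ^* (ω₀|_T) = ω₀|_S`. On the tangent spaces
of `S` the derivative does not depend on the choice of `L`. -/
structure IsSymplectomorphism {n : ℕ} (S T : Set (Ambient n)) (Φ : Ambient n → Ambient n) :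
    Prop where
  source : IsSymplecticSubmanifold S
  target : IsSymplecticSubmanifold T
  bijOn : BijOn Φ S T
  smooth : ContDiffOn ℝ ∞ Φ S
  smooth_inv : ∃ Ψ : Ambient n → Ambient n, InvOn Ψ Φ S T ∧ ContDiffOn ℝ ∞ Ψ T
  pullback : ∀ q ∈ S, ∀ L : Ambient n →L[ℝ] Ambient n, HasFDerivWithinAt Φ L S q →
    ∀ ξ ∈ tangentAt S q, ∀ η ∈ tangentAt S q, omega (Φ q) (L ξ) (L η) = omega q ξ η

/-! ### The mirror and its simplification near a facet -/

/-- The term `t^{λ_k} z^{v_k}`. -/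
def term {n p : ℕ} (fan : SmoothCompleteFan n p) (lam : Fin p → ℝ) (t : ℝ) (k : Fin p)
    (z : Fin n → ℂ) : ℂ :=
  ((t ^ lam k : ℝ) : ℂ) * ∏ i, z i ^ fan.ray k i

/-- `W(z) = 1 + ∑_k t^{λ_k} z^{v_k}`. -/
def potential {n p : ℕ} (fan : SmoothCompleteFan n p) (lam : Fin p → ℝ) (t : ℝ)
    (z : Fin n → ℂ) : ℂ := 1 + ∑ k, term fan lam t k z

/-- The Hori-Vafa mirror `Y^t = {uv = W(z)}` in `(ℂ^*)ⁿ × ℂ²`. -/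
def mirror {n p : ℕ} (fan : SmoothCompleteFan n p) (lam : Fin p → ℝ) (t : ℝ) :
    Set (Ambient n) :=
  {q | q.1 ∈ torus n ∧ q.2.1 * q.2.2 = potential fan lam t q.1}

/-- The locus `uv = 1 + t^{λ_j} z^{v_j}` in `(ℂ^*)ⁿ × ℂ²`. -/
def binomialLocus {n p : ℕ} (fan : SmoothCompleteFan n p) (lam : Fin p → ℝ) (t : ℝ)
    (j : Fin p) : Set (Ambient n) :=
  {q | q.1 ∈ torus n ∧ q.2.1 * q.2.2 = 1 + term fan lam t j q.1}

/-- `W_j(u,v,z) = W(z) - τ(u,v) ρ(z) ∑_{k ≠ j} t^{λ_k} z^{v_k}`. -/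
def cutPotential {n p : ℕ} (fan : SmoothCompleteFan n p) (lam : Fin p → ℝ) (t : ℝ)
    (j : Fin p) (τ : ℂ × ℂ → ℝ) (ρ : (Fin n → ℂ) → ℝ) (q : Ambient n) : ℂ :=
  potential fan lam t q.1 -
    (τ q.2 : ℂ) * (ρ q.1 : ℂ) * ∑ k ∈ Finset.univ.erase j, term fan lam t k q.1

/-- The locus `uv = W_j(u,v,z)` in `(ℂ^*)ⁿ × ℂ²`. -/
def cutMirror {n p : ℕ} (fan : SmoothCompleteFan n p) (lam : Fin p → ℝ) (t : ℝ)
    (j : Fin p) (τ : ℂ × ℂ → ℝ) (ρ : (Fin n → ℂ) → ℝ) : Set (Ambient n) :=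
  {q | q.1 ∈ torus n ∧ q.2.1 * q.2.2 = cutPotential fan lam t j τ ρ q}

/-- `τ` is a smooth cutoff function on `ℂ²`, equal to `1` where `|u|²/2, |v|²/2 ≤ r` and to `0`
off the set where `|u|²/2, |v|²/2 ≤ r'`. -/
structure IsFiberCutoff (r r' : ℝ) (τ : ℂ × ℂ → ℝ) : Prop where
  smooth : ContDiff ℝ ∞ τ
  mem_Icc : ∀ w, τ w ∈ Icc (0 : ℝ) 1
  eq_one : ∀ w : ℂ × ℂ, ‖w.1‖ ^ 2 / 2 ≤ r → ‖w.2‖ ^ 2 / 2 ≤ r → τ w = 1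
  eq_zero : ∀ w : ℂ × ℂ, ¬ (‖w.1‖ ^ 2 / 2 ≤ r' ∧ ‖w.2‖ ^ 2 / 2 ≤ r') → τ w = 0

/-- `ρ` is a smooth cutoff function on `(ℂ^*)ⁿ`, equal to `1` on `Log_t⁻¹(U'')` and to `0` off
`Log_t⁻¹(U')`. -/
structure IsBaseCutoff {n : ℕ} (t : ℝ) (U'' U' : Set (Fin n → ℝ)) (ρ : (Fin n → ℂ) → ℝ) :
    Prop where
  smooth : ContDiffOn ℝ ∞ ρ (torus n)
  mem_Icc : ∀ z ∈ torus n, ρ z ∈ Icc (0 : ℝ) 1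
  eq_one : ∀ z ∈ torus n, logMapT t z ∈ U'' → ρ z = 1
  eq_zero : ∀ z ∈ torus n, logMapT t z ∉ U' → ρ z = 0

/-- The image under `Log_t` of `{z | (z, 0, 0) ∈ S}`. -/
def amoebaOf {n : ℕ} (t : ℝ) (S : Set (Ambient n)) : Set (Fin n → ℝ) :=
  logMapT t '' {z | z ∈ torus n ∧ ((z, 0, 0) : Ambient n) ∈ S}

/-- The line `x + ℝ v_j`. -/
def rayLine {n p : ℕ} (fan : SmoothCompleteFan n p) (j : Fin p) (x : Fin n → ℝ) :
    Set (Fin n → ℝ) :=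
  {y | ∃ s : ℝ, y = x + s • (fun i => (fan.ray j i : ℝ))}

/-- `A ⊂⊂ B`: the closure of `A` is compact and contained in `B`. -/
def RelCompactIn {n : ℕ} (A B : Set (Fin n → ℝ)) : Prop :=
  IsCompact (closure A) ∧ closure A ⊆ B

end HoriVafa

end

/-! Near a point of the relative interior of F_j one has χ_k ≥ δ > 0 for all k ≠ j. Since |t^{λ_k}
z^{v_k}| = exp(log t · χ_k(Log_t z)) (`norm_term`), every term except the j-th is at most t^δ there,
and so, up to constants, is its differential in logarithmic coordinates. In these coordinates ω₀ is
2i times a constant real form (`omega_eq`), and the mirror is a small perturbation of uv = 1 + w,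
where w = t^{λ_j} z^{v_j}.

Let N = τρ ∑_{k≠j} t^{λ_k} z^{v_k} and F_s = uv − W + sN, so that F_0 and F_1 define the mirror and
its simplification. A level set of F is symplectic where the Poisson bracket of Im F and Re F is
nonzero (`eq_zero_of_poisson_ne_zero`). For a complex linear form this bracket is the sum of the
squared moduli of the coefficients (`poisson_complexForm`). The leading coefficients of dF_s are −w
v_j, v and u, which cannot all be small when uv is close to 1 + w (`one_div_four_le_coeffSq`). Hence
the bracket P_s of F_s is at least 1/8 near {F_s = 0} for every s in [0,1] (`poisson_family_ge`).

Parallel transport is carried out in the ambient space, not on the hypersurfaces. Take H_s =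
κ(P_s)(Re N · Im F_s − Im N · Re F_s), where κ is smooth and κ(x) = 1/x for x ≥ 1/8. Its Hamiltonian
field X_s satisfies dF_s(X_s) = −N up to an error of at most C|F_s|. Along the flow, F_s then obeys
|dF_s/ds| ≤ C|F_s|, so that a trajectory on which F_s vanishes at one time has F_s = 0 at all times,
and {F_0 = 0} is carried onto {F_1 = 0} (`IsTransportData.transports`). As N has compact support,
the flow is the identity outside the support and preserves B_t(R, U_j); being Hamiltonian it
preserves ω₀. A smooth flow over a short time comes from inverting a near-identity map on a space of
paths (`exists_flow`); longer times are reached by composition.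

The boundary of the pieces has no corners, because |uv| stays below 2R on the hypersurfaces
(`isSymplecticSubmanifold_family`).

For the amoeba, put u = v = 0. On the line x + ℝv_j the equation becomes exp ζ = 1 + (small), where
ζ is the logarithmic coordinate along v_j, with one small solution ζ(θ) for each argument vector θ
with ⟨v_j, θ⟩ = π. The slice of the amoeba is thus a continuous image of an affine hyperplane
(`isConnected_rayLine_inter_amoebaOf`). -/

noncomputable section

namespace HoriVafa

/-! ### Composition operators on spaces of continuous functions -/

section Nemytskii

universe u
variable {K : Type*} [TopologicalSpace K] [CompactSpace K]
variable {E F : Type u} [NormedAddCommGroup E] [NormedSpace ℝ E]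
  [NormedAddCommGroup F] [NormedSpace ℝ F]

/-- Pointwise application of a continuous family of operators to a continuous family of vectors. -/
def pointwiseApply : C(K, E →L[ℝ] F) →L[ℝ] C(K, E) →L[ℝ] C(K, F) :=
  LinearMap.mkContinuous₂
    (LinearMap.mk₂ ℝ (fun (A : C(K, E →L[ℝ] F)) (h : C(K, E)) =>
        (⟨fun s => A s (h s), A.continuous.clm_apply h.continuous⟩ : C(K, F)))
      (fun A B h => by ext; simp) (fun c A h => by ext; simp)
      (fun A h k => by ext; simp) (fun c A h => by ext; simp)) 1
    (fun A h => by
      rw [one_mul]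
      refine (ContinuousMap.norm_le _ (by positivity)).2 fun s => ?_
      exact (A s).le_of_opNorm_le_of_le (A.norm_coe_le_norm s) (h.norm_coe_le_norm s))

@[simp] theorem pointwiseApply_apply (A : C(K, E →L[ℝ] F)) (h : C(K, E)) (s : K) :
    pointwiseApply A h s = A s (h s) := rfl

/-- The derivative of f is uniformly continuous near the compact range of γ, so the mean value
inequality bounds the remainder uniformly in the parameter. -/
theorem hasFDerivAt_comp_continuousMap (f : C(E, F)) (f' : C(E, E →L[ℝ] F))
    (hf : ∀ x, HasFDerivAt f (f' x) x) (γ : C(K, E)) :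
    HasFDerivAt (fun γ : C(K, E) => f.comp γ) (pointwiseApply (f'.comp γ)) γ := by
  rw [hasFDerivAt_iff_isLittleO_nhds_zero, Asymptotics.isLittleO_iff]
  intro c hc
  have hcpt : IsCompact (range γ) := isCompact_range γ.continuous
  have := hcpt.uniformContinuousAt_of_continuousAt f' (fun a _ => f'.continuous.continuousAt)
    (Metric.dist_mem_uniformity hc)
  obtain ⟨δ, hδ, hδ'⟩ := Metric.mem_uniformity_dist.1 this
  filter_upwards [Metric.ball_mem_nhds (0 : C(K, E)) hδ] with h hh
  refine (ContinuousMap.norm_le _ (by positivity)).2 fun s => ?_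
  simp only [ContinuousMap.sub_apply, ContinuousMap.comp_apply, ContinuousMap.add_apply,
    pointwiseApply_apply]
  have hh' : ‖h‖ < δ := by simpa using hh
  have key : ∀ x ∈ Metric.ball (γ s) δ, ‖f' x - f' (γ s)‖ ≤ c := by
    intro x hx
    have := hδ' (a := γ s) (b := x) (by rwa [dist_comm]) (mem_range_self s)
    simp only [mem_ofPred_eq] at this
    rw [← dist_eq_norm, dist_comm]; exact this.le
  have hmem : γ s + h s ∈ Metric.ball (γ s) δ := by
    simpa using (h.norm_coe_le_norm s).trans_lt hh'
  have := (convex_ball (γ s) δ).norm_image_sub_le_of_norm_hasFDerivWithin_le'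
    (fun x _ => (hf x).hasFDerivWithinAt) key (Metric.mem_ball_self hδ) hmem
  simp only [add_sub_cancel_left] at this
  exact this.trans (by gcongr; exact h.norm_coe_le_norm s)

/-- The derivative of a composition operator is the composition operator of the derivative, followed
by a continuous bilinear map. The induction therefore replaces F by E →L F, for which E and F have
to share a universe. -/
theorem contDiff_comp_continuousMap_nat (m : ℕ) : ∀ {F : Type u} [NormedAddCommGroup F]
    [NormedSpace ℝ F] (f : C(E, F)), ContDiff ℝ m f →
      ContDiff ℝ m (fun γ : C(K, E) => f.comp γ) := by
  induction m with
  | zero =>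
    intro F _ _ f _
    exact contDiff_zero.2 (ContinuousMap.continuous_postcomp f)
  | succ m ih =>
    intro F _ _ f hf
    have h1 : ContDiff ℝ m (fderiv ℝ f) := hf.fderiv_right (by norm_cast)
    let f' : C(E, E →L[ℝ] F) := ⟨fderiv ℝ f, h1.continuous⟩
    have hd : ∀ x, HasFDerivAt f (f' x) x := fun x =>
      ((hf.differentiable (by simp)) x).hasFDerivAt
    have hd' := hasFDerivAt_comp_continuousMap (K := K) f f' hd
    have : ContDiff ℝ ((m : WithTop ℕ∞) + 1) (fun γ : C(K, E) => f.comp γ) := by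
      rw [contDiff_succ_iff_fderiv]
      refine ⟨fun γ => (hd' γ).differentiableAt, by simp, ?_⟩
      have : fderiv ℝ (fun γ : C(K, E) => f.comp γ) =
          fun γ => pointwiseApply (f'.comp γ) := funext fun γ => (hd' γ).fderiv
      rw [this]
      exact pointwiseApply.contDiff.comp (ih f' h1)
    exact_mod_cast this

theorem contDiff_comp_continuousMap (f : C(E, F)) (hf : ContDiff ℝ ∞ f) :
    ContDiff ℝ ∞ (fun γ : C(K, E) => f.comp γ) :=
  contDiff_infty.2 fun m => contDiff_comp_continuousMap_nat m f (contDiff_infty.1 hf m)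

end Nemytskii

/-! ### Small perturbations of the identity -/

section Perturbation

variable {E : Type*} [NormedAddCommGroup E] [NormedSpace ℝ E] [CompleteSpace E]

/-- A smooth map `f` with `f - id` a contraction is a diffeomorphism. -/
theorem exists_smooth_inverse_of_lipschitz_sub_id {f : E → E} (hf : ContDiff ℝ ∞ f)
    {c : NNReal} (hc : c < 1) (hl : LipschitzWith c (fun x => f x - x)) :
    ∃ g : E → E, ContDiff ℝ ∞ g ∧ Function.LeftInverse g f ∧ Function.RightInverse g f := by
  have happ : ApproximatesLinearOn f ((ContinuousLinearEquiv.refl ℝ E : E ≃L[ℝ] E) : E →L[ℝ] E)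
      univ c := by
    rw [ApproximatesLinearOn.approximatesLinearOn_iff_lipschitzOnWith]
    exact (lipschitzOnWith_univ.2 hl)
  have hcond : Subsingleton E ∨
      c < ‖((ContinuousLinearEquiv.refl ℝ E).symm : E →L[ℝ] E)‖₊⁻¹ := by
    rcases subsingleton_or_nontrivial E with h | h
    · exact Or.inl h
    · right
      have : ((ContinuousLinearEquiv.refl ℝ E).symm : E →L[ℝ] E) = ContinuousLinearMap.id ℝ E := rfl
      rw [this]
      simpa using hc
  let e : E ≃ₜ E := happ.toHomeomorph f hcond
  have he : (e : E → E) = f := rfl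
  have hdiff : ∀ a, HasFDerivAt f (fderiv ℝ f a) a := fun a =>
    ((hf.differentiable (by simp)) a).hasFDerivAt
  have hnorm : ∀ a, ‖fderiv ℝ f a - 1‖ < 1 := by
    intro a
    have h1 : HasFDerivAt (fun x => f x - x) (fderiv ℝ f a - 1) a :=
      (hdiff a).sub (hasFDerivAt_id a)
    have := h1.le_of_lipschitz hl
    exact this.trans_lt (by exact_mod_cast hc)
  -- The derivative differs from the identity by less than 1 in norm, hence is invertible by the
  -- Neumann series.
  let f₀ : E → E ≃L[ℝ] E := fun a =>
    ContinuousLinearEquiv.unitsEquiv ℝ E (Units.oneSub (1 - fderiv ℝ f a) (by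
      rw [norm_sub_rev]; exact hnorm a))
  have hf₀ : ∀ a, ((f₀ a : E ≃L[ℝ] E) : E →L[ℝ] E) = fderiv ℝ f a := by
    intro a; ext x
    simp [f₀, ContinuousLinearEquiv.unitsEquiv_apply]
  refine ⟨e.symm, ?_, fun x => e.symm_apply_apply x, fun x => e.apply_symm_apply x⟩
  exact e.contDiff_symm (f₀' := f₀) (fun a => by rw [he, hf₀]; exact hdiff a) hf

end Perturbation

/-! ### Flows of time-dependent vector fields over short times -/

section Flow

variable {V : Type} [NormedAddCommGroup V] [NormedSpace ℝ V]

/-- The primitive vanishing at `0` of a continuous function on `[0,1]`. -/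
def primitive : C(Icc (0 : ℝ) 1, V) →L[ℝ] C(Icc (0 : ℝ) 1, V) :=
  LinearMap.mkContinuous
    { toFun := fun h => ⟨fun t => ∫ s in (0 : ℝ)..t, IccExtend zero_le_one h s, by
        have hc : Continuous (IccExtend (zero_le_one (α := ℝ)) h) := h.continuous.Icc_extend'
        exact (intervalIntegral.continuous_primitive (fun a b => hc.intervalIntegrable a b) 0).comp
          continuous_subtype_val⟩
      map_add' := fun h k => by
        ext t
        have hc : Continuous (IccExtend (zero_le_one (α := ℝ)) h) := h.continuous.Icc_extend'
        have kc : Continuous (IccExtend (zero_le_one (α := ℝ)) k) := k.continuous.Icc_extend'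
        exact intervalIntegral.integral_add (hc.intervalIntegrable _ _) (kc.intervalIntegrable _ _)
      map_smul' := fun c h => by
        ext t
        exact intervalIntegral.integral_smul c _ } 1
    (fun h => by
      rw [one_mul]
      refine (ContinuousMap.norm_le _ (by positivity)).2 fun t => ?_
      have := intervalIntegral.norm_integral_le_of_norm_le_const (a := 0) (b := (t : ℝ))
        (f := IccExtend (zero_le_one (α := ℝ)) h) (C := ‖h‖)
        (fun s _ => h.norm_coe_le_norm _)
      refine this.trans ?_
      rw [sub_zero, abs_of_nonneg t.2.1]
      exact mul_le_of_le_one_right (norm_nonneg _) t.2.2)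

theorem primitive_apply (h : C(Icc (0 : ℝ) 1, V)) (t : Icc (0 : ℝ) 1) :
    primitive h t = ∫ s in (0 : ℝ)..t, IccExtend zero_le_one h s := rfl

theorem norm_primitive_le (h : C(Icc (0 : ℝ) 1, V)) : ‖primitive h‖ ≤ ‖h‖ := by
  have := (primitive (V := V)).le_of_opNorm_le (LinearMap.mkContinuous_norm_le _ zero_le_one _) h
  simpa using this

theorem hasDerivWithinAt_primitive [CompleteSpace V] (h : C(Icc (0 : ℝ) 1, V)) {s : ℝ} (hs : s ∈ Icc (0 : ℝ) 1) :
    HasDerivWithinAt (fun t => primitive h (projIcc 0 1 zero_le_one t)) (h ⟨s, hs⟩)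
      (Icc 0 1) s := by
  have hc : Continuous (IccExtend (zero_le_one (α := ℝ)) h) := h.continuous.Icc_extend'
  have h1 := (intervalIntegral.integral_hasDerivAt_right (hc.intervalIntegrable 0 s)
    (hc.stronglyMeasurableAtFilter _ _) hc.continuousAt).hasDerivWithinAt (s := Icc 0 1)
  rw [IccExtend_of_mem _ _ hs] at h1
  refine h1.congr (fun t ht => ?_) ?_
  · rw [primitive_apply, projIcc_of_mem _ ht]
  · rw [primitive_apply, projIcc_of_mem _ hs]

/-- Constant paths. -/
def constPath : V →L[ℝ] C(Icc (0 : ℝ) 1, V) :=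
  LinearMap.mkContinuous
    { toFun := fun q => ContinuousMap.const _ q
      map_add' := fun _ _ => rfl
      map_smul' := fun _ _ => rfl } 1
    (fun q => by
      rw [one_mul]
      exact (ContinuousMap.norm_le _ (by positivity)).2 fun t => le_rfl)

@[simp] theorem constPath_apply (q : V) (t : Icc (0 : ℝ) 1) : constPath q t = q := rfl

theorem norm_constPath_le (q : V) : ‖constPath q‖ ≤ ‖q‖ :=
  (ContinuousMap.norm_le _ (by positivity)).2 fun _ => le_rfl

/-- The graph `s ↦ (s, γ s)` of a path. -/
def graphPath (γ : C(Icc (0 : ℝ) 1, V)) : C(Icc (0 : ℝ) 1, ℝ × V) :=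
  (⟨Subtype.val, continuous_subtype_val⟩ : C(Icc (0 : ℝ) 1, ℝ)).prodMk γ

theorem hasFDerivAt_graphPath (γ : C(Icc (0 : ℝ) 1, V)) :
    HasFDerivAt graphPath
      ((ContinuousLinearMap.inr ℝ ℝ V).compLeftContinuous ℝ (Icc (0 : ℝ) 1)) γ := by
  have : (graphPath : C(Icc (0 : ℝ) 1, V) → _) = fun γ =>
      (ContinuousLinearMap.inr ℝ ℝ V).compLeftContinuous ℝ (Icc (0 : ℝ) 1) γ +
        graphPath 0 := by
    funext γ; ext s <;> simp [graphPath]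
  rw [this]
  exact (ContinuousLinearMap.hasFDerivAt _).add_const _

theorem contDiff_graphPath : ContDiff ℝ ∞ (graphPath (V := V)) := by
  have : (graphPath : C(Icc (0 : ℝ) 1, V) → _) = fun γ =>
      (ContinuousLinearMap.inr ℝ ℝ V).compLeftContinuous ℝ (Icc (0 : ℝ) 1) γ +
        graphPath 0 := by
    funext γ; ext s <;> simp [graphPath]
  rw [this]
  exact (ContinuousLinearMap.contDiff _).add contDiff_const

/-- A smooth time-dependent vector field with small Lipschitz constant has a flow on `[0,1]`, whose
time-one map is a diffeomorphism and whose derivative solves the variational equation. -/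
theorem exists_flow [CompleteSpace V] (Y : ℝ × V → V) (hY : ContDiff ℝ ∞ Y)
    (hL : ∀ s ∈ Icc (0 : ℝ) 1, ∀ q q', ‖Y (s, q) - Y (s, q')‖ ≤ 1 / 4 * ‖q - q'‖) :
    ∃ (φ : ℝ → V → V) (J : ℝ → V → V → V) (Ψ : V → V),
      (∀ q, φ 0 q = q) ∧
      (∀ q, ∀ s ∈ Icc (0 : ℝ) 1, HasDerivWithinAt (fun s => φ s q) (Y (s, φ s q)) (Icc 0 1) s) ∧
      ContDiff ℝ ∞ (φ 1) ∧ ContDiff ℝ ∞ Ψ ∧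
      Function.LeftInverse Ψ (φ 1) ∧ Function.RightInverse Ψ (φ 1) ∧
      (∀ q ξ, J 0 q ξ = ξ) ∧ (∀ q ξ, J 1 q ξ = fderiv ℝ (φ 1) q ξ) ∧
      ∀ q ξ, ∀ s ∈ Icc (0 : ℝ) 1, HasDerivWithinAt (fun s => J s q ξ)
        (fderiv ℝ Y (s, φ s q) (0, J s q ξ)) (Icc 0 1) s := by
  let Yc : C(ℝ × V, V) := ⟨Y, hY.continuous⟩
  let Y' : C(ℝ × V, ℝ × V →L[ℝ] V) := ⟨fderiv ℝ Y, hY.continuous_fderiv (by simp)⟩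
  have hY' : ∀ x, HasFDerivAt Yc (Y' x) x := fun x =>
    ((hY.differentiable (by simp)) x).hasFDerivAt
  let N : C(Icc (0 : ℝ) 1, V) → C(Icc (0 : ℝ) 1, V) := fun γ => Yc.comp (graphPath γ)
  have hN : ContDiff ℝ ∞ N := (contDiff_comp_continuousMap Yc hY).comp contDiff_graphPath
  have hNl : ∀ γ δ, ‖N γ - N δ‖ ≤ 1 / 4 * ‖γ - δ‖ := by
    intro γ δ
    refine (ContinuousMap.norm_le _ (by positivity)).2 fun s => ?_
    exact (hL s s.2 (γ s) (δ s)).trans (by gcongr; exact (γ - δ).norm_coe_le_norm s)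
  -- The integral equation γ = q + ∫ Y(s, γ) reads T γ = `constPath q`. As T − id is a contraction,
  -- T has a smooth inverse S, and S(`constPath q`) is the trajectory of q, depending smoothly on q.
  let T : C(Icc (0 : ℝ) 1, V) → C(Icc (0 : ℝ) 1, V) := fun γ => γ - primitive (N γ)
  have hT : ContDiff ℝ ∞ T := contDiff_id.sub ((primitive (V := V)).contDiff.comp hN)
  have hTl : LipschitzWith (1 / 4) (fun γ => T γ - γ) := by
    refine LipschitzWith.of_dist_le_mul fun γ δ => ?_
    rw [dist_eq_norm, dist_eq_norm]
    have : T γ - γ - (T δ - δ) = primitive (N δ - N γ) := by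
      simp only [T, map_sub]; abel
    rw [this, norm_sub_rev γ δ]
    refine (norm_primitive_le _).trans ((hNl δ γ).trans (le_of_eq ?_))
    norm_num
  obtain ⟨S, hS, hST, hTS⟩ := exists_smooth_inverse_of_lipschitz_sub_id hT
    (by rw [← NNReal.coe_lt_coe]; norm_num) hTl
  have hSeq : ∀ c, S c = c + primitive (N (S c)) := fun c => by
    have := hTS c
    simp only [T] at this
    rw [sub_eq_iff_eq_add] at this
    exact this
  have hSl : ∀ c d, ‖S c - S d‖ ≤ 4 / 3 * ‖c - d‖ := by
    intro c d
    have h1 : S c - S d = (c - d) + primitive (N (S c) - N (S d)) := by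
      conv_lhs => rw [hSeq c, hSeq d]
      rw [map_sub]; abel
    have h2 := norm_add_le (c - d) (primitive (N (S c) - N (S d)))
    rw [← h1] at h2
    have h3 := (norm_primitive_le (N (S c) - N (S d))).trans (hNl (S c) (S d))
    linarith
  -- Differentiating S c = c + ∫ N(S c) gives the variational equation in integrated form; this is
  -- `hdS` below.
  let dS : V → V → C(Icc (0 : ℝ) 1, V) := fun q ξ => fderiv ℝ S (constPath q) (constPath ξ)
  let DN : C(Icc (0 : ℝ) 1, V) → C(Icc (0 : ℝ) 1, V) → C(Icc (0 : ℝ) 1, V) := fun γ h =>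
    pointwiseApply (Y'.comp (graphPath γ))
      ((ContinuousLinearMap.inr ℝ ℝ V).compLeftContinuous ℝ (Icc (0 : ℝ) 1) h)
  have hSd : ∀ c, HasFDerivAt S (fderiv ℝ S c) c := fun c =>
    ((hS.differentiable (by simp)) c).hasFDerivAt
  have hdS : ∀ q ξ, dS q ξ = constPath ξ + primitive (DN (S (constPath q)) (dS q ξ)) := by
    intro q ξ
    have h1 := (hasFDerivAt_comp_continuousMap (K := Icc (0 : ℝ) 1) Yc Y' hY'
      (graphPath (S (constPath q)))).comp (constPath q) ((hasFDerivAt_graphPath (S (constPath q))).comp (constPath q) (hSd (constPath q)))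
    have h2 := (hasFDerivAt_id (𝕜 := ℝ) (constPath q)).add
      ((primitive (V := V)).hasFDerivAt.comp _ h1)
    have h3 : S = fun c => c + primitive (N (S c)) := funext hSeq
    have h4 := (hSd (constPath q)).unique (h2.congr_of_eventuallyEq
      (Filter.Eventually.of_forall fun c => hSeq c))
    have h5 := congrArg (fun L => L (constPath ξ)) h4
    exact h5
  let φ : ℝ → V → V := fun t q => S (constPath q) (projIcc 0 1 zero_le_one t)
  let J : ℝ → V → V → V := fun t q ξ => dS q ξ (projIcc 0 1 zero_le_one t)
  have hev : ∀ t : Icc (0 : ℝ) 1, ContDiff ℝ ∞ (fun γ : C(Icc (0 : ℝ) 1, V) => γ t) := fun t =>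
    (ContinuousMap.evalCLM ℝ t : C(Icc (0 : ℝ) 1, V) →L[ℝ] V).contDiff
  have hφs : ∀ t, ContDiff ℝ ∞ (φ t) := fun t =>
    (hev (projIcc 0 1 zero_le_one t)).comp (hS.comp (constPath (V := V)).contDiff)
  -- The constant is 1/4 from the field times 4/3 from S. Being below 1, it makes the time-one map a
  -- diffeomorphism.
  have hφl : LipschitzWith (1 / 3) (fun q => φ 1 q - q) := by
    refine LipschitzWith.of_dist_le_mul fun q q' => ?_
    rw [dist_eq_norm, dist_eq_norm]
    have h0 : ∀ q, φ 1 q - q = primitive (N (S (constPath q))) (projIcc 0 1 zero_le_one 1) := by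
      intro q
      have := congrArg (fun γ => γ (projIcc 0 1 zero_le_one 1)) (hSeq (constPath q))
      simp only [ContinuousMap.add_apply, constPath_apply] at this
      simp only [φ]
      rw [this, add_sub_cancel_left]
    rw [h0, h0, ← ContinuousMap.sub_apply, ← map_sub]
    refine (ContinuousMap.norm_coe_le_norm _ _).trans ((norm_primitive_le _).trans
      ((hNl _ _).trans ?_))
    have h1 := hSl (constPath q) (constPath q')
    rw [← map_sub] at h1
    have h2 := norm_constPath_le (q - q')
    push_cast
    linarith
  obtain ⟨Ψ, hΨ, hl, hr⟩ := exists_smooth_inverse_of_lipschitz_sub_id (hφs 1)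
    (by rw [← NNReal.coe_lt_coe]; norm_num) hφl
  have hz : ∀ h : C(Icc (0 : ℝ) 1, V), primitive h (projIcc 0 1 zero_le_one 0) = 0 := fun h => by
    simp [primitive_apply]
  refine ⟨φ, J, Ψ, fun q => ?_, fun q s hs => ?_, hφs 1, hΨ, hl, hr, fun q ξ => ?_,
    fun q ξ => ?_, fun q ξ s hs => ?_⟩
  · have := congrArg (fun γ => γ (projIcc 0 1 zero_le_one 0)) (hSeq (constPath q))
    simp only [ContinuousMap.add_apply, constPath_apply, hz, add_zero] at this
    exact this
  · have h1 := (hasDerivWithinAt_primitive (N (S (constPath q))) hs).const_add q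
    have h2 : N (S (constPath q)) ⟨s, hs⟩ = Y (s, φ s q) := by
      simp only [φ, projIcc_of_mem _ hs]; rfl
    rw [h2] at h1
    refine h1.congr (fun t _ => ?_) ?_ <;>
    · simp only [φ]
      conv_lhs => rw [hSeq (constPath q)]
      rfl
  · have := congrArg (fun γ => γ (projIcc 0 1 zero_le_one 0)) (hdS q ξ)
    simp only [ContinuousMap.add_apply, constPath_apply, hz, add_zero] at this
    exact this
  · have h1 := ((ContinuousMap.evalCLM ℝ (projIcc (0 : ℝ) 1 zero_le_one 1)).hasFDerivAt.comp q
      ((hSd (constPath q)).comp q (constPath (V := V)).hasFDerivAt))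
    have h2 := h1.fderiv
    exact (congrArg (fun L => L ξ) h2).symm
  · have h1 := (hasDerivWithinAt_primitive (DN (S (constPath q)) (dS q ξ)) hs).const_add ξ
    have h2 : DN (S (constPath q)) (dS q ξ) ⟨s, hs⟩ =
        fderiv ℝ Y (s, φ s q) (0, J s q ξ) := by
      simp only [φ, J, projIcc_of_mem _ hs]; rfl
    rw [h2] at h1
    refine h1.congr (fun t _ => ?_) ?_ <;>
    · simp only [J]
      conv_lhs => rw [hdS q ξ]
      rfl

theorem eq_zero_of_norm_deriv_le_right {E : Type*} [NormedAddCommGroup E] [NormedSpace ℝ E]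
    {g g' : ℝ → E} {C : ℝ} (hg : ∀ s ∈ Icc (0 : ℝ) 1, HasDerivWithinAt g (g' s) (Icc 0 1) s)
    (hC : ∀ s ∈ Icc (0 : ℝ) 1, ‖g' s‖ ≤ C * ‖g s‖) {s₀ : ℝ} (hs₀ : s₀ ∈ Icc (0 : ℝ) 1)
    (h0 : g s₀ = 0) : ∀ s ∈ Icc s₀ 1, g s = 0 := by
  refine eq_zero_of_abs_deriv_le_mul_abs_self_of_eq_zero_right (f := g) (f' := g') (K := C)
    (a := s₀) (b := 1) ?_ ?_ h0 ?_
  · exact fun x hx => ((hg x ⟨hs₀.1.trans hx.1, hx.2⟩).continuousWithinAt).mono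
      (Icc_subset_Icc hs₀.1 le_rfl)
  · intro x hx
    refine (hg x ⟨hs₀.1.trans hx.1, hx.2.le⟩).mono_of_mem_nhdsWithin ?_
    exact Filter.mem_of_superset (Icc_mem_nhdsGE hx.2)
      (Icc_subset_Icc (hs₀.1.trans hx.1) le_rfl)
  · exact fun x hx => hC x ⟨hs₀.1.trans hx.1, hx.2.le⟩

/-- A solution of a homogeneous linear differential inequality vanishing somewhere vanishes. -/
theorem eq_zero_of_norm_deriv_le {E : Type*} [NormedAddCommGroup E] [NormedSpace ℝ E]
    {g g' : ℝ → E} {C : ℝ} (hg : ∀ s ∈ Icc (0 : ℝ) 1, HasDerivWithinAt g (g' s) (Icc 0 1) s)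
    (hC : ∀ s ∈ Icc (0 : ℝ) 1, ‖g' s‖ ≤ C * ‖g s‖) {s₀ : ℝ} (hs₀ : s₀ ∈ Icc (0 : ℝ) 1)
    (h0 : g s₀ = 0) : ∀ s ∈ Icc (0 : ℝ) 1, g s = 0 := by
  intro s hs
  rcases le_total s₀ s with h | h
  · exact eq_zero_of_norm_deriv_le_right hg hC hs₀ h0 s ⟨h, hs.2⟩
  -- Times before s₀ are reached by reversing time.
  · have hm : MapsTo (fun x : ℝ => 1 - x) (Icc 0 1) (Icc 0 1) := fun x hx =>
      ⟨by linarith [hx.2], by linarith [hx.1]⟩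
    have hd : ∀ x ∈ Icc (0 : ℝ) 1, HasDerivWithinAt (fun x => g (1 - x)) (-g' (1 - x))
        (Icc 0 1) x := by
      intro x hx
      have h1 : HasDerivWithinAt (fun x : ℝ => 1 - x) (-1) (Icc 0 1) x :=
        ((hasDerivAt_id x).const_sub 1).hasDerivWithinAt
      have h2 := (hg (1 - x) (hm hx)).scomp x h1 hm
      rw [neg_one_smul] at h2
      exact h2
    have := eq_zero_of_norm_deriv_le_right hd (C := C)
      (fun x hx => by rw [norm_neg]; exact hC _ (hm hx)) (hm hs₀) (by simpa using h0)
      (1 - s) ⟨by linarith, by linarith [hs.1]⟩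
    simpa using this

end Flow

/-! ### Linear symplectic algebra on the ambient space -/

section Symplectic

variable {n : ℕ}

/-- The constant symplectic form `Im ∑ ξ_i η̄_i`. -/
def sympl : Ambient n →ₗ[ℝ] Ambient n →ₗ[ℝ] ℝ :=
  LinearMap.mk₂ ℝ (fun ξ η => (∑ i, (ξ.1 i * star (η.1 i)).im) + (ξ.2.1 * star η.2.1).im +
      (ξ.2.2 * star η.2.2).im)
    (fun ξ ξ' η => by simp [add_mul, Finset.sum_add_distrib]; ring)
    (fun c ξ η => by simp [Finset.mul_sum, mul_add, mul_assoc])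
    (fun ξ η η' => by simp [mul_add, Finset.sum_add_distrib]; ring)
    (fun c ξ η => by
      simp only [Prod.smul_fst, Prod.smul_snd, Pi.smul_apply, star_smul, star_trivial,
        mul_smul_comm, Complex.smul_im, smul_eq_mul, Finset.mul_sum, mul_add])

theorem sympl_apply (ξ η : Ambient n) : sympl ξ η =
    (∑ i, (ξ.1 i * star (η.1 i)).im) + (ξ.2.1 * star η.2.1).im + (ξ.2.2 * star η.2.2).im := rfl

theorem sympl_antisymm (ξ η : Ambient n) : sympl ξ η = -sympl η ξ := by
  have h : ∀ z w : ℂ, (z * star w).im = -(w * star z).im := fun z w => by simp; ring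
  rw [sympl_apply, sympl_apply, h ξ.2.1, h ξ.2.2, Finset.sum_congr rfl fun i _ => h (ξ.1 i) _,
    Finset.sum_neg_distrib]
  ring

theorem sympl_self (ξ : Ambient n) : sympl ξ ξ = 0 := by
  linarith [sympl_antisymm ξ ξ]

theorem hasDerivWithinAt_sympl {y₁ y₂ : ℝ → Ambient n} {y₁' y₂' : Ambient n} {s : ℝ} {S : Set ℝ}
    (h₁ : HasDerivWithinAt y₁ y₁' S s) (h₂ : HasDerivWithinAt y₂ y₂' S s) :
    HasDerivWithinAt (fun s => sympl (y₁ s) (y₂ s)) (sympl y₁' (y₂ s) + sympl (y₁ s) y₂') S s := by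
  have := (LinearMap.toContinuousBilinearMap (sympl (n := n))).hasFDerivWithinAt_of_bilinear
    h₁.hasFDerivWithinAt h₂.hasFDerivWithinAt
  refine this.hasDerivWithinAt.congr_deriv ?_
  simp [add_comm]

/-- The coordinate vectors. -/
def basisZ (i : Fin n) : Ambient n := (Pi.single i 1, 0, 0)
def basisU : Ambient n := (0, 1, 0)
def basisV : Ambient n := (0, 0, 1)

theorem eq_sum_basis (η : Ambient n) : η = (∑ i, η.1 i • basisZ i) + η.2.1 • basisU +
    η.2.2 • basisV := by
  refine Prod.ext ?_ (Prod.ext ?_ ?_)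
  · ext l
    simp [basisZ, basisU, basisV, Prod.fst_sum, Finset.sum_apply, Pi.single_apply]
  · simp [basisZ, basisU, basisV, Prod.snd_sum]
  · simp [basisZ, basisU, basisV, Prod.snd_sum]

/-- The coordinate of a symplectic gradient along the complex line spanned by `e`. -/
def gradCoord (e : Ambient n) : (Ambient n →L[ℝ] ℝ) →L[ℝ] ℂ :=
  Complex.I • (Complex.ofRealCLM ∘L ContinuousLinearMap.apply ℝ ℝ e) -
    Complex.ofRealCLM ∘L ContinuousLinearMap.apply ℝ ℝ (Complex.I • e)

theorem gradCoord_apply (e : Ambient n) (ℓ : Ambient n →L[ℝ] ℝ) :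
    gradCoord e ℓ = Complex.I * ℓ e - ℓ (Complex.I • e) := by
  simp [gradCoord]

theorem im_gradCoord_mul (e : Ambient n) (ℓ : Ambient n →L[ℝ] ℝ) (w : ℂ) :
    (gradCoord e ℓ * star w).im = ℓ (w • e) := by
  have : w • e = w.re • e + w.im • (Complex.I • e) := by
    conv_lhs => rw [← Complex.re_add_im w]
    rw [add_smul, mul_smul]
    simp
  rw [this, map_add, map_smul, map_smul, gradCoord_apply]
  simp
  ring

/-- The symplectic gradient. -/
def sgrad : (Ambient n →L[ℝ] ℝ) →L[ℝ] Ambient n :=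
  (ContinuousLinearMap.pi fun i => gradCoord (basisZ i)).prod
    ((gradCoord basisU).prod (gradCoord basisV))

theorem sympl_sgrad (ℓ : Ambient n →L[ℝ] ℝ) (η : Ambient n) : sympl (sgrad ℓ) η = ℓ η := by
  conv_rhs => rw [eq_sum_basis η]
  simp only [map_add, map_sum, ← im_gradCoord_mul]
  rfl

/-- Nondegeneracy of `sympl`: pairing ξ with iξ gives −|ξ|². -/
theorem eq_sgrad_of_forall (ξ : Ambient n) (ℓ : Ambient n →L[ℝ] ℝ)
    (h : ∀ η, sympl ξ η = ℓ η) : ξ = sgrad ℓ := by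
  have hnd : ∀ ξ : Ambient n, (∀ η, sympl ξ η = 0) → ξ = 0 := by
    intro ξ h
    have h1 := h (Complex.I • ξ)
    have h2 : sympl ξ (Complex.I • ξ) =
        -((∑ i, Complex.normSq (ξ.1 i)) + Complex.normSq ξ.2.1 + Complex.normSq ξ.2.2) := by
      have : ∀ z : ℂ, (z * star (Complex.I * z)).im = -Complex.normSq z := fun z => by
        simp [Complex.normSq_apply]
      rw [sympl_apply]
      simp only [Prod.smul_fst, Prod.smul_snd, Pi.smul_apply, smul_eq_mul, this,
        Finset.sum_neg_distrib]
      ring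
    rw [h2, neg_eq_zero] at h1
    have p1 : 0 ≤ ∑ i, Complex.normSq (ξ.1 i) := Finset.sum_nonneg fun i _ => Complex.normSq_nonneg _
    have p2 := Complex.normSq_nonneg ξ.2.1
    have p3 := Complex.normSq_nonneg ξ.2.2
    have e1 : ∑ i, Complex.normSq (ξ.1 i) = 0 := by linarith
    rw [Finset.sum_eq_zero_iff_of_nonneg fun i _ => Complex.normSq_nonneg _] at e1
    refine Prod.ext (funext fun i => Complex.normSq_eq_zero.1 (e1 i (Finset.mem_univ i)))
      (Prod.ext (Complex.normSq_eq_zero.1 ?_) (Complex.normSq_eq_zero.1 ?_)) <;> linarith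
  rw [← sub_eq_zero]
  refine hnd _ fun η => ?_
  rw [map_sub, LinearMap.sub_apply, h, sympl_sgrad, sub_self]

/-- The Poisson bracket of the imaginary and the real part of a complex valued linear form. -/
def poisson (L : Ambient n →L[ℝ] ℂ) : ℝ :=
  sympl (sgrad (Complex.imCLM ∘L L)) (sgrad (Complex.reCLM ∘L L))

/-- A function is constant along its own Hamiltonian direction, so only the bracket with the other
component survives. -/
theorem apply_sgrad_re (L : Ambient n →L[ℝ] ℂ) :
    L (sgrad (Complex.reCLM ∘L L)) = (poisson L : ℂ) * Complex.I := by
  have h1 := sympl_sgrad (Complex.reCLM ∘L L) (sgrad (Complex.reCLM ∘L L))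
  have h2 := sympl_sgrad (Complex.imCLM ∘L L) (sgrad (Complex.reCLM ∘L L))
  rw [sympl_self] at h1
  apply Complex.ext
  · simpa using h1.symm
  · simpa [poisson] using h2.symm

theorem apply_sgrad_im (L : Ambient n →L[ℝ] ℂ) :
    L (sgrad (Complex.imCLM ∘L L)) = -(poisson L : ℂ) := by
  have h1 := sympl_sgrad (Complex.imCLM ∘L L) (sgrad (Complex.imCLM ∘L L))
  have h2 := sympl_sgrad (Complex.reCLM ∘L L) (sgrad (Complex.imCLM ∘L L))
  rw [sympl_self] at h1
  rw [sympl_antisymm] at h2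
  apply Complex.ext
  · simpa [poisson] using h2.symm
  · simpa using h1.symm

theorem surjective_of_poisson_ne_zero {L : Ambient n →L[ℝ] ℂ} (h : poisson L ≠ 0) :
    Function.Surjective L := by
  intro w
  refine ⟨(w.im / poisson L) • sgrad (Complex.reCLM ∘L L) -
    (w.re / poisson L) • sgrad (Complex.imCLM ∘L L), ?_⟩
  rw [map_sub, map_smul, map_smul, apply_sgrad_re, apply_sgrad_im]
  apply Complex.ext <;> simp <;> field_simp

/-- The kernel of a complex valued linear form with nonzero Poisson bracket is symplectic. -/
theorem eq_zero_of_poisson_ne_zero {L : Ambient n →L[ℝ] ℂ} (h : poisson L ≠ 0) {ξ : Ambient n}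
    (hξ : L ξ = 0) (hω : ∀ η, L η = 0 → sympl ξ η = 0) : ξ = 0 := by
  set A := sgrad (Complex.reCLM ∘L L) with hA
  set B := sgrad (Complex.imCLM ∘L L) with hB
  -- The hypothesis is tested on the projection of η to the kernel of L along the span of A and B.
  -- It shows that ξ lies in that span, on which L is injective.
  have h1 : ∀ η, sympl ξ η = ((sympl ξ A / poisson L) • (Complex.imCLM ∘L L) -
      (sympl ξ B / poisson L) • (Complex.reCLM ∘L L)) η := by
    intro η
    have := hω (η - ((L η).im / poisson L) • A + ((L η).re / poisson L) • B) (by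
      rw [map_add, map_sub, map_smul, map_smul, apply_sgrad_re, apply_sgrad_im]
      apply Complex.ext <;> simp <;> field_simp <;> ring)
    simp only [map_add, map_sub, map_smul, smul_eq_mul] at this
    simp
    field_simp at this ⊢
    linarith
  have h2 := eq_sgrad_of_forall ξ _ h1
  rw [map_sub, map_smul, map_smul, ← hA, ← hB] at h2
  have h3 := congrArg L h2
  rw [hξ, map_sub, map_smul, map_smul, apply_sgrad_re, apply_sgrad_im] at h3
  have h4 := congrArg Complex.re h3
  have h5 := congrArg Complex.im h3
  simp at h4 h5
  have h6 : sympl ξ A = 0 := by tauto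
  have h7 : sympl ξ B = 0 := by tauto
  rw [h2, h6, h7]; simp

/-! ### Logarithmic coordinates -/

/-- Vectors in logarithmic coordinates at `q`, as vectors. -/
def twist (q : Ambient n) : Ambient n →L[ℝ] Ambient n :=
  ContinuousLinearMap.mul ℝ (Ambient n) (q.1, 1)

theorem twist_apply (q ξ : Ambient n) : twist q ξ = (q.1 * ξ.1, ξ.2) := by
  simp [twist, Prod.mul_def]

theorem contDiff_twist : ContDiff ℝ ∞ (twist (n := n)) :=
  (ContinuousLinearMap.mul ℝ (Ambient n)).contDiff.comp (contDiff_fst.prodMk contDiff_const)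

/-- Logarithmic coordinates of a vector at `q`. -/
def untwist (q ξ : Ambient n) : Ambient n := (fun i => ξ.1 i / q.1 i, ξ.2)

theorem twist_untwist {q : Ambient n} (hq : q.1 ∈ torus n) (ξ : Ambient n) :
    twist q (untwist q ξ) = ξ := by
  rw [twist_apply]
  refine Prod.ext (funext fun i => ?_) rfl
  exact mul_div_cancel₀ _ (hq i)

theorem untwist_twist {q : Ambient n} (hq : q.1 ∈ torus n) (ξ : Ambient n) :
    untwist q (twist q ξ) = ξ := by
  rw [twist_apply]
  refine Prod.ext (funext fun i => ?_) rfl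
  exact mul_div_cancel_left₀ _ (hq i)

/-- Dividing the torus components by z_i absorbs the weights 1/|z_i|², so that symplectic questions
reduce to linear algebra with a constant real form. -/
theorem omega_eq {q : Ambient n} (ξ η : Ambient n) :
    omega q ξ η = 2 * Complex.I * (sympl (untwist q ξ) (untwist q η) : ℂ) := by
  have h : ∀ z w : ℂ, z * star w - w * star z = 2 * Complex.I * ((z * star w).im : ℂ) := by
    intro z w
    apply Complex.ext <;> simp <;> ring
  have h' : ∀ z w a : ℂ, (z * star w - w * star z) / ((‖a‖ : ℂ) ^ 2) =
      2 * Complex.I * ((z / a * star (w / a)).im : ℂ) := by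
    intro z w a
    rw [← h]
    have : ((‖a‖ : ℂ) ^ 2) = a * star a := by
      rw [Complex.star_def, Complex.mul_conj, Complex.normSq_eq_norm_sq]; push_cast; rfl
    rw [this, star_div₀, star_div₀]
    by_cases ha : a = 0
    · simp [ha]
    · have : star a ≠ 0 := star_ne_zero.2 ha
      field_simp
  rw [sympl_apply, omega, h ξ.2.1, h ξ.2.2, Finset.sum_congr rfl fun i _ => h' _ _ _]
  push_cast
  simp only [untwist, mul_add, Finset.mul_sum]

theorem isOpen_torus : IsOpen (torus n) := by
  have : torus n = ⋂ i, {z : Fin n → ℂ | z i ≠ 0} := by ext; simp [torus]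
  rw [this]
  exact isOpen_iInter_of_finite fun i => isOpen_ne_fun (continuous_apply i) continuous_const

/-- The open subset `(ℂ^*)ⁿ × ℂ²` of the ambient space. -/
def space (n : ℕ) : Set (Ambient n) := {q | q.1 ∈ torus n}

theorem isOpen_space : IsOpen (space n) := isOpen_torus.preimage continuous_fst

/-- The differential in logarithmic coordinates. -/
def logForm {E : Type*} [NormedAddCommGroup E] [NormedSpace ℝ E] (F : Ambient n → E)
    (q : Ambient n) : Ambient n →L[ℝ] E := fderiv ℝ F q ∘L twist q

/-- The Hamiltonian vector field in logarithmic coordinates. -/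
def logHam (F : Ambient n → ℝ) (q : Ambient n) : Ambient n := sgrad (logForm F q)

/-- The Hamiltonian vector field. -/
def hamField (F : Ambient n → ℝ) (q : Ambient n) : Ambient n := twist q (logHam F q)

end Symplectic

/-! ### Hamiltonian vector fields in logarithmic coordinates -/

section Hamiltonian

variable {n : ℕ}

/-- The derivative of `q ↦ twist q y`. -/
def twistDeriv (y : Ambient n) : Ambient n →L[ℝ] Ambient n :=
  ((ContinuousLinearMap.mul ℝ (Fin n → ℂ)).flip y.1 ∘L ContinuousLinearMap.fst ℝ _ _).prod 0

theorem twistDeriv_apply (y ξ : Ambient n) : twistDeriv y ξ = (ξ.1 * y.1, 0) := rfl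

theorem hasFDerivAt_twist (y q : Ambient n) :
    HasFDerivAt (fun q => twist q y) (twistDeriv y) q := by
  have : (fun q : Ambient n => twist q y) = fun q => twistDeriv y q + (0, y.2) := by
    funext q; simp [twist_apply, twistDeriv_apply]
  rw [this]
  exact (twistDeriv y).hasFDerivAt.add_const _

theorem contDiff_logForm {E : Type*} [NormedAddCommGroup E] [NormedSpace ℝ E]
    {F : Ambient n → E} (hF : ContDiff ℝ ∞ F) : ContDiff ℝ ∞ (logForm F) :=
  (hF.fderiv_right (by simp)).clm_comp contDiff_twist

theorem contDiff_logHam {F : Ambient n → ℝ} (hF : ContDiff ℝ ∞ F) : ContDiff ℝ ∞ (logHam F) :=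
  sgrad.contDiff.comp (contDiff_logForm hF)

/-- Hamiltonian vector fields are infinitesimal symplectic transformations. -/
theorem sympl_fderiv_logHam {F : Ambient n → ℝ} (hF : ContDiff ℝ ∞ F) {q : Ambient n}
    (hq : q.1 ∈ torus n) (ξ η : Ambient n) :
    sympl (fderiv ℝ (logHam F) q ξ) (untwist q η) +
      sympl (untwist q ξ) (fderiv ℝ (logHam F) q η) = 0 := by
  have key : ∀ ξ y : Ambient n, sympl (fderiv ℝ (logHam F) q ξ) y =
      fderiv ℝ (fderiv ℝ F) q ξ (twist q y) + fderiv ℝ F q (ξ.1 * y.1, 0) := by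
    intro ξ y
    have h1 : HasFDerivAt (logHam F) (fderiv ℝ (logHam F) q) q :=
      ((contDiff_logHam hF).differentiable (by simp) q).hasFDerivAt
    have h2 : HasFDerivAt (fun q => sympl (logHam F q) y)
        (LinearMap.toContinuousLinearMap (sympl.flip y) ∘L fderiv ℝ (logHam F) q) q :=
      (LinearMap.toContinuousLinearMap (sympl.flip y)).hasFDerivAt.comp q h1
    have h3 : HasFDerivAt (fderiv ℝ F) (fderiv ℝ (fderiv ℝ F) q) q :=
      ((hF.fderiv_right (m := ∞) (by simp)).differentiable (by simp) q).hasFDerivAt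
    have h4 := h3.clm_apply (hasFDerivAt_twist y q)
    have h5 : (fun q => sympl (logHam F q) y) = fun q => fderiv ℝ F q (twist q y) := by
      funext q; exact sympl_sgrad _ _
    rw [h5] at h2
    have h6 := congrArg (fun L => L ξ) (h2.unique h4)
    simp only [ContinuousLinearMap.comp_apply, add_apply,
      ContinuousLinearMap.flip_apply, twistDeriv_apply] at h6
    rw [add_comm]
    exact h6
  have hsymm : IsSymmSndFDerivAt ℝ F q := hF.contDiffAt.isSymmSndFDerivAt (by
    simp only [minSmoothness_of_isRCLikeNormedField]; exact WithTop.coe_le_coe.2 (le_top : (2 : ℕ∞) ≤ ⊤))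
  rw [sympl_antisymm (untwist q ξ), key, key, twist_untwist hq, twist_untwist hq, hsymm.eq]
  -- Besides the symmetric Hessian of F there is a term from the derivative of `twist`; it is
  -- symmetric too, since both sides are z times the product of the logarithmic components.
  have : ξ.1 * (untwist q η).1 = η.1 * (untwist q ξ).1 := by
    ext i; simp only [untwist, Pi.mul_apply]; ring
  rw [this]; ring

theorem fderiv_hamField {F : Ambient n → ℝ} (hF : ContDiff ℝ ∞ F) (q ξ : Ambient n) :
    fderiv ℝ (hamField F) q ξ =
      twist q (fderiv ℝ (logHam F) q ξ) + (ξ.1 * (logHam F q).1, 0) := by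
  have h1 : HasFDerivAt (logHam F) (fderiv ℝ (logHam F) q) q :=
    ((contDiff_logHam hF).differentiable (by simp) q).hasFDerivAt
  have h2 : HasFDerivAt (twist (n := n)) (fderiv ℝ twist q) q :=
    (contDiff_twist.differentiable (by simp) q).hasFDerivAt
  have h3 := h2.clm_apply h1
  have h4 : fderiv ℝ twist q ξ (logHam F q) = (ξ.1 * (logHam F q).1, 0) := by
    have h5 := h2.clm_apply (hasFDerivAt_const (logHam F q) q)
    have h6 := congrArg (fun L => L ξ) (h5.unique (hasFDerivAt_twist _ q))
    simpa [twistDeriv_apply] using h6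
  have h5 : fderiv ℝ (hamField F) q = _ := h3.fderiv
  rw [h5, ← h4]
  simp

/-- In the quotient rule for J_i / γ_i the term coming from the velocity of γ cancels the extra
summand in the velocity of J, which is the one produced by `fderiv_hamField`. -/
theorem hasDerivWithinAt_untwist {γ J : ℝ → Ambient n} {h k : Ambient n} {s : ℝ} {S : Set ℝ}
    (hq : (γ s).1 ∈ torus n) (hγ : HasDerivWithinAt γ (twist (γ s) h) S s)
    (hJ : HasDerivWithinAt J (twist (γ s) k + ((J s).1 * h.1, 0)) S s) :
    HasDerivWithinAt (fun s => untwist (γ s) (J s)) k S s := by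
  have hγ1 : ∀ i, HasDerivWithinAt (fun s => (γ s).1 i) ((γ s).1 i * h.1 i) S s := fun i => by
    have := ((ContinuousLinearMap.proj (R := ℝ) (φ := fun _ : Fin n => ℂ) i) ∘L
      ContinuousLinearMap.fst ℝ (Fin n → ℂ) (ℂ × ℂ)).hasFDerivAt.comp_hasDerivWithinAt s hγ
    exact this.congr_deriv (by simp [twist_apply])
  have hJ1 : ∀ i, HasDerivWithinAt (fun s => (J s).1 i)
      ((γ s).1 i * k.1 i + (J s).1 i * h.1 i) S s := fun i => by
    have := ((ContinuousLinearMap.proj (R := ℝ) (φ := fun _ : Fin n => ℂ) i) ∘L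
      ContinuousLinearMap.fst ℝ (Fin n → ℂ) (ℂ × ℂ)).hasFDerivAt.comp_hasDerivWithinAt s hJ
    exact this.congr_deriv (by simp [twist_apply])
  have hJ2 : HasDerivWithinAt (fun s => (J s).2) k.2 S s := by
    have := (ContinuousLinearMap.snd ℝ (Fin n → ℂ) (ℂ × ℂ)).hasFDerivAt.comp_hasDerivWithinAt s hJ
    exact this.congr_deriv (by simp [twist_apply])
  have h1 : HasDerivWithinAt (fun s => (untwist (γ s) (J s)).1) k.1 S s := by
    rw [hasDerivWithinAt_pi]
    intro i
    refine ((hJ1 i).div (hγ1 i) (hq i)).congr_deriv ?_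
    have := hq i
    field_simp
    ring
  exact h1.prodMk hJ2

/-- A function that is smooth on an open set and vanishes off a closed subset of it is smooth. -/
theorem contDiff_of_contDiffOn_of_eq_zero {E F : Type*} [NormedAddCommGroup E] [NormedSpace ℝ E]
    [NormedAddCommGroup F] [NormedSpace ℝ F] {f : E → F} {Ω K : Set E} (hΩ : IsOpen Ω)
    (hK : IsClosed K) (hKΩ : K ⊆ Ω) (hf : ContDiffOn ℝ ∞ f Ω) (h0 : ∀ x, x ∉ K → f x = 0) :
    ContDiff ℝ ∞ f := by
  rw [contDiff_iff_contDiffAt]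
  intro x
  by_cases hx : x ∈ K
  · exact hf.contDiffAt (hΩ.mem_nhds (hKΩ hx))
  · have : f =ᶠ[nhds x] fun _ => 0 := by
      filter_upwards [hK.isOpen_compl.mem_nhds hx] with y hy using h0 y hy
    exact contDiffAt_const.congr_of_eventuallyEq this

/-- The transport Hamiltonian contains the inverse of a Poisson bracket that may vanish away from
the hypersurfaces; a globally smooth substitute for the reciprocal avoids this. -/
theorem exists_smooth_inv {c : ℝ} (hc : 0 < c) :
    ∃ κ : ℝ → ℝ, ContDiff ℝ ∞ κ ∧ ∀ x, c ≤ x → κ x * x = 1 := by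
  -- The numerator is 0 for x ≤ c/2 and 1 for x ≥ c.
  refine ⟨fun x => Real.smoothTransition (2 * x / c - 1) / x, ?_, fun x hx => ?_⟩
  · refine contDiff_of_contDiffOn_of_eq_zero (Ω := {x : ℝ | x ≠ 0}) (K := Ici (c / 2))
      isOpen_ne isClosed_Ici (fun x hx => ?_) ?_ fun x hx => ?_
    · have : c / 2 ≤ x := hx
      exact (by linarith : 0 < x).ne'
    · refine ContDiffOn.div ?_ contDiffOn_id fun x hx => hx
      exact (Real.smoothTransition.contDiff.comp
        (((contDiff_const.mul contDiff_id).div_const c).sub contDiff_const)).contDiffOn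
    · have : x < c / 2 := not_le.1 hx
      rw [Real.smoothTransition.zero_of_nonpos, zero_div]
      rw [sub_nonpos, div_le_one hc]; linarith
  · change Real.smoothTransition (2 * x / c - 1) / x * x = 1
    rw [Real.smoothTransition.one_of_one_le]
    · exact div_mul_cancel₀ _ (by linarith : 0 < x).ne'
    · rw [le_sub_iff_add_le, le_div_iff₀ hc]; linarith

theorem contDiff_poisson : ContDiff ℝ ∞ (poisson (n := n)) := by
  have h : ∀ A : ℂ →L[ℝ] ℝ, ContDiff ℝ ∞ (fun L : Ambient n →L[ℝ] ℂ => sgrad (A ∘L L)) := fun A =>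
    sgrad.contDiff.comp (contDiff_const.clm_comp contDiff_id)
  have := ((LinearMap.toContinuousBilinearMap (sympl (n := n))).contDiff.comp
    (h Complex.imCLM)).clm_apply (h Complex.reCLM)
  exact this

end Hamiltonian

/-! ### Symplectic parallel transport in a linear family of hypersurfaces -/

section Moser

variable {n : ℕ}

/-- `Φ` is a diffeomorphism with inverse `Ψ`, equal to the identity off `K`, that preserves `ω₀`. -/
structure IsSupportedSymplecto (K : Set (Ambient n)) (Φ Ψ : Ambient n → Ambient n) : Prop where
  smooth : ContDiff ℝ ∞ Φ
  smooth_inv : ContDiff ℝ ∞ Ψ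
  left_inv : Function.LeftInverse Ψ Φ
  right_inv : Function.RightInverse Ψ Φ
  eq_self : ∀ q, q ∉ K → Φ q = q
  mem_space : ∀ q ∈ space n, Φ q ∈ space n
  omega_eq : ∀ q ∈ space n, ∀ ξ η, omega (Φ q) (fderiv ℝ Φ q ξ) (fderiv ℝ Φ q η) = omega q ξ η

theorem IsSupportedSymplecto.refl (K : Set (Ambient n)) : IsSupportedSymplecto K id id where
  smooth := contDiff_id
  smooth_inv := contDiff_id
  left_inv := fun _ => rfl
  right_inv := fun _ => rfl
  eq_self := fun _ _ => rfl
  mem_space := fun _ h => h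
  omega_eq := fun q _ ξ η => by simp

theorem IsSupportedSymplecto.comp {K : Set (Ambient n)} {Φ Ψ Φ' Ψ' : Ambient n → Ambient n}
    (h' : IsSupportedSymplecto K Φ' Ψ') (h : IsSupportedSymplecto K Φ Ψ) :
    IsSupportedSymplecto K (Φ' ∘ Φ) (Ψ ∘ Ψ') where
  smooth := h'.smooth.comp h.smooth
  smooth_inv := h.smooth_inv.comp h'.smooth_inv
  left_inv := h'.left_inv.comp h.left_inv
  right_inv := h'.right_inv.comp h.right_inv
  eq_self := fun q hq => by rw [Function.comp_apply, h.eq_self q hq, h'.eq_self q hq]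
  mem_space := fun q hq => h'.mem_space _ (h.mem_space q hq)
  omega_eq := fun q hq ξ η => by
    rw [fderiv_comp q (h'.smooth.differentiable (by simp) _) (h.smooth.differentiable (by simp) _)]
    exact (h'.omega_eq _ (h.mem_space q hq) _ _).trans (h.omega_eq q hq ξ η)

theorem contDiff_hamField {H : ℝ × Ambient n → ℝ} (hH : ContDiff ℝ ∞ H) :
    ContDiff ℝ ∞ (fun x : ℝ × Ambient n => hamField (fun q => H (x.1, q)) x.2) := by
  have h1 : ContDiff ℝ ∞ (Function.uncurry fun (x : ℝ × Ambient n) (q : Ambient n) =>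
      H (x.1, q)) := hH.comp ((contDiff_fst.comp contDiff_fst).prodMk contDiff_snd)
  have h2 : ContDiff ℝ ∞ (fun x : ℝ × Ambient n => fderiv ℝ (fun q => H (x.1, q)) x.2) :=
    ContDiff.fderiv h1 contDiff_snd (by simp)
  have h3 : ContDiff ℝ ∞ (fun x : ℝ × Ambient n => twist x.2) := contDiff_twist.comp contDiff_snd
  exact h3.clm_apply (sgrad.contDiff.comp (h2.clm_comp h3))

/-- The flow of a compactly supported time-dependent Hamiltonian over a short time interval. -/
theorem exists_hamiltonian_flow {K : Set (Ambient n)} (hKs : K ⊆ space n)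
    (H : ℝ × Ambient n → ℝ) (hH : ContDiff ℝ ∞ H)
    (hH0 : ∀ s, ∀ q, q ∉ K → hamField (fun q => H (s, q)) q = 0) {L : ℝ}
    (hL : ∀ s ∈ Icc (0 : ℝ) 1, ∀ q q', ‖hamField (fun q => H (s, q)) q -
      hamField (fun q => H (s, q)) q'‖ ≤ L * ‖q - q'‖)
    {a ε : ℝ} (ha : 0 ≤ a) (hε : 0 ≤ ε) (haε : a + ε ≤ 1) (hεL : ε * L ≤ 1 / 4) :
    ∃ (φ : ℝ → Ambient n → Ambient n) (Ψ : Ambient n → Ambient n),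
      IsSupportedSymplecto K (φ 1) Ψ ∧ (∀ q, φ 0 q = q) ∧
      (∀ q ∈ space n, ∀ s ∈ Icc (0 : ℝ) 1, φ s q ∈ space n) ∧
      ∀ q, ∀ s ∈ Icc (0 : ℝ) 1, HasDerivWithinAt (fun s => φ s q)
        (ε • hamField (fun q => H (a + ε * s, q)) (φ s q)) (Icc 0 1) s := by
  have hHs : ∀ s, ContDiff ℝ ∞ (fun q => H (s, q)) := fun s =>
    hH.comp (contDiff_const.prodMk contDiff_id)
  let Y : ℝ × Ambient n → Ambient n := fun x => ε • hamField (fun q => H (a + ε * x.1, q)) x.2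
  have hY : ContDiff ℝ ∞ Y :=
     ((contDiff_hamField hH).comp ((contDiff_const.add
      (contDiff_const.mul contDiff_fst)).prodMk contDiff_snd)).const_smul ε
  have hmem : ∀ s ∈ Icc (0 : ℝ) 1, a + ε * s ∈ Icc (0 : ℝ) 1 := fun s hs =>
    ⟨by nlinarith [hs.1], by nlinarith [hs.2]⟩
  have hYL : ∀ s ∈ Icc (0 : ℝ) 1, ∀ q q', ‖Y (s, q) - Y (s, q')‖ ≤ 1 / 4 * ‖q - q'‖ := by
    intro s hs q q'
    have : Y (s, q) - Y (s, q') = ε • (hamField (fun q => H (a + ε * s, q)) q -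
        hamField (fun q => H (a + ε * s, q)) q') := by simp only [Y, smul_sub]
    rw [this, norm_smul, Real.norm_of_nonneg hε]
    calc ε * _ ≤ ε * (L * ‖q - q'‖) := by gcongr; exact hL _ (hmem s hs) _ _
      _ = ε * L * ‖q - q'‖ := by ring
      _ ≤ _ := by gcongr
  obtain ⟨φ, J, Ψ, hφ0, hφ, hs1, hsΨ, hl, hr, hJ0, hJ1, hJ⟩ := exists_flow Y hY hYL
  -- A point outside K is a zero of the field at all times, so the distance of a trajectory to it
  -- satisfies a homogeneous differential inequality. A trajectory that is outside K at one time is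
  -- therefore stationary, and none can leave the torus.
  have hconst : ∀ q, ∀ s₀ ∈ Icc (0 : ℝ) 1, φ s₀ q ∉ K → ∀ s ∈ Icc (0 : ℝ) 1,
      φ s q = φ s₀ q := by
    intro q s₀ hs₀ hK s hs
    have h1 := eq_zero_of_norm_deriv_le (g := fun s => φ s q - φ s₀ q)
      (g' := fun s => Y (s, φ s q)) (C := 1 / 4)
      (fun s hs => (hφ q s hs).sub_const _) (fun s hs => by
        have h0 : Y (s, φ s₀ q) = 0 := by simp only [Y, hH0 _ _ hK, smul_zero]
        have := hYL s hs (φ s q) (φ s₀ q)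
        rwa [h0, sub_zero] at this) hs₀ (sub_self _) s hs
    exact sub_eq_zero.1 h1
  have h0 : (0 : ℝ) ∈ Icc (0 : ℝ) 1 := ⟨le_rfl, zero_le_one⟩
  have h1 : (1 : ℝ) ∈ Icc (0 : ℝ) 1 := ⟨zero_le_one, le_rfl⟩
  have hspace : ∀ q ∈ space n, ∀ s ∈ Icc (0 : ℝ) 1, φ s q ∈ space n := by
    intro q hq s hs
    by_contra hc
    have := hconst q s hs (fun h => hc (hKs h)) 0 h0
    rw [← this, hφ0] at hc
    exact hc hq
  refine ⟨φ, Ψ, ⟨hs1, hsΨ, hl, hr, fun q hq => ?_, fun q hq => hspace q hq 1 h1, ?_⟩, hφ0, hspace,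
    fun q s hs => hφ q s hs⟩
  · have := hconst q 0 h0 (by rwa [hφ0]) 1 h1
    rw [this, hφ0]
  · intro q hq ξ η
    rw [HoriVafa.omega_eq, HoriVafa.omega_eq, ← hJ1, ← hJ1]
    congr 2
    -- In logarithmic coordinates the variational equation involves only the derivative of `logHam`,
    -- and invariance of the form becomes its infinitesimal version `sympl_fderiv_logHam`.
    have hd : ∀ ξ, ∀ s ∈ Icc (0 : ℝ) 1, HasDerivWithinAt (fun s => untwist (φ s q) (J s q ξ))
        (ε • fderiv ℝ (logHam fun q => H (a + ε * s, q)) (φ s q) (J s q ξ)) (Icc 0 1) s := by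
      intro ξ s hs
      have hYs : fderiv ℝ Y (s, φ s q) (0, J s q ξ) =
          ε • fderiv ℝ (hamField fun q => H (a + ε * s, q)) (φ s q) (J s q ξ) := by
        have e1 := ((hY.differentiable (by simp)) (s, φ s q)).hasFDerivAt.comp (φ s q)
          (hasFDerivAt_prodMk_right s (φ s q))
        have e2 : ContDiff ℝ ∞ (hamField fun q => H (a + ε * s, q)) :=
          contDiff_twist.clm_apply (contDiff_logHam (hHs _))
        have e3 := ((e2.differentiable (by simp)) (φ s q)).hasFDerivAt.const_smul ε
        exact congrArg (fun L => L (J s q ξ)) (e1.unique e3)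
      refine hasDerivWithinAt_untwist (h := ε • logHam (fun q => H (a + ε * s, q)) (φ s q))
        (hspace q hq s hs) ((hφ q s hs).congr_deriv ?_) ((hJ q ξ s hs).congr_deriv ?_)
      · simp [Y, hamField]
      · rw [hYs, fderiv_hamField (hHs _), map_smul, smul_add]
        congr 1
        ext <;> simp
        ring
    have hd2 := fun s hs => hasDerivWithinAt_sympl (hd ξ s hs) (hd η s hs)
    have := eq_zero_of_norm_deriv_le (C := 0)
      (g := fun s => sympl (untwist (φ s q) (J s q ξ)) (untwist (φ s q) (J s q η)) -
        sympl (untwist q ξ) (untwist q η)) (g' := fun _ => 0)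
      (fun s hs => ((hd2 s hs).sub_const _).congr_deriv (by
        have := sympl_fderiv_logHam (hHs (a + ε * s)) (hspace q hq s hs) (J s q ξ) (J s q η)
        rw [map_smul, map_smul, LinearMap.smul_apply, ← smul_add, this, smul_zero]))
      (fun s hs => by simp) h0 (by simp only [hφ0, hJ0, sub_self]) 1 h1
    exact sub_eq_zero.1 this

end Moser

/-! ### The transport Hamiltonian and its effect on zero sets -/

section Transport

variable {n : ℕ}

/-- The linear family of functions `G + s N`. -/
def family (G N : Ambient n → ℂ) (s : ℝ) (q : Ambient n) : ℂ := G q + s * N q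

/-- The coefficient of `Re G_s` in the Hamiltonian of the parallel transport. -/
def transportRe (κ : ℝ → ℝ) (G N : Ambient n → ℂ) (x : ℝ × Ambient n) : ℝ :=
  -(κ (poisson (logForm (family G N x.1) x.2)) * (N x.2).im)

/-- The coefficient of `Im G_s` in the Hamiltonian of the parallel transport. -/
def transportIm (κ : ℝ → ℝ) (G N : Ambient n → ℂ) (x : ℝ × Ambient n) : ℝ :=
  κ (poisson (logForm (family G N x.1) x.2)) * (N x.2).re

/-- The Hamiltonian of the parallel transport. -/
def transportHam (κ : ℝ → ℝ) (G N : Ambient n → ℂ) (x : ℝ × Ambient n) : ℝ :=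
  transportRe κ G N x * (family G N x.1 x.2).re + transportIm κ G N x * (family G N x.1 x.2).im

variable {G N : Ambient n → ℂ} {K : Set (Ambient n)}

theorem contDiffOn_logForm {F : Ambient n → ℂ} (hF : ContDiffOn ℝ ∞ F (space n)) :
    ContDiffOn ℝ ∞ (logForm F) (space n) :=
  (hF.fderiv_of_isOpen isOpen_space (by simp)).clm_comp contDiff_twist.contDiffOn

theorem logForm_family (hG : ContDiffOn ℝ ∞ G (space n)) (hN : ContDiff ℝ ∞ N) (s : ℝ)
    {q : Ambient n} (hq : q ∈ space n) :
    logForm (family G N s) q = logForm G q + s • logForm N q := by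
  have h1 : HasFDerivAt G (fderiv ℝ G q) q :=
    ((hG.contDiffAt (isOpen_space.mem_nhds hq)).differentiableAt (by simp)).hasFDerivAt
  have h2 : HasFDerivAt N (fderiv ℝ N q) q := (hN.differentiable (by simp) q).hasFDerivAt
  have h3 := h1.add (h2.const_smul s)
  have h4 : family G N s = G + s • N := by funext q; simp [family]
  rw [logForm, h4, h3.fderiv, logForm, logForm]
  rw [ContinuousLinearMap.add_comp, ContinuousLinearMap.smul_comp]

/-- The domain `ℝ × (ℂ^*)ⁿ × ℂ²` of a family. -/
def familyDomain (n : ℕ) : Set (ℝ × Ambient n) := univ ×ˢ space n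

theorem isOpen_familyDomain : IsOpen (familyDomain n) := isOpen_univ.prod isOpen_space

theorem contDiffOn_logForm_family (hG : ContDiffOn ℝ ∞ G (space n)) (hN : ContDiff ℝ ∞ N) :
    ContDiffOn ℝ ∞ (fun x : ℝ × Ambient n => logForm (family G N x.1) x.2) (familyDomain n) := by
  have h1 : ContDiffOn ℝ ∞ (fun x : ℝ × Ambient n => logForm G x.2 + x.1 • logForm N x.2)
      (familyDomain n) :=
    ((contDiffOn_logForm hG).comp contDiffOn_snd fun x hx => hx.2).add
      (contDiff_fst.smul ((contDiff_logForm hN).comp contDiff_snd)).contDiffOn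
  exact h1.congr fun x hx => logForm_family hG hN x.1 hx.2

theorem contDiffOn_family (hG : ContDiffOn ℝ ∞ G (space n)) (hN : ContDiff ℝ ∞ N) :
    ContDiffOn ℝ ∞ (fun x : ℝ × Ambient n => family G N x.1 x.2) (familyDomain n) :=
  (hG.comp contDiffOn_snd fun _ hx => hx.2).add
    ((Complex.ofRealCLM.contDiff.comp contDiff_fst).mul (hN.comp contDiff_snd)).contDiffOn

/-- The data of a parallel transport: the function `G` is smooth on `(ℂ^*)ⁿ × ℂ²`, and `N` is smooth
with compact support. -/
structure IsTransportData (G N : Ambient n → ℂ) (K : Set (Ambient n)) : Prop where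
  smooth : ContDiffOn ℝ ∞ G (space n)
  smooth_pert : ContDiff ℝ ∞ N
  isCompact : IsCompact K
  subset : K ⊆ space n
  eq_zero : ∀ q, q ∉ K → N q = 0

variable {κ : ℝ → ℝ}

/-- The bracket is controlled only over the torus, but the compactly supported factor N lets the
product extend by zero. -/
theorem IsTransportData.contDiff_coeff (h : IsTransportData G N K) (hκ : ContDiff ℝ ∞ κ)
    (A : ℂ →L[ℝ] ℝ) : ContDiff ℝ ∞
    (fun x : ℝ × Ambient n => κ (poisson (logForm (family G N x.1) x.2)) * A (N x.2)) := by
  refine contDiff_of_contDiffOn_of_eq_zero isOpen_familyDomain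
    (isClosed_univ.prod h.isCompact.isClosed) (prod_mono le_rfl h.subset) ?_ fun x hx => ?_
  · exact ((hκ.comp contDiff_poisson).comp_contDiffOn
      (contDiffOn_logForm_family h.smooth h.smooth_pert)).mul
      (A.contDiff.comp (h.smooth_pert.comp contDiff_snd)).contDiffOn
  · rw [h.eq_zero x.2 fun h => hx ⟨mem_univ _, h⟩, map_zero, mul_zero]

theorem IsTransportData.contDiff_re (h : IsTransportData G N K) (hκ : ContDiff ℝ ∞ κ) :
    ContDiff ℝ ∞ (transportRe κ G N) := (h.contDiff_coeff hκ Complex.imCLM).neg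

theorem IsTransportData.contDiff_im (h : IsTransportData G N K) (hκ : ContDiff ℝ ∞ κ) :
    ContDiff ℝ ∞ (transportIm κ G N) := h.contDiff_coeff hκ Complex.reCLM

theorem IsTransportData.contDiff_ham (h : IsTransportData G N K) (hκ : ContDiff ℝ ∞ κ) :
    ContDiff ℝ ∞ (transportHam κ G N) := by
  have hf := contDiffOn_family h.smooth h.smooth_pert
  refine contDiff_of_contDiffOn_of_eq_zero isOpen_familyDomain
    (isClosed_univ.prod h.isCompact.isClosed) (prod_mono le_rfl h.subset) ?_ fun x hx => ?_
  · exact ((h.contDiff_re hκ).contDiffOn.mul (Complex.reCLM.contDiff.comp_contDiffOn hf)).add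
      ((h.contDiff_im hκ).contDiffOn.mul (Complex.imCLM.contDiff.comp_contDiffOn hf))
  · have h := h.eq_zero x.2 fun h => hx ⟨mem_univ _, h⟩
    simp [transportHam, transportRe, transportIm, h]

theorem IsTransportData.logHam_eq_zero (h : IsTransportData G N K) (s : ℝ) {q : Ambient n}
    (hq : q ∉ K) : logHam (fun q => transportHam κ G N (s, q)) q = 0 := by
  have h : (fun q => transportHam κ G N (s, q)) =ᶠ[nhds q] fun _ => 0 := by
    filter_upwards [h.isCompact.isClosed.isOpen_compl.mem_nhds hq] with y hy
    simp [transportHam, transportRe, transportIm, h.eq_zero y hy]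
  simp [logHam, logForm, h.fderiv_eq]

theorem IsTransportData.hamField_eq_zero (h : IsTransportData G N K) (s : ℝ) {q : Ambient n}
    (hq : q ∉ K) : hamField (fun q => transportHam κ G N (s, q)) q = 0 := by
  rw [hamField, h.logHam_eq_zero s hq, map_zero]

/-- The spatial derivative of the field is bounded on the compact set [0,1] × K and vanishes off K.
-/
theorem IsTransportData.exists_lipschitz (h : IsTransportData G N K) (hκ : ContDiff ℝ ∞ κ) :
    ∃ L : ℝ, 0 ≤ L ∧ ∀ s ∈ Icc (0 : ℝ) 1, ∀ q q',
      ‖hamField (fun q => transportHam κ G N (s, q)) q -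
        hamField (fun q => transportHam κ G N (s, q)) q'‖ ≤ L * ‖q - q'‖ := by
  let X : ℝ → Ambient n → Ambient n := fun s => hamField (fun q => transportHam κ G N (s, q))
  have hX : ContDiff ℝ ∞ (fun x : ℝ × Ambient n => X x.1 x.2) :=
    contDiff_hamField (h.contDiff_ham hκ)
  have hXs : ∀ s, ContDiff ℝ ∞ (X s) := fun s => hX.comp (contDiff_const.prodMk contDiff_id)
  have hd : ContDiff ℝ ∞ (fun x : ℝ × Ambient n => fderiv ℝ (X x.1) x.2) :=
    ContDiff.fderiv (f := fun (x : ℝ × Ambient n) q => X x.1 q)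
      (hX.comp ((contDiff_fst.comp contDiff_fst).prodMk contDiff_snd)) contDiff_snd (by simp)
  obtain ⟨L, hL⟩ := ((isCompact_Icc (a := (0 : ℝ)) (b := 1)).prod h.isCompact).exists_bound_of_continuousOn
    hd.continuous.continuousOn
  refine ⟨max L 0, le_max_right _ _, fun s hs q q' => ?_⟩
  refine convex_univ.norm_image_sub_le_of_norm_fderiv_le
    (fun x _ => (hXs s).differentiable (by simp) x) (fun x _ => ?_) (mem_univ q') (mem_univ q)
  by_cases hx : x ∈ K
  · exact (hL (s, x) ⟨hs, hx⟩).trans (le_max_left _ _)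
  · have : X s =ᶠ[nhds x] fun _ => 0 := by
      filter_upwards [h.isCompact.isClosed.isOpen_compl.mem_nhds hx] with y hy
      exact h.hamField_eq_zero s hy
    change ‖fderiv ℝ (X s) x‖ ≤ _
    rw [this.fderiv_eq]
    simp

/-- By Leibniz, the field of a Re F + b Im F is a X_{Re F} + b X_{Im F} plus terms with a factor Re
F or Im F. Since dF takes X_{Re F} to iP and X_{Im F} to −P, the values a = −κ Im N and b = κ Re N
produce −κPN. -/
theorem IsTransportData.logForm_logHam (h : IsTransportData G N K) (hκ : ContDiff ℝ ∞ κ) (s : ℝ)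
    {q : Ambient n} (hq : q ∈ space n) :
    logForm (family G N s) q (logHam (fun q => transportHam κ G N (s, q)) q) =
      -(κ (poisson (logForm (family G N s) q)) * poisson (logForm (family G N s) q) : ℝ) * N q +
      (family G N s q).re *
        logForm (family G N s) q (logHam (fun q => transportRe κ G N (s, q)) q) +
      (family G N s q).im *
        logForm (family G N s) q (logHam (fun q => transportIm κ G N (s, q)) q) := by
  have hf : HasFDerivAt (family G N s) (fderiv ℝ (family G N s) q) q := by
    have h1 := (contDiffOn_family h.smooth h.smooth_pert).comp
      (contDiff_const.prodMk contDiff_id : ContDiff ℝ ∞ fun q : Ambient n => (s, q)).contDiffOn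
      (s := space n) fun q hq => ⟨mem_univ _, hq⟩
    exact ((h1.contDiffAt (isOpen_space.mem_nhds hq)).differentiableAt (by simp)).hasFDerivAt
  have hre : HasFDerivAt (fun q => transportRe κ G N (s, q))
      (fderiv ℝ (fun q => transportRe κ G N (s, q)) q) q :=
    (((h.contDiff_re hκ).comp (contDiff_const.prodMk contDiff_id)).differentiable
      (by simp) q).hasFDerivAt
  have him : HasFDerivAt (fun q => transportIm κ G N (s, q))
      (fderiv ℝ (fun q => transportIm κ G N (s, q)) q) q :=
    (((h.contDiff_im hκ).comp (contDiff_const.prodMk contDiff_id)).differentiable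
      (by simp) q).hasFDerivAt
  have hH := (hre.mul (Complex.reCLM.hasFDerivAt.comp q hf)).add
    (him.mul (Complex.imCLM.hasFDerivAt.comp q hf))
  have hl : logForm (fun q => transportHam κ G N (s, q)) q =
      transportRe κ G N (s, q) • (Complex.reCLM ∘L logForm (family G N s) q) +
      (family G N s q).re • logForm (fun q => transportRe κ G N (s, q)) q +
      (transportIm κ G N (s, q) • (Complex.imCLM ∘L logForm (family G N s) q) +
      (family G N s q).im • logForm (fun q => transportIm κ G N (s, q)) q) := by
    have h2 : fderiv ℝ (fun q => transportHam κ G N (s, q)) q = _ := hH.fderiv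
    rw [logForm, h2]
    rfl
  rw [logHam, hl]
  simp only [map_add, map_smul, apply_sgrad_re, apply_sgrad_im]
  simp only [logHam, transportRe, transportIm, Complex.real_smul]
  push_cast
  conv_rhs => rw [← Complex.re_add_im (N q)]
  ring_nf

/-- Along the parallel transport, the value of the family grows at most exponentially. -/
theorem IsTransportData.exists_growth (h : IsTransportData G N K) (hκ : ContDiff ℝ ∞ κ)
    {c η : ℝ} (hη : 0 < η) (hκc : ∀ x, c ≤ x → κ x * x = 1)
    (hP : ∀ s ∈ Icc (0 : ℝ) 1, ∀ q ∈ K, ‖family G N s q‖ < η →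
      c ≤ poisson (logForm (family G N s) q)) :
    ∃ C : ℝ, ∀ s ∈ Icc (0 : ℝ) 1, ∀ q,
      ‖N q + logForm (family G N s) q (logHam (fun q => transportHam κ G N (s, q)) q)‖ ≤
        C * ‖family G N s q‖ := by
  have hsub : Icc (0 : ℝ) 1 ×ˢ K ⊆ familyDomain n := prod_mono (subset_univ _) h.subset
  have hcpt := (isCompact_Icc (a := (0 : ℝ)) (b := 1)).prod h.isCompact
  have hlog := ((contDiffOn_logForm_family h.smooth h.smooth_pert).continuousOn).mono hsub
  have hham : ∀ F : ℝ × Ambient n → ℝ, ContDiff ℝ ∞ F →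
      Continuous fun x : ℝ × Ambient n => logHam (fun q => F (x.1, q)) x.2 := fun F hF => by
    have h2 : ContDiff ℝ ∞ (fun x : ℝ × Ambient n => fderiv ℝ (fun q => F (x.1, q)) x.2) :=
      ContDiff.fderiv (f := fun (x : ℝ × Ambient n) q => F (x.1, q))
        (hF.comp ((contDiff_fst.comp contDiff_fst).prodMk contDiff_snd)) contDiff_snd (by simp)
    exact (sgrad.contDiff.comp (h2.clm_comp (contDiff_twist.comp contDiff_snd))).continuous
  obtain ⟨C₁, hC₁⟩ := hcpt.exists_bound_of_continuousOn
    (hlog.clm_apply (hham _ (h.contDiff_re hκ)).continuousOn)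
  obtain ⟨C₂, hC₂⟩ := hcpt.exists_bound_of_continuousOn
    (hlog.clm_apply (hham _ (h.contDiff_im hκ)).continuousOn)
  have hpc : ContinuousOn (fun x : ℝ × Ambient n => poisson (logForm (family G N x.1) x.2))
      (Icc (0 : ℝ) 1 ×ˢ K) := contDiff_poisson.continuous.comp_continuousOn hlog
  obtain ⟨C₃, hC₃⟩ := hcpt.exists_bound_of_continuousOn
    (f := fun x : ℝ × Ambient n => ((1 - κ (poisson (logForm (family G N x.1) x.2)) *
      poisson (logForm (family G N x.1) x.2) : ℝ) : ℂ) * N x.2)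
    ((Complex.continuous_ofReal.comp_continuousOn (continuousOn_const.sub
      ((hκ.continuous.comp_continuousOn hpc).mul hpc))).mul
      (h.smooth_pert.continuous.comp continuous_snd).continuousOn)
  refine ⟨max (C₃ / η + C₁ + C₂) 0, fun s hs q => ?_⟩
  by_cases hq : q ∈ K
  · rw [h.logForm_logHam hκ s (h.subset hq)]
    set P := poisson (logForm (family G N s) q) with hPdef
    set g := family G N s q with hg
    have b1 := hC₁ (s, q) ⟨hs, hq⟩
    have b2 := hC₂ (s, q) ⟨hs, hq⟩
    have b3 : ‖((1 - κ P * P : ℝ) : ℂ) * N q‖ ≤ C₃ / η * ‖g‖ := by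
      have b3 := hC₃ (s, q) ⟨hs, hq⟩
      simp only [] at b3
      -- Close to the hypersurface κP = 1 and the term vanishes; at distance |F_s| ≥ η, boundedness
      -- is enough.
      by_cases hlt : ‖g‖ < η
      · have := hκc P (hP s hs q hq hlt)
        rw [this, sub_self]
        have hC : 0 ≤ C₃ := (norm_nonneg _).trans b3
        simp only [Complex.ofReal_zero, zero_mul, norm_zero]
        positivity
      · refine b3.trans ?_
        have hC : 0 ≤ C₃ := (norm_nonneg _).trans b3
        rw [div_mul_eq_mul_div, le_div_iff₀ hη]
        exact mul_le_mul_of_nonneg_left (not_lt.1 hlt) hC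
    simp only [] at b1 b2
    set ℓ₁ := logForm (family G N s) q (logHam (fun q => transportRe κ G N (s, q)) q)
    set ℓ₂ := logForm (family G N s) q (logHam (fun q => transportIm κ G N (s, q)) q)
    have e : N q + (-((κ P * P : ℝ) : ℂ) * N q + g.re * ℓ₁ + g.im * ℓ₂) =
        ((1 - κ P * P : ℝ) : ℂ) * N q + g.re * ℓ₁ + g.im * ℓ₂ := by
      push_cast; ring
    rw [e]
    have c1 : ‖(g.re : ℂ) * ℓ₁‖ ≤ C₁ * ‖g‖ := by
      rw [norm_mul, Complex.norm_real, mul_comm]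
      exact mul_le_mul b1 (Complex.abs_re_le_norm g) (norm_nonneg _) ((norm_nonneg _).trans b1)
    have c2 : ‖(g.im : ℂ) * ℓ₂‖ ≤ C₂ * ‖g‖ := by
      rw [norm_mul, Complex.norm_real, mul_comm]
      exact mul_le_mul b2 (Complex.abs_im_le_norm g) (norm_nonneg _) ((norm_nonneg _).trans b2)
    have := norm_add₃_le (a := ((1 - κ P * P : ℝ) : ℂ) * N q) (b := (g.re : ℂ) * ℓ₁)
      (c := (g.im : ℂ) * ℓ₂)
    have hm := mul_le_mul_of_nonneg_right (le_max_left (C₃ / η + C₁ + C₂) 0) (norm_nonneg g)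
    linarith
  · rw [h.eq_zero q hq, h.logHam_eq_zero s hq, map_zero, add_zero, norm_zero]
    positivity

/-- A symplectic diffeomorphism supported in `K` that carries `{G_a = 0}` to `{G_b = 0}`. -/
def Transports (G N : Ambient n → ℂ) (K : Set (Ambient n)) (a b : ℝ) : Prop :=
  ∃ Φ Ψ, IsSupportedSymplecto K Φ Ψ ∧
    ∀ q ∈ space n, family G N a q = 0 ↔ family G N b (Φ q) = 0

theorem Transports.trans {a b c : ℝ} (h₁ : Transports G N K a b) (h₂ : Transports G N K b c) :
    Transports G N K a c := by
  obtain ⟨Φ, Ψ, h, hz⟩ := h₁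
  obtain ⟨Φ', Ψ', h', hz'⟩ := h₂
  exact ⟨_, _, h'.comp h, fun q hq => (hz q hq).trans (hz' _ (h.mem_space q hq))⟩

/-- The derivative of F_{a+εs} along the flow is ε(N + dF(X)), bounded by εC|F|. A zero at either
end of the trajectory thus forces a zero at the other, which gives both implications. -/
theorem IsTransportData.transports_of_short (h : IsTransportData G N K) (hκ : ContDiff ℝ ∞ κ)
    {L C : ℝ} (hL : ∀ s ∈ Icc (0 : ℝ) 1, ∀ q q',
      ‖hamField (fun q => transportHam κ G N (s, q)) q -
        hamField (fun q => transportHam κ G N (s, q)) q'‖ ≤ L * ‖q - q'‖)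
    (hC : ∀ s ∈ Icc (0 : ℝ) 1, ∀ q,
      ‖N q + logForm (family G N s) q (logHam (fun q => transportHam κ G N (s, q)) q)‖ ≤
        C * ‖family G N s q‖)
    {a ε : ℝ} (ha : 0 ≤ a) (hε : 0 ≤ ε) (haε : a + ε ≤ 1) (hεL : ε * L ≤ 1 / 4) :
    Transports G N K a (a + ε) := by
  obtain ⟨φ, Ψ, hΦ, hφ0, hsp, hφ⟩ := exists_hamiltonian_flow h.subset _ (h.contDiff_ham hκ)
    (fun s q hq => h.hamField_eq_zero s hq) hL ha hε haε hεL
  refine ⟨φ 1, Ψ, hΦ, fun q hq => ?_⟩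
  have h0 : (0 : ℝ) ∈ Icc (0 : ℝ) 1 := ⟨le_rfl, zero_le_one⟩
  have h1 : (1 : ℝ) ∈ Icc (0 : ℝ) 1 := ⟨zero_le_one, le_rfl⟩
  have hmem : ∀ s ∈ Icc (0 : ℝ) 1, a + ε * s ∈ Icc (0 : ℝ) 1 := fun s hs =>
    ⟨by nlinarith [hs.1], by nlinarith [hs.2]⟩
  have hd : ∀ s ∈ Icc (0 : ℝ) 1, HasDerivWithinAt (fun s => family G N (a + ε * s) (φ s q))
      (ε • (N (φ s q) + logForm (family G N (a + ε * s)) (φ s q)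
        (logHam (fun q => transportHam κ G N (a + ε * s, q)) (φ s q)))) (Icc 0 1) s := by
    intro s hs
    have hG : HasFDerivAt G (fderiv ℝ G (φ s q)) (φ s q) :=
      ((h.smooth.contDiffAt (isOpen_space.mem_nhds (hsp q hq s hs))).differentiableAt
        (by simp)).hasFDerivAt
    have hN : HasFDerivAt N (fderiv ℝ N (φ s q)) (φ s q) :=
      (h.smooth_pert.differentiable (by simp) _).hasFDerivAt
    have hs1 : HasDerivWithinAt (fun s : ℝ => ((a + ε * s : ℝ) : ℂ)) (ε : ℂ) (Icc 0 1) s := by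
      have : HasDerivAt (fun s : ℝ => a + ε * s) ε s := by
        simpa using ((hasDerivAt_id s).const_mul ε).const_add a
      exact this.ofReal_comp.hasDerivWithinAt
    refine ((hG.comp_hasDerivWithinAt s (hφ q s hs)).add
      (hs1.mul (hN.comp_hasDerivWithinAt s (hφ q s hs)))).congr_deriv ?_
    rw [logForm_family h.smooth h.smooth_pert _ (hsp q hq s hs)]
    simp [logForm, hamField]
    ring
  have hb : ∀ s ∈ Icc (0 : ℝ) 1, ‖ε • (N (φ s q) + logForm (family G N (a + ε * s)) (φ s q)
        (logHam (fun q => transportHam κ G N (a + ε * s, q)) (φ s q)))‖ ≤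
      ε * C * ‖family G N (a + ε * s) (φ s q)‖ := by
    intro s hs
    rw [norm_smul, Real.norm_of_nonneg hε, mul_assoc]
    exact mul_le_mul_of_nonneg_left (hC _ (hmem s hs) _) hε
  constructor
  · intro hz
    simpa using eq_zero_of_norm_deriv_le hd hb h0 (by simpa [hφ0] using hz) 1 h1
  · intro hz
    simpa [hφ0] using eq_zero_of_norm_deriv_le hd hb h1 (by simpa using hz) 0 h0

/-- Parallel transport: if the hypersurfaces `{G_s = 0}` are symplectic near the support of the
perturbation, then the first is carried to the last by a supported symplectomorphism. -/
theorem IsTransportData.transports (h : IsTransportData G N K) {c η : ℝ} (hc : 0 < c) (hη : 0 < η)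
    (hP : ∀ s ∈ Icc (0 : ℝ) 1, ∀ q ∈ K, ‖family G N s q‖ < η →
      c ≤ poisson (logForm (family G N s) q)) : Transports G N K 0 1 := by
  obtain ⟨κ, hκ, hκc⟩ := exists_smooth_inv hc
  obtain ⟨L, hL0, hL⟩ := h.exists_lipschitz hκ
  obtain ⟨C, hC⟩ := h.exists_growth hκ hη hκc hP
  -- Time steps of length 1/m satisfy L/m ≤ 1/4, the condition for the short-time flow.
  obtain ⟨m, hm⟩ := exists_nat_gt (4 * L)
  have hm0 : (0 : ℝ) < m := by linarith
  have key : ∀ k : ℕ, k ≤ m → Transports G N K 0 (k / m) := by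
    intro k
    induction k with
    | zero => exact fun _ => ⟨id, id, .refl K, fun q _ => by simp⟩
    | succ k ih =>
      intro hk
      have hk' : (k : ℝ) + 1 ≤ m := by exact_mod_cast hk
      have e : ((k + 1 : ℕ) : ℝ) / m = k / m + 1 / m := by push_cast; ring
      rw [e]
      refine (ih (by omega)).trans (h.transports_of_short hκ hL hC (by positivity) (by positivity)
        ?_ ?_)
      · rw [← add_div, div_le_one hm0]; exact hk'
      · rw [div_mul_eq_mul_div, div_le_iff₀ hm0]; linarith
  have := key m le_rfl
  rwa [div_self hm0.ne'] at this

end Transport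

/-! ### Tangent spaces of submanifolds with boundary -/

section Tangent

open Filter Topology

variable {E F : Type*} [NormedAddCommGroup E] [NormedSpace ℝ E]
  [NormedAddCommGroup F] [NormedSpace ℝ F] [FiniteDimensional ℝ F]

/-- Through a regular point of a level set there is a curve in each direction of the kernel. -/
theorem exists_curve_of_mem_ker [CompleteSpace E] {f : E → F} {f' : E →L[ℝ] F} {a ξ : E}
    (hf : HasStrictFDerivAt f f' a) (hf' : Function.Surjective f') (hξ : f' ξ = 0) :
    ∃ c : ℝ → E, c 0 = a ∧ HasDerivAt c ξ 0 ∧ ∀ᶠ s in 𝓝 (0 : ℝ), f (c s) = f a := by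
  have hr : f'.range = ⊤ := LinearMap.range_eq_top.2 hf'
  let k : f'.ker := ⟨ξ, hξ⟩
  have hk : HasDerivAt (fun s : ℝ => s • k) k 0 := by
    simpa using (hasDerivAt_id (0 : ℝ)).smul_const k
  refine ⟨fun s => hf.implicitFunction f f' hr (f a) (s • k), ?_, ?_, ?_⟩
  · simp
  · have h1 : HasFDerivAt (hf.implicitFunction f f' hr (f a)) f'.ker.subtypeL ((0 : ℝ) • k) := by
      rw [zero_smul]; exact (hf.to_implicitFunction hr).hasFDerivAt
    exact h1.comp_hasDerivAt 0 hk
  · have h1 : Tendsto (fun s : ℝ => (f a, s • k)) (𝓝 0) (𝓝 (f a, 0)) := by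
      refine tendsto_const_nhds.prodMk_nhds ?_
      simpa using hk.continuousAt.tendsto
    exact h1.eventually (hf.map_implicitFunction_eq hr)

theorem mem_tangentConeAt_of_curve {S : Set E} {a ξ : E} {c : ℝ → E} (h0 : c 0 = a)
    (hc : HasDerivAt c ξ 0) (hS : ∀ᶠ s in 𝓝[>] (0 : ℝ), c s ∈ S) : ξ ∈ tangentConeAt ℝ S a := by
  refine mem_tangentConeAt_of_seq (𝓝[>] (0 : ℝ)) (fun s => s⁻¹) (fun s => c s - a) ?_ ?_ ?_
  · have := hc.continuousAt.tendsto.mono_left (nhdsWithin_le_nhds (s := Ioi (0 : ℝ)))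
    rw [h0] at this
    simpa using this.sub_const a
  · simpa using hS
  · have := hasDerivAt_iff_tendsto_slope.1 hc
    have := this.mono_left (nhdsWithin_mono _ (fun x hx => ne_of_gt hx) :
      𝓝[>] (0 : ℝ) ≤ 𝓝[≠] 0)
    simpa [slope_fun_def, h0] using this

/-- The span of the tangent cone of a submanifold with boundary `{f = 0, g ≤ 0}`. -/
theorem span_tangentConeAt_eq_ker [CompleteSpace E] {S W : Set E} {f : E → F} {g : E → ℝ} {f' : E →L[ℝ] F}
    {g' : E →L[ℝ] ℝ} {a : E} (ha : a ∈ S) (hW : W ∈ 𝓝 a)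
    (hS : S ∩ W = {x | x ∈ W ∧ f x = 0 ∧ g x ≤ 0}) (hf : HasStrictFDerivAt f f' a)
    (hf' : Function.Surjective f') (hg : HasFDerivAt g g' a)
    (hb : g a = 0 → ∃ ξ, f' ξ = 0 ∧ g' ξ < 0) :
    Submodule.span ℝ (tangentConeAt ℝ S a) = f'.ker := by
  have haW : a ∈ W := mem_of_mem_nhds hW
  have hmem : a ∈ {x | x ∈ W ∧ f x = 0 ∧ g x ≤ 0} := hS ▸ ⟨ha, haW⟩
  have hfa : f a = 0 := hmem.2.1
  apply le_antisymm
  · rw [Submodule.span_le]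
    intro ξ hξ
    have h1 : HasFDerivWithinAt f f' S a := hf.hasFDerivAt.hasFDerivWithinAt
    have h2 : HasFDerivWithinAt f (0 : E →L[ℝ] F) S a := by
      refine (hasFDerivWithinAt_const (0 : F) a S).congr_of_eventuallyEq ?_ hfa
      filter_upwards [inter_mem_nhdsWithin S hW] with x hx
      have : x ∈ {x | x ∈ W ∧ f x = 0 ∧ g x ≤ 0} := hS ▸ hx
      exact this.2.1
    exact h1.unique_on h2 hξ
  · have key : ∀ ξ, f' ξ = 0 → (g a = 0 → g' ξ < 0) → ξ ∈ tangentConeAt ℝ S a := by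
      intro ξ hξ hgξ
      obtain ⟨c, hc0, hc, hfc⟩ := exists_curve_of_mem_ker hf hf' hξ
      refine mem_tangentConeAt_of_curve hc0 hc ?_
      have hcW : ∀ᶠ s in 𝓝 (0 : ℝ), c s ∈ W := by
        refine hc.continuousAt.eventually_mem ?_
        rwa [hc0]
      have hgc : HasDerivAt (fun s => g (c s)) (g' ξ) 0 := by
        have hg' : HasFDerivAt g g' (c 0) := by rwa [hc0]
        exact hg'.comp_hasDerivAt 0 hc
      have hneg : ∀ᶠ s in 𝓝[>] (0 : ℝ), g (c s) < 0 := by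
        rcases hmem.2.2.lt_or_eq with h | h
        · have : ∀ᶠ s in 𝓝 (0 : ℝ), g (c s) < 0 := by
            refine hgc.continuousAt.eventually_lt_const ?_
            simpa [hc0] using h
          exact this.filter_mono nhdsWithin_le_nhds
        · have h1 := (hasDerivAt_iff_tendsto_slope.1 hgc).mono_left
            (nhdsWithin_mono _ (fun x hx => ne_of_gt hx) : 𝓝[>] (0 : ℝ) ≤ 𝓝[≠] 0)
          filter_upwards [h1.eventually_lt_const (hgξ h), self_mem_nhdsWithin] with s hs hs0
          have hs0 : 0 < s := hs0
          rw [slope_def_field, hc0, h, sub_zero, sub_zero] at hs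
          by_contra hge
          exact absurd hs (not_lt.2 (div_nonneg (not_lt.1 hge) hs0.le))
      filter_upwards [(hfc.and hcW).filter_mono nhdsWithin_le_nhds, hneg] with s hs hs'
      have : c s ∈ S ∩ W := hS ▸ ⟨hs.2, hs.1.trans hfa, hs'.le⟩
      exact this.1
    intro ξ hξ
    have hξ : f' ξ = 0 := hξ
    by_cases hga : g a = 0
    · obtain ⟨ζ, hζ, hgζ⟩ := hb hga
      -- With this c, g'(ξ + cζ) = g'ξ − |g'ξ| − 1 < 0. Any kernel vector is thus a linear
      -- combination of two inward ones, both in the tangent cone.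
      set c : ℝ := (|g' ξ| + 1) / -(g' ζ) with hc
      have h1 : ξ + c • ζ ∈ tangentConeAt ℝ S a := by
        refine key _ (by rw [map_add, map_smul, hξ, hζ, smul_zero, add_zero]) fun _ => ?_
        have : c * g' ζ = -(|g' ξ| + 1) := by
          rw [hc, div_mul_eq_mul_div, div_eq_iff (neg_ne_zero.2 hgζ.ne)]; ring
        rw [map_add, map_smul, smul_eq_mul, this]
        linarith [le_abs_self (g' ξ)]
      have h2 := key ζ hζ fun _ => hgζ
      have := Submodule.sub_mem _ (Submodule.subset_span h1)
        (Submodule.smul_mem _ c (Submodule.subset_span h2))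
      simpa using this
    · exact Submodule.subset_span (key ξ hξ fun h => absurd h hga)

end Tangent

/-! ### Symplectic submanifolds given by equations -/

variable {n : ℕ}

/-- The local description of a symplectic submanifold with boundary by equations. -/
def HasSymplecticEquation (S : Set (Ambient n)) (q : Ambient n) (f : Ambient n → ℂ) : Prop :=
  ∃ (W : Set (Ambient n)) (g : Ambient n → ℝ), IsOpen W ∧ q ∈ W ∧ ContDiffOn ℝ ∞ f W ∧
    ContDiffOn ℝ ∞ g W ∧ S ∩ W = {x | x ∈ W ∧ f x = 0 ∧ g x ≤ 0} ∧
    poisson (logForm f q) ≠ 0 ∧ (g q = 0 → ∃ ξ, fderiv ℝ f q ξ = 0 ∧ fderiv ℝ g q ξ < 0)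

theorem HasSymplecticEquation.surjective_fderiv {S : Set (Ambient n)} {q : Ambient n}
    {f : Ambient n → ℂ} (h : HasSymplecticEquation S q f) :
    Function.Surjective (fderiv ℝ f q) := by
  obtain ⟨W, g, -, -, -, -, -, hp, -⟩ := h
  intro w
  obtain ⟨y, hy⟩ := surjective_of_poisson_ne_zero hp w
  exact ⟨twist q y, hy⟩

theorem HasSymplecticEquation.tangentAt_eq {S : Set (Ambient n)} {q : Ambient n} (hq : q ∈ S)
    {f : Ambient n → ℂ} (h : HasSymplecticEquation S q f) :
    tangentAt S q = (fderiv ℝ f q).ker := by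
  have hs := h.surjective_fderiv
  obtain ⟨W, g, hW, hqW, hf, hg, hS, hp, hb⟩ := h
  refine span_tangentConeAt_eq_ker hq (hW.mem_nhds hqW) hS ?_ hs ?_ hb
  · exact (hf.contDiffAt (hW.mem_nhds hqW)).hasStrictFDerivAt (by simp)
  · exact ((hg.contDiffAt (hW.mem_nhds hqW)).differentiableAt (by simp)).hasFDerivAt

/-- Nondegeneracy on the kernel of dF comes from the Poisson bracket. A kernel vector on which dg is
negative makes (dF, dg) onto at the boundary. -/
theorem isSymplecticSubmanifold_of_equations {S : Set (Ambient n)}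
    (hS : ∀ q ∈ S, q.1 ∈ torus n ∧ ∃ f, HasSymplecticEquation S q f) :
    IsSymplecticSubmanifold S := by
  intro q hq
  obtain ⟨hqt, f, h⟩ := hS q hq
  have hs := h.surjective_fderiv
  have ht := h.tangentAt_eq hq
  obtain ⟨W, g, hW, hqW, hf, hg, hSW, hp, hb⟩ := h
  refine ⟨hqt, ⟨W, f, g, hW, hqW, hf, hg, hSW, hs, fun hgq => ?_⟩, ?_⟩
  · obtain ⟨ζ, hζ, hgζ⟩ := hb hgq
    rintro ⟨w, r⟩
    obtain ⟨ξ, hξ⟩ := hs w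
    refine ⟨ξ + ((r - fderiv ℝ g q ξ) / fderiv ℝ g q ζ) • ζ, ?_⟩
    refine Prod.ext ?_ ?_
    · simp [hξ, hζ]
    · simp
      have := hgζ.ne
      field_simp
      ring
  · intro ξ hξ hω
    rw [ht] at hξ hω
    have h1 : untwist q ξ = 0 := by
      refine eq_zero_of_poisson_ne_zero hp ?_ fun y hy => ?_
      · rw [logForm, ContinuousLinearMap.comp_apply, twist_untwist hqt]; exact hξ
      · have := hω (twist q y) hy
        rw [omega_eq, untwist_twist hqt] at this
        simpa using this
    have h2 := twist_untwist hqt ξ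
    rw [← h2, h1, map_zero]

/-- A supported symplectomorphism restricts to a symplectomorphism of the submanifolds that
correspond to each other. -/
theorem IsSupportedSymplecto.isSymplectomorphism {K S T : Set (Ambient n)}
    {Φ Ψ : Ambient n → Ambient n} (h : IsSupportedSymplecto K Φ Ψ)
    (hS : IsSymplecticSubmanifold S) (hT : IsSymplecticSubmanifold T)
    (hΦ : ∀ q, q ∈ S ↔ Φ q ∈ T) : IsSymplectomorphism S T Φ where
  source := hS
  target := hT
  bijOn := ⟨fun q hq => (hΦ q).1 hq, h.left_inv.injective.injOn, fun q hq =>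
    ⟨Ψ q, (hΦ _).2 (by rwa [h.right_inv q]), h.right_inv q⟩⟩
  smooth := h.smooth.contDiffOn
  smooth_inv := ⟨Ψ, ⟨fun q _ => h.left_inv q, fun q _ => h.right_inv q⟩, h.smooth_inv.contDiffOn⟩
  pullback := by
    intro q hq L hL ξ hξ η hη
    have h1 : HasFDerivWithinAt Φ (fderiv ℝ Φ q) S q :=
      (h.smooth.differentiable (by simp) q).hasFDerivAt.hasFDerivWithinAt
    have h2 : EqOn L (fderiv ℝ Φ q) (tangentAt S q) :=
      LinearMap.eqOn_span (f := (L : Ambient n →ₗ[ℝ] Ambient n))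
        (g := (fderiv ℝ Φ q : Ambient n →ₗ[ℝ] Ambient n)) (hL.unique_on h1)
    rw [h2 hξ, h2 hη]
    exact h.omega_eq q (hS q hq).1 ξ η

/-! ### Toric preliminaries -/

section Toric

variable {n p : ℕ}

/-- A ray generator as a vector of `ℝⁿ`. -/
def realRay (fan : SmoothCompleteFan n p) (j : Fin p) : Fin n → ℝ := fun i => (fan.ray j i : ℝ)

/-- The vectors of a maximal cone take arbitrary integral values on a suitable lattice point. -/
theorem SmoothCompleteFan.exists_dual (fan : SmoothCompleteFan n p) {σ : Finset (Fin p)}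
    (hσ : σ ∈ fan.maxCones) (a : Fin p → ℤ) :
    ∃ y : Fin n → ℤ, ∀ i ∈ σ, ∑ l, fan.ray i l * y l = a i := by
  have hspan : ⊤ ≤ Submodule.span ℤ (range fun i : σ => fan.ray i) := by
    have : range (fun i : σ => fan.ray i) = fan.ray '' (σ : Set (Fin p)) := by
      ext x; simp
    rw [this, fan.spans σ hσ]
  let b := Module.Basis.mk (fan.linInd σ hσ) hspan
  let f : (Fin n → ℤ) →ₗ[ℤ] ℤ := b.constr ℤ fun i => a i
  refine ⟨fun l => f (Pi.single l 1), fun i hi => ?_⟩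
  have h1 : f (fan.ray i) = a i := by
    have := b.constr_basis ℤ (fun i : σ => a i) ⟨i, hi⟩
    have hb : b ⟨i, hi⟩ = fan.ray i := by simp [b]
    rwa [hb] at this
  rw [← h1]
  conv_rhs => rw [pi_eq_sum_univ' (fan.ray i)]
  rw [map_sum]
  refine Finset.sum_congr rfl fun l _ => ?_
  rw [map_smul, smul_eq_mul]

theorem SmoothCompleteFan.exists_lattice_point (fan : SmoothCompleteFan n p) (j : Fin p) :
    ∃ l : Fin n → ℤ, ∑ i, fan.ray j i * l i = 1 := by
  obtain ⟨σ, hσ, hj⟩ := fan.ray_mem j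
  obtain ⟨y, hy⟩ := fan.exists_dual hσ fun _ => 1
  exact ⟨y, hy j hj⟩

theorem pairing_add (v : Fin n → ℤ) (x y : Fin n → ℝ) :
    pairing v (x + y) = pairing v x + pairing v y := by
  simp [pairing, mul_add, Finset.sum_add_distrib]

theorem pairing_smul (v : Fin n → ℤ) (c : ℝ) (x : Fin n → ℝ) :
    pairing v (c • x) = c * pairing v x := by
  simp only [pairing, Finset.mul_sum, Pi.smul_apply, smul_eq_mul]
  exact Finset.sum_congr rfl fun i _ => by ring

theorem continuous_pairing (v : Fin n → ℤ) : Continuous (pairing v) := by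
  unfold pairing; fun_prop

theorem pairing_intCast (v y : Fin n → ℤ) :
    pairing v (fun i => (y i : ℝ)) = ((∑ i, v i * y i : ℤ) : ℝ) := by
  simp [pairing]

/-- The facet has a point in its relative interior. -/
theorem SmoothCompleteFan.exists_facet_point (fan : SmoothCompleteFan n p) {lam : Fin p → ℝ}
    (hlam : fan.IsAmple lam) (j : Fin p) :
    ∃ x, chi fan lam j x = 0 ∧ ∀ k, k ≠ j → 0 < chi fan lam k x := by
  classical
  obtain ⟨σ, hσ, hj⟩ := fan.ray_mem j
  obtain ⟨m, hm, hm'⟩ := hlam σ hσ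
  -- Starting at the vertex m of the cone σ, the direction y keeps χ_j = 0 and raises the other χ_i
  -- with i in σ. The remaining χ_k are positive at m and stay so for small ε.
  obtain ⟨y, hy⟩ := fan.exists_dual hσ fun i => if i = j then 0 else 1
  let y' : Fin n → ℝ := fun i => (y i : ℝ)
  have hchi : ∀ k ε, chi fan lam k (m + ε • y') =
      chi fan lam k m + ε * pairing (fan.ray k) y' := fun k ε => by
    rw [chi, pairing_add, pairing_smul, chi, add_assoc]
  have hσy : ∀ i ∈ σ, pairing (fan.ray i) y' = if i = j then 0 else 1 := fun i hi => by
    rw [pairing_intCast, hy i hi]; split_ifs <;> simp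
  have hev : ∀ᶠ ε in nhdsWithin (0 : ℝ) (Ioi 0), ∀ k, k ≠ j → 0 < chi fan lam k (m + ε • y') := by
    rw [Filter.eventually_all]
    intro k
    by_cases hk : k ∈ σ
    · filter_upwards [self_mem_nhdsWithin] with ε hε hkj
      rw [hchi, hσy k hk, if_neg hkj, chi, hm k hk]
      have : 0 < ε := hε
      linarith
    · have hc : Filter.Tendsto (fun ε : ℝ => chi fan lam k (m + ε • y')) (nhds 0)
          (nhds (chi fan lam k m)) := by
        have : Continuous fun ε : ℝ => chi fan lam k (m + ε • y') := by
          simp only [hchi]; fun_prop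
        simpa using this.tendsto 0
      have hpos : 0 < chi fan lam k m := by
        have := hm' k hk
        rw [chi]; linarith
      filter_upwards [(hc.eventually_const_lt hpos).filter_mono nhdsWithin_le_nhds] with ε hε _
        using hε
  obtain ⟨ε, hε⟩ := hev.exists
  refine ⟨m + ε • y', ?_, hε⟩
  rw [hchi, hσy j hj, if_pos rfl, chi, hm j hj]
  ring

/-- The squared length of a ray generator. -/
def raySq (fan : SmoothCompleteFan n p) (j : Fin p) : ℝ := ∑ i, (fan.ray j i : ℝ) ^ 2

theorem one_le_raySq (fan : SmoothCompleteFan n p) (j : Fin p) : 1 ≤ raySq fan j := by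
  obtain ⟨l, hl⟩ := fan.exists_lattice_point j
  have h0 : ∃ i, fan.ray j i ≠ 0 := by
    by_contra! h
    simp [h] at hl
  obtain ⟨i, hi⟩ := h0
  have h1 : (1 : ℝ) ≤ (fan.ray j i : ℝ) ^ 2 := by
    have : (1 : ℤ) ≤ fan.ray j i ^ 2 := by have := sq_pos_of_ne_zero hi; omega
    exact_mod_cast this
  exact h1.trans (Finset.single_le_sum (f := fun i => (fan.ray j i : ℝ) ^ 2)
    (fun i _ => sq_nonneg _) (Finset.mem_univ i))

theorem pairing_realRay (fan : SmoothCompleteFan n p) (j : Fin p) :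
    pairing (fan.ray j) (realRay fan j) = raySq fan j := by
  simp [pairing, realRay, raySq, sq]

/-- The gauge of a cylinder around a point, with axis the ray `j`. -/
def cylGauge (fan : SmoothCompleteFan n p) (j : Fin p) (x₀ x : Fin n → ℝ) : ℝ :=
  max |pairing (fan.ray j) (x - x₀)|
    ‖(x - x₀) - (pairing (fan.ray j) (x - x₀) / raySq fan j) • realRay fan j‖

/-- The cylinder of radius `r` around `x₀`, with axis the ray `j`. -/
def cyl (fan : SmoothCompleteFan n p) (j : Fin p) (x₀ : Fin n → ℝ) (r : ℝ) : Set (Fin n → ℝ) :=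
  {x | cylGauge fan j x₀ x < r}

variable (fan : SmoothCompleteFan n p) (j : Fin p) (x₀ : Fin n → ℝ)

theorem continuous_cylGauge : Continuous (cylGauge fan j x₀) := by
  have h : Continuous fun x => pairing (fan.ray j) (x - x₀) :=
    (continuous_pairing _).comp (continuous_id.sub continuous_const)
  exact h.abs.max (((continuous_id.sub continuous_const).sub
    ((h.div_const _).smul continuous_const)).norm)

theorem isOpen_cyl (r : ℝ) : IsOpen (cyl fan j x₀ r) :=
  isOpen_lt (continuous_cylGauge fan j x₀) continuous_const

theorem center_mem_cyl {r : ℝ} (hr : 0 < r) : x₀ ∈ cyl fan j x₀ r := by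
  simpa [cyl, cylGauge, pairing] using hr

theorem norm_sub_le_of_cylGauge {x : Fin n → ℝ} {r : ℝ} (h : cylGauge fan j x₀ x ≤ r) :
    ‖x - x₀‖ ≤ (1 + ‖realRay fan j‖) * r := by
  obtain ⟨h1, h2⟩ := max_le_iff.1 h
  set c := pairing (fan.ray j) (x - x₀)
  have h3 : ‖(c / raySq fan j) • realRay fan j‖ ≤ r * ‖realRay fan j‖ := by
    rw [norm_smul, Real.norm_eq_abs, abs_div]
    gcongr
    have := one_le_raySq fan j
    rw [abs_of_pos (by linarith : 0 < raySq fan j)]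
    exact (div_le_self (abs_nonneg c) this).trans h1
  have h4 : x - x₀ = ((x - x₀) - (c / raySq fan j) • realRay fan j) +
      (c / raySq fan j) • realRay fan j := by abel
  rw [h4]
  refine (norm_add_le _ _).trans ?_
  linarith

theorem closure_cyl_subset (r : ℝ) : closure (cyl fan j x₀ r) ⊆ {x | cylGauge fan j x₀ x ≤ r} :=
  closure_minimal (fun x hx => (show cylGauge fan j x₀ x < r from hx).le) (isClosed_le (continuous_cylGauge fan j x₀)
    continuous_const)

theorem isCompact_closedCyl (r : ℝ) : IsCompact {x | cylGauge fan j x₀ x ≤ r} := by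
  refine (isCompact_closedBall x₀ ((1 + ‖realRay fan j‖) * r)).of_isClosed_subset
    (isClosed_le (continuous_cylGauge fan j x₀) continuous_const) fun x hx => ?_
  rw [mem_closedBall_iff_norm]
  exact norm_sub_le_of_cylGauge fan j x₀ hx

theorem relCompactIn_cyl {r r' : ℝ} (h : r < r') :
    RelCompactIn (cyl fan j x₀ r) (cyl fan j x₀ r') :=
  ⟨(isCompact_closedCyl fan j x₀ r).of_isClosed_subset isClosed_closure
    (closure_cyl_subset fan j x₀ r), fun _ hx => (closure_cyl_subset fan j x₀ r hx).trans_lt h⟩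

theorem exists_cyl_subset {S : Set (Fin n → ℝ)} (hS : S ∈ nhds x₀) :
    ∃ r, 0 < r ∧ cyl fan j x₀ r ⊆ S := by
  obtain ⟨ε, hε, h⟩ := Metric.mem_nhds_iff.1 hS
  have hc : 0 < 1 + ‖realRay fan j‖ := by positivity
  refine ⟨ε / (2 * (1 + ‖realRay fan j‖)), by positivity, fun x hx => h ?_⟩
  rw [mem_ball_iff_norm]
  refine (norm_sub_le_of_cylGauge fan j x₀ (le_of_lt hx)).trans_lt ?_
  field_simp
  linarith

/-- Points of the cylinder on the hyperplane through the center may be moved along the axis. -/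
theorem add_smul_mem_cyl {x : Fin n → ℝ} {r s : ℝ} (hx : x ∈ cyl fan j x₀ r)
    (h0 : pairing (fan.ray j) (x - x₀) = 0) (hs : |s| * raySq fan j < r) :
    x + s • realRay fan j ∈ cyl fan j x₀ r := by
  have hp := one_le_raySq fan j
  have hx2 := (max_lt_iff.1 (show max _ _ < r from hx)).2
  rw [h0, zero_div, zero_smul, sub_zero] at hx2
  have h1 : x + s • realRay fan j - x₀ = (x - x₀) + s • realRay fan j := by abel
  have h2 : pairing (fan.ray j) (x + s • realRay fan j - x₀) = s * raySq fan j := by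
    rw [h1, pairing_add, pairing_smul, h0, pairing_realRay, zero_add]
  -- Only the axial entry of the gauge changes; the transverse entry remains that of x. In a ball,
  -- points of the facet near the boundary would have no room along v_j, whereas a cylinder leaves
  -- the same room at all of them.
  change cylGauge fan j x₀ (x + s • realRay fan j) < r
  refine max_lt ?_ ?_
  · rw [h2, abs_mul, abs_of_pos (by linarith : 0 < raySq fan j)]
    exact hs
  · rw [h2, mul_div_assoc, div_self (by linarith : raySq fan j ≠ 0), mul_one, h1,
      add_sub_cancel_right]
    exact hx2

end Toric

/-! ### Cutoff functions -/

/-- Smooth Urysohn functions with bounded derivative. -/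
theorem exists_smooth_cutoff {E : Type*} [NormedAddCommGroup E] [NormedSpace ℝ E]
    [FiniteDimensional ℝ E] {A O K : Set E} (hA : IsClosed A) (hO : IsOpen O) (hAO : A ⊆ O)
    (hOK : O ⊆ K) (hK : IsCompact K) :
    ∃ (f : E → ℝ) (C : ℝ), ContDiff ℝ ∞ f ∧ (∀ x, f x ∈ Icc (0 : ℝ) 1) ∧ (∀ x ∈ A, f x = 1) ∧
      (∀ x, x ∉ O → f x = 0) ∧ 0 ≤ C ∧ ∀ x, ‖fderiv ℝ f x‖ ≤ C := by
  obtain ⟨f, h0, h1, hf⟩ := exists_contMDiffMap_zero_one_of_isClosed (n := ⊤)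
    (modelWithCornersSelf ℝ E) hO.isClosed_compl hA
    (disjoint_compl_left_iff_subset.2 hAO)
  have hfs : ContDiff ℝ ∞ f := f.contMDiff.contDiff
  obtain ⟨C, hC⟩ := hK.exists_bound_of_continuousOn (hfs.continuous_fderiv (by simp)).continuousOn
  refine ⟨f, max C 0, hfs, hf, fun x hx => h1 hx, fun x hx => h0 hx, le_max_right _ _, fun x => ?_⟩
  by_cases hx : x ∈ K
  · exact (hC x hx).trans (le_max_left _ _)
  · have : f =ᶠ[nhds x] fun _ => 0 := by
      filter_upwards [hK.isClosed.isOpen_compl.mem_nhds hx] with y hy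
      exact h0 fun h => hy (hOK h)
    rw [this.fderiv_eq]
    simp

/-! ### Positivity of the Poisson bracket -/

section Poisson

variable {n : ℕ}

/-- The complex linear form with coefficients `l`. -/
def complexForm (l : Ambient n) : Ambient n →L[ℝ] ℂ :=
  (∑ i, l.1 i • (ContinuousLinearMap.proj (R := ℝ) (φ := fun _ : Fin n => ℂ) i ∘L
    ContinuousLinearMap.fst ℝ (Fin n → ℂ) (ℂ × ℂ))) +
  l.2.1 • (ContinuousLinearMap.fst ℝ ℂ ℂ ∘L ContinuousLinearMap.snd ℝ (Fin n → ℂ) (ℂ × ℂ)) +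
  l.2.2 • (ContinuousLinearMap.snd ℝ ℂ ℂ ∘L ContinuousLinearMap.snd ℝ (Fin n → ℂ) (ℂ × ℂ))

theorem complexForm_apply (l ξ : Ambient n) :
    complexForm l ξ = (∑ i, l.1 i * ξ.1 i) + l.2.1 * ξ.2.1 + l.2.2 * ξ.2.2 := by
  simp [complexForm]

/-- The sum of the squares of the coefficients. -/
def coeffSq (l : Ambient n) : ℝ := (∑ i, ‖l.1 i‖ ^ 2) + ‖l.2.1‖ ^ 2 + ‖l.2.2‖ ^ 2

/-- For coefficients l, the symplectic gradients of the real and imaginary parts are i·l̄ and −l̄.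
-/
theorem poisson_complexForm (l : Ambient n) : poisson (complexForm l) = coeffSq l := by
  have hre : sgrad (Complex.reCLM ∘L complexForm l) = Complex.I • star l := by
    symm
    refine eq_sgrad_of_forall _ _ fun η => ?_
    simp only [sympl_apply, ContinuousLinearMap.comp_apply, complexForm_apply,
      Complex.reCLM_apply, Complex.add_re, Complex.re_sum]
    have h : ∀ a b : ℂ, (Complex.I • star a * star b).im = (a * b).re := fun a b => by
      simp; ring
    simp only [Prod.smul_fst, Prod.smul_snd, Prod.fst_star, Prod.snd_star, Pi.smul_apply,
      Pi.star_apply, h]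
  have him : sgrad (Complex.imCLM ∘L complexForm l) = -star l := by
    symm
    refine eq_sgrad_of_forall _ _ fun η => ?_
    simp only [sympl_apply, ContinuousLinearMap.comp_apply, complexForm_apply,
      Complex.imCLM_apply, Complex.add_im, Complex.im_sum]
    have h : ∀ a b : ℂ, (-star a * star b).im = (a * b).im := fun a b => by simp; ring
    simp only [Prod.fst_neg, Prod.snd_neg, Prod.fst_star, Prod.snd_star, Pi.neg_apply,
      Pi.star_apply, h]
  have h : ∀ a : ℂ, (-star a * star (Complex.I • star a)).im = ‖a‖ ^ 2 := fun a => by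
    rw [← Complex.normSq_eq_norm_sq, Complex.normSq_apply]; simp
  rw [poisson, hre, him, sympl_apply, coeffSq]
  simp only [Prod.smul_fst, Prod.smul_snd, Prod.fst_star, Prod.snd_star, Pi.smul_apply,
    Pi.star_apply, Prod.fst_neg, Prod.snd_neg, Pi.neg_apply, h]

theorem norm_complexForm_le (l : Ambient n) :
    ‖complexForm l‖ ≤ (n + 2) * Real.sqrt (coeffSq l) := by
  have hs : 0 ≤ ∑ i, ‖l.1 i‖ ^ 2 := Finset.sum_nonneg fun i _ => sq_nonneg _
  have h1 : ∀ i, ‖l.1 i‖ ≤ Real.sqrt (coeffSq l) := fun i => Real.le_sqrt_of_sq_le (by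
    have := Finset.single_le_sum (f := fun i => ‖l.1 i‖ ^ 2) (fun i _ => sq_nonneg _)
      (Finset.mem_univ i)
    simp only [coeffSq] at this ⊢
    nlinarith [sq_nonneg ‖l.2.1‖, sq_nonneg ‖l.2.2‖])
  have h2 : ‖l.2.1‖ ≤ Real.sqrt (coeffSq l) := Real.le_sqrt_of_sq_le (by
    simp only [coeffSq]; nlinarith [sq_nonneg ‖l.2.1‖, sq_nonneg ‖l.2.2‖])
  have h3 : ‖l.2.2‖ ≤ Real.sqrt (coeffSq l) := Real.le_sqrt_of_sq_le (by
    simp only [coeffSq]; nlinarith [sq_nonneg ‖l.2.1‖, sq_nonneg ‖l.2.2‖])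
  refine ContinuousLinearMap.opNorm_le_bound _ (by positivity) fun ξ => ?_
  rw [complexForm_apply]
  set S := Real.sqrt (coeffSq l)
  have hS : 0 ≤ S := Real.sqrt_nonneg _
  have b1 : ∀ i, ‖l.1 i * ξ.1 i‖ ≤ S * ‖ξ‖ := fun i => by
    rw [norm_mul]
    exact mul_le_mul (h1 i) ((norm_le_pi_norm ξ.1 i).trans (norm_fst_le ξ)) (norm_nonneg _) hS
  have b2 : ‖l.2.1 * ξ.2.1‖ ≤ S * ‖ξ‖ := by
    rw [norm_mul]
    exact mul_le_mul h2 ((norm_fst_le ξ.2).trans (norm_snd_le ξ)) (norm_nonneg _) hS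
  have b3 : ‖l.2.2 * ξ.2.2‖ ≤ S * ‖ξ‖ := by
    rw [norm_mul]
    exact mul_le_mul h3 ((norm_snd_le ξ.2).trans (norm_snd_le ξ)) (norm_nonneg _) hS
  have b4 : ‖∑ i, l.1 i * ξ.1 i‖ ≤ n * (S * ‖ξ‖) := by
    refine (norm_sum_le_of_le _ fun i _ => b1 i).trans (by simp)
  refine (norm_add₃_le).trans ?_
  linarith

/-- A small perturbation of a large complex linear form has positive Poisson bracket. -/
theorem exists_poisson_pos (n : ℕ) : ∃ ε : ℝ, 0 < ε ∧ ∀ (l : Ambient n) (L : Ambient n →L[ℝ] ℂ),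
    1 / 4 ≤ coeffSq l → ‖L‖ ≤ ε → 1 / 8 ≤ poisson (complexForm l + L) := by
  let B : (Ambient n →L[ℝ] ℂ) → (Ambient n →L[ℝ] ℂ) → ℝ := fun L₁ L₂ =>
    sympl (sgrad (Complex.imCLM ∘L L₁)) (sgrad (Complex.reCLM ∘L L₂))
  have hB : ∃ C : ℝ, 0 ≤ C ∧ ∀ L₁ L₂, |B L₁ L₂| ≤ C * (‖L₁‖ * ‖L₂‖) := by
    let σ := LinearMap.toContinuousBilinearMap (sympl (n := n))
    refine ⟨‖σ‖ * (‖(sgrad : _ →L[ℝ] Ambient n)‖ * ‖Complex.imCLM‖) *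
      (‖(sgrad : _ →L[ℝ] Ambient n)‖ * ‖Complex.reCLM‖), by positivity, fun L₁ L₂ => ?_⟩
    have h1 := σ.le_opNorm₂ (sgrad (Complex.imCLM ∘L L₁)) (sgrad (Complex.reCLM ∘L L₂))
    have h2 : ‖sgrad (Complex.imCLM ∘L L₁)‖ ≤
        ‖(sgrad : _ →L[ℝ] Ambient n)‖ * ‖Complex.imCLM‖ * ‖L₁‖ := by
      rw [mul_assoc]
      exact ContinuousLinearMap.le_opNorm_of_le _ (ContinuousLinearMap.opNorm_comp_le _ _)
    have h3 : ‖sgrad (Complex.reCLM ∘L L₂)‖ ≤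
        ‖(sgrad : _ →L[ℝ] Ambient n)‖ * ‖Complex.reCLM‖ * ‖L₂‖ := by
      rw [mul_assoc]
      exact ContinuousLinearMap.le_opNorm_of_le _ (ContinuousLinearMap.opNorm_comp_le _ _)
    refine (h1.trans (mul_le_mul (mul_le_mul_of_nonneg_left h2 (by positivity)) h3
      (norm_nonneg _) (by positivity))).trans (le_of_eq (by ring))
  obtain ⟨C, hC, hB⟩ := hB
  -- With S² the bracket of the complex linear form, each mixed term is at most S/16 and the
  -- quadratic one at most 1/16, and S² − S/8 − 1/16 ≥ 1/8 for S ≥ 1/2.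
  refine ⟨1 / (16 * (C + 1) * (n + 2)), by positivity, fun l L hl hL => ?_⟩
  set S := Real.sqrt (coeffSq l) with hS
  have hS2 : S ^ 2 = coeffSq l := Real.sq_sqrt (by linarith)
  have hSh : 1 / 2 ≤ S := Real.le_sqrt_of_sq_le (by norm_num; linarith)
  have hexp : poisson (complexForm l + L) =
      poisson (complexForm l) + B (complexForm l) L + B L (complexForm l) + B L L := by
    simp only [poisson, B, ContinuousLinearMap.comp_add, map_add, LinearMap.add_apply]
    ring
  rw [hexp, poisson_complexForm, ← hS2]
  have hn := norm_complexForm_le l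
  rw [← hS] at hn
  have hnL : (n + 2) * ((C + 1) * ‖L‖) ≤ 1 / 16 := by
    have : (0 : ℝ) < 16 * (C + 1) * (n + 2) := by positivity
    rw [le_div_iff₀ this] at hL
    linarith
  have hn2 : (2 : ℝ) ≤ n + 2 := by linarith [Nat.cast_nonneg (α := ℝ) n]
  have hL0 := norm_nonneg L
  have e1 : C * (‖complexForm l‖ * ‖L‖) ≤ S / 16 := by
    have h1 : C * (‖complexForm l‖ * ‖L‖) ≤ C * (((n + 2) * S) * ‖L‖) := by gcongr
    have h2 : (n + 2) * (C * ‖L‖) ≤ 1 / 16 := by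
      refine le_trans ?_ hnL
      gcongr
      linarith
    nlinarith
  have e2 : C * (‖L‖ * ‖L‖) ≤ 1 / 16 := by
    have h1 : (C + 1) * ‖L‖ ≤ 1 / 32 := by nlinarith [mul_nonneg (by linarith : 0 ≤ C + 1) hL0]
    have h2 : C * ‖L‖ ≤ 1 / 32 := by nlinarith
    have h3 : ‖L‖ ≤ 1 / 32 := by nlinarith [mul_nonneg hC hL0]
    nlinarith
  have b1 := abs_le.1 (hB (complexForm l) L)
  have b2 := abs_le.1 (hB L (complexForm l))
  have b3 := abs_le.1 (hB L L)
  rw [mul_comm ‖L‖ ‖complexForm l‖] at b2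
  nlinarith [b1.1, b2.1, b3.1]

end Poisson

/-! ### Logarithmic differentials of the functions in the mirror equation -/

section LogCalculus

variable {n : ℕ}

/-- The curve through `q` with logarithmic velocity `ξ`. -/
def logCurve (q ξ : Ambient n) (s : ℝ) : Ambient n :=
  (fun i => q.1 i * Complex.exp (s * ξ.1 i), q.2 + s • ξ.2)

theorem logCurve_zero (q ξ : Ambient n) : logCurve q ξ 0 = q := by
  simp [logCurve]

theorem hasDerivAt_logCurve (q ξ : Ambient n) : HasDerivAt (logCurve q ξ) (twist q ξ) 0 := by
  have h1 : HasDerivAt (fun s : ℝ => (logCurve q ξ s).1) (q.1 * ξ.1) 0 := by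
    rw [hasDerivAt_pi]
    intro i
    have h0 : HasDerivAt (fun s : ℝ => (s : ℂ) * ξ.1 i) (ξ.1 i) 0 := by
      simpa using (Complex.ofRealCLM.hasDerivAt (x := (0 : ℝ))).mul_const (ξ.1 i)
    exact ((h0.cexp).const_mul (q.1 i)).congr_deriv (by simp)
  have h2 : HasDerivAt (fun s : ℝ => (logCurve q ξ s).2) ξ.2 0 := by
    exact (((hasDerivAt_id (0 : ℝ)).smul_const ξ.2).const_add q.2).congr_deriv (by simp)
  rw [twist_apply]
  exact h1.prodMk h2

theorem hasDerivAt_comp_logCurve {E : Type*} [NormedAddCommGroup E] [NormedSpace ℝ E]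
    {F : Ambient n → E} {q : Ambient n} (hF : DifferentiableAt ℝ F q) (ξ : Ambient n) :
    HasDerivAt (fun s => F (logCurve q ξ s)) (logForm F q ξ) 0 := by
  have h1 : HasFDerivAt F (fderiv ℝ F q) (logCurve q ξ 0) := by
    rw [logCurve_zero]; exact hF.hasFDerivAt
  exact h1.comp_hasDerivAt 0 (hasDerivAt_logCurve q ξ)

theorem logForm_apply_eq {E : Type*} [NormedAddCommGroup E] [NormedSpace ℝ E]
    {F : Ambient n → E} {q ξ : Ambient n} (hF : DifferentiableAt ℝ F q) {d : E}
    (hd : HasDerivAt (fun s => F (logCurve q ξ s)) d 0) : logForm F q ξ = d :=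
  (hasDerivAt_comp_logCurve hF ξ).unique hd

theorem logForm_mul {F G : Ambient n → ℂ} {q : Ambient n} (hF : DifferentiableAt ℝ F q)
    (hG : DifferentiableAt ℝ G q) :
    logForm (fun q => F q * G q) q = F q • logForm G q + G q • logForm F q := by
  have := (hF.hasFDerivAt.mul hG.hasFDerivAt).fderiv
  refine ContinuousLinearMap.ext fun ξ => ?_
  have h2 := congrArg (fun L => L (twist q ξ)) this
  exact h2

theorem norm_logForm_mul_le {F G : Ambient n → ℂ} {q : Ambient n} (hF : DifferentiableAt ℝ F q)
    (hG : DifferentiableAt ℝ G q) {a b a' b' : ℝ} (h1 : ‖F q‖ ≤ a) (h2 : ‖G q‖ ≤ b)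
    (h3 : ‖logForm F q‖ ≤ a') (h4 : ‖logForm G q‖ ≤ b') :
    ‖logForm (fun q => F q * G q) q‖ ≤ a * b' + b * a' := by
  rw [logForm_mul hF hG]
  refine (norm_add_le _ _).trans (add_le_add ?_ ?_)
  · rw [norm_smul]
    exact mul_le_mul h1 h4 (norm_nonneg _) ((norm_nonneg _).trans h1)
  · rw [norm_smul]
    exact mul_le_mul h2 h3 (norm_nonneg _) ((norm_nonneg _).trans h2)

end LogCalculus

/-! ### Monomials, the tail and the mirror equation -/

section Terms

variable {n p : ℕ} (fan : SmoothCompleteFan n p) (lam : Fin p → ℝ) (t : ℝ)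

theorem contDiffOn_zpow (m : ℤ) : ContDiffOn ℝ ∞ (fun z : ℂ => z ^ m) {z | z ≠ 0} := by
  cases m with
  | ofNat a => simpa using (contDiff_id.pow a).contDiffOn
  | negSucc a =>
    simp only [zpow_negSucc]
    exact (contDiff_id.pow (a + 1)).contDiffOn.inv fun z hz => pow_ne_zero _ hz

theorem contDiffOn_term (k : Fin p) :
    ContDiffOn ℝ ∞ (term fan lam t k) (torus n) := by
  refine contDiffOn_const.mul (contDiffOn_prod fun i _ => ?_)
  exact (contDiffOn_zpow _).comp (contDiff_apply ℝ ℂ i).contDiffOn fun z hz => hz i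

theorem contDiffOn_term_fst (k : Fin p) :
    ContDiffOn ℝ ∞ (fun q : Ambient n => term fan lam t k q.1) (space n) :=
  (contDiffOn_term fan lam t k).comp contDiff_fst.contDiffOn fun _ hq => hq

/-- The complex linear form `ξ ↦ ⟨v, ξ⟩`. -/
def rayForm (v : Fin n → ℤ) : Ambient n →L[ℝ] ℂ := complexForm (fun i => (v i : ℂ), 0, 0)

theorem rayForm_apply (v : Fin n → ℤ) (ξ : Ambient n) : rayForm v ξ = ∑ i, (v i : ℂ) * ξ.1 i := by
  simp [rayForm, complexForm_apply]

theorem term_mul_exp (k : Fin p) (z ζ : Fin n → ℂ) :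
    term fan lam t k (fun i => z i * Complex.exp (ζ i)) =
      term fan lam t k z * Complex.exp (∑ i, (fan.ray k i : ℂ) * ζ i) := by
  simp only [term, mul_zpow, Finset.prod_mul_distrib, Complex.exp_sum, ← Complex.exp_int_mul]
  ring

theorem differentiableAt_of_contDiffOn_space {E : Type*} [NormedAddCommGroup E] [NormedSpace ℝ E]
    {F : Ambient n → E} (hF : ContDiffOn ℝ ∞ F (space n)) {q : Ambient n} (hq : q ∈ space n) :
    DifferentiableAt ℝ F q :=
  (hF.contDiffAt (isOpen_space.mem_nhds hq)).differentiableAt (by simp)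

theorem logForm_term (k : Fin p) {q : Ambient n} (hq : q ∈ space n) :
    logForm (fun q : Ambient n => term fan lam t k q.1) q =
      term fan lam t k q.1 • rayForm (fan.ray k) := by
  refine ContinuousLinearMap.ext fun ξ => ?_
  refine logForm_apply_eq (differentiableAt_of_contDiffOn_space
    (contDiffOn_term_fst fan lam t k) hq) ?_
  have h0 : HasDerivAt (fun s : ℝ => (s : ℂ) * rayForm (fan.ray k) ξ) (rayForm (fan.ray k) ξ) 0 := by
    simpa using (Complex.ofRealCLM.hasDerivAt (x := (0 : ℝ))).mul_const (rayForm (fan.ray k) ξ)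
  have h1 := h0.cexp.const_mul (term fan lam t k q.1)
  have h2 : (fun s : ℝ => term fan lam t k (logCurve q ξ s).1) =
      fun s : ℝ => term fan lam t k q.1 * Complex.exp (s * rayForm (fan.ray k) ξ) := by
    funext s
    simp only [logCurve]
    rw [term_mul_exp, rayForm_apply, Finset.mul_sum]
    congr 2
    exact Finset.sum_congr rfl fun i _ => by ring
  rw [h2]
  simpa using h1

theorem norm_eq_exp_logMapT {t : ℝ} (ht : Real.log t ≠ 0) {z : Fin n → ℂ} (hz : z ∈ torus n)
    (i : Fin n) : ‖z i‖ = Real.exp (Real.log t * logMapT t z i) := by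
  have : Real.log t * logMapT t z i = Real.log ‖z i‖ := by
    simp only [logMapT, logMap, Pi.smul_apply, smul_eq_mul]
    field_simp
  rw [this, Real.exp_log (norm_pos_iff.2 (hz i))]

/-- The source of all smallness: for t < 1 a term decays at the rate t^{χ_k}, so only those with χ_k
near zero matter. -/
theorem norm_term {t : ℝ} (ht : 0 < t) (hlog : Real.log t ≠ 0) (k : Fin p) {z : Fin n → ℂ}
    (hz : z ∈ torus n) :
    ‖term fan lam t k z‖ = Real.exp (Real.log t * chi fan lam k (logMapT t z)) := by
  rw [term, norm_mul, Complex.norm_real, Real.norm_of_nonneg (by positivity), norm_prod,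
    Real.rpow_def_of_pos ht, chi, mul_add, Real.exp_add, pairing, Finset.mul_sum, Real.exp_sum]
  congr 1
  refine Finset.prod_congr rfl fun i _ => ?_
  rw [norm_zpow, norm_eq_exp_logMapT hlog hz, ← Real.rpow_intCast, ← Real.exp_mul]
  ring_nf

/-- The sum of the terms other than the one of `j`. -/
def tail (j : Fin p) (q : Ambient n) : ℂ := ∑ k ∈ Finset.univ.erase j, term fan lam t k q.1

/-- The function defining the mirror. -/
def mirrorFun (q : Ambient n) : ℂ := q.2.1 * q.2.2 - potential fan lam t q.1

theorem contDiffOn_tail (j : Fin p) : ContDiffOn ℝ ∞ (tail fan lam t j) (space n) :=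
  ContDiffOn.sum fun k _ => contDiffOn_term_fst fan lam t k

theorem contDiffOn_mirrorFun : ContDiffOn ℝ ∞ (mirrorFun fan lam t) (space n) := by
  refine ContDiffOn.sub ?_ (contDiffOn_const.add
    (ContDiffOn.sum fun k _ => contDiffOn_term_fst fan lam t k))
  exact ((contDiff_fst.comp contDiff_snd).mul (contDiff_snd.comp contDiff_snd)).contDiffOn

theorem potential_eq (j : Fin p) (q : Ambient n) :
    potential fan lam t q.1 = 1 + (term fan lam t j q.1 + tail fan lam t j q) := by
  rw [potential, tail, Finset.add_sum_erase _ (fun k => term fan lam t k q.1) (Finset.mem_univ j)]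

theorem logForm_tail (j : Fin p) {q : Ambient n} (hq : q ∈ space n) :
    logForm (tail fan lam t j) q =
      ∑ k ∈ Finset.univ.erase j, term fan lam t k q.1 • rayForm (fan.ray k) := by
  have h := (HasFDerivAt.fun_sum (u := Finset.univ.erase j) fun k _ =>
    (differentiableAt_of_contDiffOn_space (contDiffOn_term_fst fan lam t k) hq).hasFDerivAt).fderiv
  have h' : fderiv ℝ (tail fan lam t j) q = _ := h
  rw [logForm, h', ContinuousLinearMap.finsetSum_comp]
  exact Finset.sum_congr rfl fun k _ => logForm_term fan lam t k hq

/-- The coefficients of the leading part of the differential of the mirror equation. -/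
def leadCoeff (j : Fin p) (q : Ambient n) : Ambient n :=
  (fun i => -(term fan lam t j q.1 * (fan.ray j i : ℂ)), q.2.2, q.2.1)

theorem logForm_mirrorFun (j : Fin p) {q : Ambient n} (hq : q ∈ space n) :
    logForm (mirrorFun fan lam t) q =
      complexForm (leadCoeff fan lam t j q) - logForm (tail fan lam t j) q := by
  refine ContinuousLinearMap.ext fun ξ => ?_
  have hd : DifferentiableAt ℝ (mirrorFun fan lam t) q :=
    differentiableAt_of_contDiffOn_space (contDiffOn_mirrorFun fan lam t) hq
  have h1 := hasDerivAt_comp_logCurve (differentiableAt_of_contDiffOn_space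
    (contDiffOn_term_fst fan lam t j) hq) ξ
  have h2 := hasDerivAt_comp_logCurve (differentiableAt_of_contDiffOn_space
    (contDiffOn_tail fan lam t j) hq) ξ
  have h3 : HasDerivAt (fun s : ℝ => (logCurve q ξ s).2.1) ξ.2.1 0 := by
    exact (((hasDerivAt_id (0 : ℝ)).smul_const ξ.2.1).const_add q.2.1).congr_deriv (by simp)
  have h4 : HasDerivAt (fun s : ℝ => (logCurve q ξ s).2.2) ξ.2.2 0 := by
    exact (((hasDerivAt_id (0 : ℝ)).smul_const ξ.2.2).const_add q.2.2).congr_deriv (by simp)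
  refine logForm_apply_eq hd ?_
  have h5 := (h3.mul h4).sub ((h1.add h2).const_add 1)
  have h6 : (fun s => mirrorFun fan lam t (logCurve q ξ s)) = fun s => (logCurve q ξ s).2.1 *
      (logCurve q ξ s).2.2 - (1 + (term fan lam t j (logCurve q ξ s).1 +
        tail fan lam t j (logCurve q ξ s))) := by
    funext s; rw [mirrorFun, potential_eq fan lam t j]
  rw [h6]
  refine h5.congr_deriv ?_
  rw [logForm_term fan lam t j hq, logCurve_zero, sub_apply, complexForm_apply]
  simp only [leadCoeff, smul_apply, rayForm_apply, smul_eq_mul, Finset.mul_sum, neg_mul,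
    Finset.sum_neg_distrib, mul_assoc]
  ring

/-- The leading part is large on the mirror. -/
theorem one_div_four_le_coeffSq (j : Fin p) {q : Ambient n}
    (h : ‖1 + term fan lam t j q.1 - q.2.1 * q.2.2‖ ≤ 1 / 4) :
    1 / 4 ≤ coeffSq (leadCoeff fan lam t j q) := by
  have hs : ∑ i, ‖(leadCoeff fan lam t j q).1 i‖ ^ 2 =
      ‖term fan lam t j q.1‖ ^ 2 * raySq fan j := by
    rw [raySq, Finset.mul_sum]
    refine Finset.sum_congr rfl fun i _ => ?_
    simp only [leadCoeff, norm_neg, norm_mul, mul_pow]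
    congr 1
    rw [← Complex.ofReal_intCast, Complex.norm_real, Real.norm_eq_abs, sq_abs]
  rw [coeffSq, hs]
  simp only [leadCoeff]
  have hr := one_le_raySq fan j
  set w := term fan lam t j q.1
  -- Either |w| ≥ 1/2, and |w|²|v_j|² ≥ 1/4 as |v_j| ≥ 1, or |uv| ≥ 1 − 1/4 − 1/2 = 1/4, and |u|² +
  -- |v|² ≥ 2|uv|.
  by_cases hw : 1 / 2 ≤ ‖w‖
  · nlinarith [sq_nonneg ‖q.2.1‖, sq_nonneg ‖q.2.2‖, sq_nonneg ‖w‖]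
  · have h1 : ‖(1 : ℂ)‖ ≤ ‖1 + w - q.2.1 * q.2.2‖ + ‖w‖ + ‖q.2.1 * q.2.2‖ := by
      have : (1 : ℂ) = (1 + w - q.2.1 * q.2.2) + (-w) + q.2.1 * q.2.2 := by ring
      conv_lhs => rw [this]
      refine norm_add₃_le.trans ?_
      rw [norm_neg]
    rw [norm_one, norm_mul] at h1
    have h2 : 1 / 4 ≤ ‖q.2.1‖ * ‖q.2.2‖ := by linarith
    have h3 : 0 ≤ ‖w‖ ^ 2 * raySq fan j := by positivity
    nlinarith [sq_nonneg (‖q.2.1‖ - ‖q.2.2‖)]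

end Terms

/-! ### Cutoff functions on the torus and on the fibre -/

section Cutoffs

variable {n : ℕ}

theorem logCurve_mem_space {q : Ambient n} (hq : q ∈ space n) (ξ : Ambient n) (s : ℝ) :
    logCurve q ξ s ∈ space n := fun i => mul_ne_zero (hq i) (Complex.exp_ne_zero _)

theorem logMapT_mul_exp (t : ℝ) {z : Fin n → ℂ} (hz : z ∈ torus n) (ζ : Fin n → ℂ) :
    logMapT t (fun i => z i * Complex.exp (ζ i)) =
      logMapT t z + (Real.log t)⁻¹ • fun i => (ζ i).re := by
  ext i
  simp only [logMapT, logMap, Pi.add_apply, Pi.smul_apply, smul_eq_mul]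
  rw [norm_mul, Complex.norm_exp, Real.log_mul (norm_ne_zero_iff.2 (hz i)) (Real.exp_ne_zero _),
    Real.log_exp, mul_add]

theorem contDiffOn_logMapT (t : ℝ) : ContDiffOn ℝ ∞ (logMapT (n := n) t) (torus n) := by
  refine ContDiffOn.const_smul _ ?_
  rw [contDiffOn_pi]
  intro i
  refine ContDiffOn.log ?_ fun z hz => norm_ne_zero_iff.2 (hz i)
  exact (contDiff_apply ℝ ℂ i).contDiffOn.norm ℝ fun z hz => hz i

/-- The cutoff function on the torus obtained from one on `ℝⁿ`. -/
def baseCut (t : ℝ) (f : (Fin n → ℝ) → ℝ) (z : Fin n → ℂ) : ℝ :=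
  (torus n).indicator (fun z => f (logMapT t z)) z

theorem baseCut_of_mem (t : ℝ) (f : (Fin n → ℝ) → ℝ) {z : Fin n → ℂ} (hz : z ∈ torus n) :
    baseCut t f z = f (logMapT t z) := indicator_of_mem hz _

theorem baseCut_mem_Icc {t : ℝ} {f : (Fin n → ℝ) → ℝ} (hf : ∀ x, f x ∈ Icc (0 : ℝ) 1)
    (z : Fin n → ℂ) : baseCut t f z ∈ Icc (0 : ℝ) 1 := by
  by_cases hz : z ∈ torus n
  · rw [baseCut_of_mem t f hz]; exact hf _
  · rw [baseCut, indicator_of_notMem hz]; exact ⟨le_rfl, zero_le_one⟩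

theorem contDiffOn_baseCut (t : ℝ) {f : (Fin n → ℝ) → ℝ} (hf : ContDiff ℝ ∞ f) :
    ContDiffOn ℝ ∞ (baseCut t f) (torus n) :=
  (hf.comp_contDiffOn (contDiffOn_logMapT t)).congr fun _ hz => baseCut_of_mem t f hz

theorem contDiffOn_baseCut_fst (t : ℝ) {f : (Fin n → ℝ) → ℝ} (hf : ContDiff ℝ ∞ f) :
    ContDiffOn ℝ ∞ (fun q : Ambient n => (baseCut t f q.1 : ℂ)) (space n) :=
  Complex.ofRealCLM.contDiff.comp_contDiffOn
    ((contDiffOn_baseCut t hf).comp contDiff_fst.contDiffOn fun _ hq => hq)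

/-- Differentiating `logMapT` in logarithmic coordinates gives a factor 1/|log t| ≤ 1, so the bound
is uniform in t. -/
theorem norm_logForm_baseCut_le {t : ℝ} (ht : 1 ≤ |Real.log t|) {f : (Fin n → ℝ) → ℝ}
    (hf : ContDiff ℝ ∞ f) {C : ℝ} (hC0 : 0 ≤ C) (hC : ∀ x, ‖fderiv ℝ f x‖ ≤ C) {q : Ambient n}
    (hq : q ∈ space n) :
    ‖logForm (fun q : Ambient n => (baseCut t f q.1 : ℂ)) q‖ ≤ C := by
  refine ContinuousLinearMap.opNorm_le_bound _ hC0 fun ξ => ?_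
  set y : Fin n → ℝ := (Real.log t)⁻¹ • fun i => (ξ.1 i).re with hy
  have h1 : (fun s : ℝ => (baseCut t f (logCurve q ξ s).1 : ℂ)) =
      fun s : ℝ => ((f (logMapT t q.1 + s • y) : ℝ) : ℂ) := by
    funext s
    rw [baseCut_of_mem t f (logCurve_mem_space hq ξ s)]
    simp only [logCurve]
    rw [logMapT_mul_exp t hq]
    congr 3
    ext i
    simp [hy]
    ring
  have h2 : HasDerivAt (fun s : ℝ => logMapT t q.1 + s • y) y 0 := by
    exact (((hasDerivAt_id (0 : ℝ)).smul_const y).const_add _).congr_deriv (by simp)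
  have h3 : HasFDerivAt f (fderiv ℝ f (logMapT t q.1)) (logMapT t q.1 + (0 : ℝ) • y) := by
    rw [zero_smul, add_zero]; exact (hf.differentiable (by simp) _).hasFDerivAt
  have h4 := (h3.comp_hasDerivAt 0 h2).ofReal_comp
  have h5 : logForm (fun q : Ambient n => (baseCut t f q.1 : ℂ)) q ξ =
      ((fderiv ℝ f (logMapT t q.1) y : ℝ) : ℂ) := by
    refine logForm_apply_eq (differentiableAt_of_contDiffOn_space
      (contDiffOn_baseCut_fst t hf) hq) ?_
    rw [h1]
    exact h4
  rw [h5, Complex.norm_real]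
  have hy1 : ‖y‖ ≤ ‖ξ‖ := by
    rw [hy, norm_smul, norm_inv, Real.norm_eq_abs]
    have e1 : ‖fun i => (ξ.1 i).re‖ ≤ ‖ξ‖ := by
      refine (pi_norm_le_iff_of_nonneg (norm_nonneg _)).2 fun i => ?_
      exact (Complex.abs_re_le_norm _).trans ((norm_le_pi_norm ξ.1 i).trans (norm_fst_le ξ))
    have e2 : |Real.log t|⁻¹ ≤ 1 := inv_le_one_of_one_le₀ ht
    calc _ ≤ 1 * ‖ξ‖ := mul_le_mul e2 e1 (norm_nonneg _) zero_le_one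
      _ = _ := one_mul _
  exact ContinuousLinearMap.le_of_opNorm_le_of_le _ (hC _) hy1

theorem norm_logForm_fiberCut_le {θ : ℂ × ℂ → ℝ} (hθ : ContDiff ℝ ∞ θ) {C c : ℝ} (hC0 : 0 ≤ C)
    (hC : ∀ w, ‖fderiv ℝ θ w‖ ≤ C) (hc0 : 0 ≤ c) (hc : c ≤ 1) (q : Ambient n) :
    ‖logForm (fun q : Ambient n => (θ (c • q.2) : ℂ)) q‖ ≤ C := by
  refine ContinuousLinearMap.opNorm_le_bound _ hC0 fun ξ => ?_
  have h2 : HasDerivAt (fun s : ℝ => c • (logCurve q ξ s).2) (c • ξ.2) 0 := by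
    exact ((((hasDerivAt_id (0 : ℝ)).smul_const ξ.2).const_add q.2).const_smul c).congr_deriv
      (by simp)
  have h3 : HasFDerivAt θ (fderiv ℝ θ (c • q.2)) (c • (logCurve q ξ 0).2) := by
    rw [logCurve_zero]; exact (hθ.differentiable (by simp) _).hasFDerivAt
  have h4 := (h3.comp_hasDerivAt 0 h2).ofReal_comp
  have hd : ContDiff ℝ ∞ (fun q : Ambient n => (θ (c • q.2) : ℂ)) :=
    Complex.ofRealCLM.contDiff.comp (hθ.comp (contDiff_snd.const_smul c))
  have h5 : logForm (fun q : Ambient n => (θ (c • q.2) : ℂ)) q ξ =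
      ((fderiv ℝ θ (c • q.2) (c • ξ.2) : ℝ) : ℂ) :=
    logForm_apply_eq (hd.differentiable (by simp) q) h4
  rw [h5, Complex.norm_real]
  refine ContinuousLinearMap.le_of_opNorm_le_of_le _ (hC _) ?_
  rw [norm_smul, Real.norm_of_nonneg hc0]
  calc _ ≤ 1 * ‖ξ‖ := mul_le_mul hc (norm_snd_le ξ) (norm_nonneg _) zero_le_one
    _ = _ := one_mul _

/-- The points of the ambient space over given compact sets. -/
def tube (t : ℝ) (A : Set (Fin n → ℝ)) (D : Set (ℂ × ℂ)) : Set (Ambient n) :=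
  {q | q ∈ space n ∧ logMapT t q.1 ∈ A ∧ q.2 ∈ D}

/-- Polar coordinates present the tube as a continuous image of A × (S¹)ⁿ × D. -/
theorem isCompact_tube {t : ℝ} (ht : Real.log t ≠ 0) {A : Set (Fin n → ℝ)} (hA : IsCompact A)
    {D : Set (ℂ × ℂ)} (hD : IsCompact D) : IsCompact (tube t A D) := by
  let c : Set (Fin n → ℂ) := univ.pi fun _ => Metric.sphere (0 : ℂ) 1
  have hc : IsCompact c := isCompact_univ_pi fun _ => isCompact_sphere _ _
  let g : (Fin n → ℝ) × (Fin n → ℂ) × (ℂ × ℂ) → Ambient n := fun a =>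
    (fun i => (Real.exp (Real.log t * a.1 i) : ℂ) * a.2.1 i, a.2.2)
  have hg : Continuous g := by fun_prop
  have : tube t A D = g '' (A ×ˢ (c ×ˢ D)) := by
    ext q
    constructor
    · rintro ⟨h1, h2, h3⟩
      have hn : ∀ i, ‖q.1 i‖ ≠ 0 := fun i => norm_ne_zero_iff.2 (h1 i)
      refine ⟨(logMapT t q.1, fun i => q.1 i / ‖q.1 i‖, q.2), ⟨h2, fun i _ => ?_, h3⟩, ?_⟩
      · simp [div_self (hn i)]
      · refine Prod.ext (funext fun i => ?_) rfl
        simp only [g]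
        rw [← norm_eq_exp_logMapT ht h1]
        have : (‖q.1 i‖ : ℂ) ≠ 0 := by exact_mod_cast hn i
        field_simp
    · rintro ⟨⟨x, y, w⟩, ⟨hx, hy, hw⟩, rfl⟩
      have hy1 : ∀ i, ‖y i‖ = 1 := fun i => by simpa using hy i (mem_univ i)
      have hsp : g (x, y, w) ∈ space n := fun i => by
        refine mul_ne_zero (by exact_mod_cast Real.exp_ne_zero _) ?_
        rw [← norm_ne_zero_iff, hy1]; exact one_ne_zero
      refine ⟨hsp, ?_, hw⟩
      have : logMapT t (g (x, y, w)).1 = x := by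
        ext i
        simp only [logMapT, logMap, g, Pi.smul_apply, smul_eq_mul]
        rw [norm_mul, hy1, mul_one, Complex.norm_real, Real.norm_eq_abs, Real.abs_exp,
          Real.log_exp]
        field_simp
      rwa [this]
  rw [this]
  exact (hA.prod (hc.prod hD)).image hg

theorem mem_box {t : ℝ} (ht : Real.log t ≠ 0) {R : ℝ} {U : Set (Fin n → ℝ)} {q : Ambient n} :
    q ∈ box t R U ↔ q ∈ space n ∧ logMapT t q.1 ∈ U ∧ ‖q.2.1‖ ^ 2 / 2 ≤ R ∧
      ‖q.2.2‖ ^ 2 / 2 ≤ R := by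
  have h1 : logMap q.1 ∈ Real.log t • U ↔ logMapT t q.1 ∈ U := by
    rw [mem_smul_set_iff_inv_smul_mem₀ ht]; rfl
  have h2 : ∀ x : ℂ, 0 ≤ ‖x‖ ^ 2 / 2 := fun x => by positivity
  simp only [box, momentMap, mem_ofPred_eq, mem_prod, mem_Icc, h1, h2, true_and]
  rfl

end Cutoffs

/-! ### The family joining the mirror to its simplification -/

section Perturbation

variable {n p : ℕ} (fan : SmoothCompleteFan n p) (lam : Fin p → ℝ) (t : ℝ) (j : Fin p)

/-- The perturbation of the mirror equation. -/
def pert (τ : ℂ × ℂ → ℝ) (ρ : (Fin n → ℂ) → ℝ) (q : Ambient n) : ℂ :=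
  ((τ q.2 : ℂ) * (ρ q.1 : ℂ)) * tail fan lam t j q

variable {fan lam t j}

theorem mirror_eq (τ : ℂ × ℂ → ℝ) (ρ : (Fin n → ℂ) → ℝ) : mirror fan lam t =
    {q | q ∈ space n ∧ family (mirrorFun fan lam t) (pert fan lam t j τ ρ) 0 q = 0} := by
  ext q
  simp only [mirror, family, mirrorFun, Complex.ofReal_zero, zero_mul, add_zero, mem_ofPred_eq,
    sub_eq_zero]
  rfl

theorem cutMirror_eq (τ : ℂ × ℂ → ℝ) (ρ : (Fin n → ℂ) → ℝ) : cutMirror fan lam t j τ ρ =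
    {q | q ∈ space n ∧ family (mirrorFun fan lam t) (pert fan lam t j τ ρ) 1 q = 0} := by
  ext q
  have : family (mirrorFun fan lam t) (pert fan lam t j τ ρ) 1 q =
      q.2.1 * q.2.2 - cutPotential fan lam t j τ ρ q := by
    simp only [family, mirrorFun, pert, cutPotential, tail]; push_cast; ring
  simp only [cutMirror, mem_ofPred_eq, this, sub_eq_zero]
  rfl

theorem isTransportData_pert {θ : ℂ × ℂ → ℝ} (hθ : ContDiff ℝ ∞ θ) {f : (Fin n → ℝ) → ℝ}
    (hf : ContDiff ℝ ∞ f) {A : Set (Fin n → ℝ)} (hA : IsCompact A) (hfA : ∀ x, x ∉ A → f x = 0)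
    {D : Set (ℂ × ℂ)} (hD : IsCompact D) (hθD : ∀ w, w ∉ D → θ w = 0) (ht : Real.log t ≠ 0) :
    IsTransportData (mirrorFun fan lam t) (pert fan lam t j θ (baseCut t f)) (tube t A D) := by
  have hK := isCompact_tube ht hA hD
  have h0 : ∀ q, q ∉ tube t A D → pert fan lam t j θ (baseCut t f) q = 0 := by
    intro q hq
    by_cases h1 : q ∈ space n
    · by_cases h2 : logMapT t q.1 ∈ A
      · have h3 : q.2 ∉ D := fun h3 => hq ⟨h1, h2, h3⟩
        simp [pert, hθD _ h3]
      · simp [pert, baseCut_of_mem t f h1, hfA _ h2]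
    · simp [pert, baseCut, indicator_of_notMem (show q.1 ∉ torus n from h1)]
  refine ⟨contDiffOn_mirrorFun fan lam t, ?_, hK, fun q hq => hq.1, h0⟩
  refine contDiff_of_contDiffOn_of_eq_zero isOpen_space hK.isClosed (fun q hq => hq.1) ?_ h0
  exact (((Complex.ofRealCLM.contDiff.comp (hθ.comp contDiff_snd)).contDiffOn).mul
    (contDiffOn_baseCut_fst t hf)).mul (contDiffOn_tail fan lam t j)

theorem norm_logForm_pert_le {θ : ℂ × ℂ → ℝ} (hθ : ContDiff ℝ ∞ θ)
    (hθI : ∀ w, θ w ∈ Icc (0 : ℝ) 1) {f : (Fin n → ℝ) → ℝ}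
    (hf : ContDiff ℝ ∞ f) (hfI : ∀ x, f x ∈ Icc (0 : ℝ) 1) {q : Ambient n} (hq : q ∈ space n)
    {C₁ C₂ T T' : ℝ} (h1 : ‖logForm (fun q : Ambient n => (θ q.2 : ℂ)) q‖ ≤ C₁)
    (h2 : ‖logForm (fun q : Ambient n => (baseCut t f q.1 : ℂ)) q‖ ≤ C₂)
    (h3 : ‖tail fan lam t j q‖ ≤ T) (h4 : ‖logForm (tail fan lam t j) q‖ ≤ T') :
    ‖logForm (pert fan lam t j θ (baseCut t f)) q‖ ≤ T' + T * (C₁ + C₂) := by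
  have hn : ∀ x ∈ Icc (0 : ℝ) 1, ‖(x : ℂ)‖ ≤ 1 := fun x hx => by
    rw [Complex.norm_real, Real.norm_of_nonneg hx.1]; exact hx.2
  have d1 : DifferentiableAt ℝ (fun q : Ambient n => (θ q.2 : ℂ)) q :=
    (Complex.ofRealCLM.contDiff.comp (hθ.comp contDiff_snd)).differentiable (by simp) q
  have d2 := differentiableAt_of_contDiffOn_space (contDiffOn_baseCut_fst t hf) hq
  have d3 := differentiableAt_of_contDiffOn_space (contDiffOn_tail fan lam t j) hq
  have e1 := norm_logForm_mul_le d1 d2 (hn _ (hθI _)) (hn _ (baseCut_mem_Icc hfI _)) h1 h2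
  have e2 : ‖(θ q.2 : ℂ) * (baseCut t f q.1 : ℂ)‖ ≤ 1 := by
    rw [norm_mul]
    exact mul_le_one₀ (hn _ (hθI _)) (norm_nonneg _) (hn _ (baseCut_mem_Icc hfI _))
  have e3 := norm_logForm_mul_le (d1.mul d2) d3 e2 h3 e1 h4
  refine e3.trans (le_of_eq ?_)
  ring

/-- The hypersurfaces of the family are symplectic where the tail is small. -/
theorem poisson_family_ge {ε : ℝ} (hε : ∀ (l : Ambient n) (L : Ambient n →L[ℝ] ℂ),
      1 / 4 ≤ coeffSq l → ‖L‖ ≤ ε → 1 / 8 ≤ poisson (complexForm l + L))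
    {τ : ℂ × ℂ → ℝ} (hτ : ∀ w, τ w ∈ Icc (0 : ℝ) 1) {ρ : (Fin n → ℂ) → ℝ}
    (hρ : ∀ z, ρ z ∈ Icc (0 : ℝ) 1) (hN : ContDiff ℝ ∞ (pert fan lam t j τ ρ))
    {q : Ambient n} (hq : q ∈ space n) (h1 : ‖tail fan lam t j q‖ ≤ 1 / 16) {a b : ℝ}
    (h2 : ‖logForm (tail fan lam t j) q‖ ≤ a) (h3 : ‖logForm (pert fan lam t j τ ρ) q‖ ≤ b)
    (hab : a + b ≤ ε) {s : ℝ} (hs : s ∈ Icc (0 : ℝ) 1)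
    (h4 : ‖family (mirrorFun fan lam t) (pert fan lam t j τ ρ) s q‖ ≤ 1 / 8) :
    1 / 8 ≤ poisson (logForm (family (mirrorFun fan lam t) (pert fan lam t j τ ρ) s) q) := by
  rw [logForm_family (contDiffOn_mirrorFun fan lam t) hN s hq, logForm_mirrorFun fan lam t j hq,
    sub_add_eq_add_sub, add_sub_assoc]
  refine hε _ _ (one_div_four_le_coeffSq fan lam t j ?_) ?_
  -- F_s = uv − 1 − w − m · tail with 0 ≤ m ≤ 1, so |1 + w − uv| ≤ 1/8 + 1/16 < 1/4.
  · set m : ℝ := 1 - s * (τ q.2 * ρ q.1) with hm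
    have hm1 : |m| ≤ 1 := by
      have a1 := hτ q.2; have a2 := hρ q.1
      have p1 : 0 ≤ s * (τ q.2 * ρ q.1) := mul_nonneg hs.1 (mul_nonneg a1.1 a2.1)
      have p2 : s * (τ q.2 * ρ q.1) ≤ 1 :=
        mul_le_one₀ hs.2 (mul_nonneg a1.1 a2.1) (mul_le_one₀ a1.2 a2.1 a2.2)
      rw [abs_le]; constructor <;> linarith
    have e : 1 + term fan lam t j q.1 - q.2.1 * q.2.2 =
        -family (mirrorFun fan lam t) (pert fan lam t j τ ρ) s q - m * tail fan lam t j q := by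
      rw [family, mirrorFun, potential_eq fan lam t j, pert, hm]; push_cast; ring
    rw [e]
    refine (norm_sub_le _ _).trans ?_
    rw [norm_neg, norm_mul, Complex.norm_real, Real.norm_eq_abs]
    have : |m| * ‖tail fan lam t j q‖ ≤ 1 * (1 / 16) :=
      mul_le_mul hm1 h1 (norm_nonneg _) zero_le_one
    linarith
  · refine (norm_sub_le _ _).trans ?_
    rw [norm_smul, Real.norm_of_nonneg hs.1]
    have : s * ‖logForm (pert fan lam t j τ ρ) q‖ ≤ 1 * b :=
      mul_le_mul hs.2 h3 (norm_nonneg _) zero_le_one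
    linarith

end Perturbation

/-! ### The mirror and its simplification as symplectic submanifolds with boundary -/

section Submanifold

variable {n p : ℕ} {fan : SmoothCompleteFan n p} {lam : Fin p → ℝ} {t : ℝ}

/-- The vectors `(0, -c u, c v)` are tangent to the mirror. -/
theorem fderiv_mirrorFun_rotation (j : Fin p) {q : Ambient n} (hq : q ∈ space n) (c : ℝ) :
    fderiv ℝ (mirrorFun fan lam t) q (0, -(c * q.2.1), c * q.2.2) = 0 := by
  have h : twist q (0, -(c * q.2.1), c * q.2.2) = (0, -(c * q.2.1), c * q.2.2) := by
    rw [twist_apply]; simp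
  rw [← h]
  change logForm (mirrorFun fan lam t) q _ = 0
  rw [logForm_mirrorFun fan lam t j hq, logForm_tail fan lam t j hq, sub_apply, complexForm_apply]
  simp [leadCoeff, rayForm_apply, sum_apply]
  ring

theorem fderiv_normSq_fst (R : ℝ) (q ξ : Ambient n) :
    fderiv ℝ (fun q : Ambient n => ‖q.2.1‖ ^ 2 / 2 - R) q ξ = (q.2.1 * star ξ.2.1).re := by
  have h0 : HasFDerivAt (fun q : Ambient n => q.2.1)
      (ContinuousLinearMap.fst ℝ ℂ ℂ ∘L ContinuousLinearMap.snd ℝ (Fin n → ℂ) (ℂ × ℂ)) q :=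
    (ContinuousLinearMap.fst ℝ ℂ ℂ ∘L ContinuousLinearMap.snd ℝ (Fin n → ℂ) (ℂ × ℂ)).hasFDerivAt
  have h1 := ((h0.norm_sq.mul_const (2⁻¹ : ℝ)).sub_const R).fderiv
  simp only [div_eq_mul_inv]
  rw [h1]
  simp [Complex.inner]
  ring

theorem fderiv_normSq_snd (R : ℝ) (q ξ : Ambient n) :
    fderiv ℝ (fun q : Ambient n => ‖q.2.2‖ ^ 2 / 2 - R) q ξ = (q.2.2 * star ξ.2.2).re := by
  have h0 : HasFDerivAt (fun q : Ambient n => q.2.2)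
      (ContinuousLinearMap.snd ℝ ℂ ℂ ∘L ContinuousLinearMap.snd ℝ (Fin n → ℂ) (ℂ × ℂ)) q :=
    (ContinuousLinearMap.snd ℝ ℂ ℂ ∘L ContinuousLinearMap.snd ℝ (Fin n → ℂ) (ℂ × ℂ)).hasFDerivAt
  have h1 := ((h0.norm_sq.mul_const (2⁻¹ : ℝ)).sub_const R).fderiv
  simp only [div_eq_mul_inv]
  rw [h1]
  simp [Complex.inner]
  ring

/-- As U is open, the boundary lies in |u|²/2 = R and |v|²/2 = R, and |u||v| ≤ B < 2R keeps these
two faces apart. The vectors (−u, v) and (u, −v) respectively are tangent to the hypersurface there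
and point inwards. -/
theorem isSymplecticSubmanifold_family (j : Fin p) (ht : Real.log t ≠ 0)
    {N : Ambient n → ℂ} (hN : ContDiff ℝ ∞ N) {U : Set (Fin n → ℝ)} (hU : IsOpen U)
    {R R' B : ℝ} (hB0 : 0 ≤ B) (hBR : B < 2 * R) (hR : R' < R)
    (hN0 : ∀ q : Ambient n, ¬ (‖q.2.1‖ ^ 2 / 2 ≤ R' ∧ ‖q.2.2‖ ^ 2 / 2 ≤ R') → N q = 0) {s : ℝ}
    (hP : ∀ q ∈ space n, logMapT t q.1 ∈ U → family (mirrorFun fan lam t) N s q = 0 →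
      poisson (logForm (family (mirrorFun fan lam t) N s) q) ≠ 0)
    (hB : ∀ q ∈ space n, logMapT t q.1 ∈ U → family (mirrorFun fan lam t) N s q = 0 →
      ‖q.2.1‖ * ‖q.2.2‖ ≤ B) :
    IsSymplecticSubmanifold
      ({q | q ∈ space n ∧ family (mirrorFun fan lam t) N s q = 0} ∩ box t R U) := by
  set F := family (mirrorFun fan lam t) N s with hF
  have hFs : ContDiffOn ℝ ∞ F (space n) :=
    (contDiffOn_mirrorFun fan lam t).add (contDiffOn_const.mul hN.contDiffOn)
  have hΩ : IsOpen {q : Ambient n | q ∈ space n ∧ logMapT t q.1 ∈ U} := by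
    have h1 : ContinuousOn (fun q : Ambient n => logMapT t q.1) (space n) :=
      (contDiffOn_logMapT t).continuousOn.comp continuous_fst.continuousOn fun _ hq => hq
    exact h1.isOpen_inter_preimage isOpen_space hU
  have hcu : Continuous fun q : Ambient n => ‖q.2.1‖ ^ 2 / 2 := by fun_prop
  have hcv : Continuous fun q : Ambient n => ‖q.2.2‖ ^ 2 / 2 := by fun_prop
  have hsu : ContDiff ℝ ∞ fun q : Ambient n => ‖q.2.1‖ ^ 2 / 2 - R :=
    (((contDiff_fst.comp contDiff_snd).norm_sq ℝ).div_const 2).sub contDiff_const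
  have hsv : ContDiff ℝ ∞ fun q : Ambient n => ‖q.2.2‖ ^ 2 / 2 - R :=
    (((contDiff_snd.comp contDiff_snd).norm_sq ℝ).div_const 2).sub contDiff_const
  have hsmall : ∀ a b : ℝ, 0 ≤ a → 0 ≤ b → a ^ 2 / 2 = R → a * b ≤ B → b ^ 2 / 2 < R := by
    intro a b ha hb haR hab
    by_contra hc
    have hc : a ^ 2 / 2 ≤ b ^ 2 / 2 := haR ▸ not_lt.1 hc
    have h1 : a ≤ b := by
      by_contra h
      nlinarith [not_le.1 h]
    nlinarith
  refine isSymplecticSubmanifold_of_equations fun q hq => ?_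
  obtain ⟨⟨hqs, hFq⟩, hqb⟩ := hq
  obtain ⟨-, hqU, hu, hv⟩ := (mem_box ht).1 hqb
  have hPq := hP q hqs hqU hFq
  have hBq := hB q hqs hqU hFq
  refine ⟨hqs, F, ?_⟩
  -- Near either face N vanishes because R' < R, so F agrees locally with `mirrorFun`, whose tangent
  -- vectors include the hyperbolic rotations of (u, v).
  have hFd : ∀ ξ, (¬ (‖q.2.1‖ ^ 2 / 2 ≤ R' ∧ ‖q.2.2‖ ^ 2 / 2 ≤ R')) →
      fderiv ℝ F q ξ = fderiv ℝ (mirrorFun fan lam t) q ξ := by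
    intro ξ hn
    have hopen : IsOpen {q : Ambient n | ¬ (‖q.2.1‖ ^ 2 / 2 ≤ R' ∧ ‖q.2.2‖ ^ 2 / 2 ≤ R')} :=
      ((isClosed_le hcu continuous_const).inter (isClosed_le hcv continuous_const)).isOpen_compl
    have : F =ᶠ[nhds q] mirrorFun fan lam t := by
      filter_upwards [hopen.mem_nhds hn] with x hx
      simp [hF, family, hN0 x hx]
    rw [this.fderiv_eq]
  by_cases hu' : ‖q.2.1‖ ^ 2 / 2 = R
  · have hv' : ‖q.2.2‖ ^ 2 / 2 < R :=
      hsmall _ _ (norm_nonneg _) (norm_nonneg _) hu' hBq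
    refine ⟨{q | q ∈ space n ∧ logMapT t q.1 ∈ U} ∩ {q | ‖q.2.2‖ ^ 2 / 2 < R},
      fun q => ‖q.2.1‖ ^ 2 / 2 - R, hΩ.inter (isOpen_lt hcv continuous_const),
      ⟨⟨hqs, hqU⟩, hv'⟩, hFs.mono fun x hx => hx.1.1, hsu.contDiffOn, ?_, hPq,
      fun _ => ⟨(0, -((1 : ℝ) * q.2.1), (1 : ℝ) * q.2.2), ?_, ?_⟩⟩
    · ext x
      constructor
      · rintro ⟨⟨⟨-, h1⟩, h2⟩, h3⟩
        exact ⟨h3, h1, by linarith [((mem_box ht).1 h2).2.2.1]⟩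
      · rintro ⟨h3, h1, h2⟩
        exact ⟨⟨⟨h3.1.1, h1⟩, (mem_box ht).2 ⟨h3.1.1, h3.1.2, by linarith,
          le_of_lt (show _ < _ from h3.2)⟩⟩, h3⟩
    · rw [hFd _ fun h => absurd h.1 (by rw [hu']; exact not_le.2 hR)]
      exact fderiv_mirrorFun_rotation j hqs 1
    · rw [fderiv_normSq_fst]
      have : (q.2.1 * star (-((1 : ℝ) * q.2.1))).re = -‖q.2.1‖ ^ 2 := by
        rw [← Complex.normSq_eq_norm_sq, Complex.normSq_apply]; simp
      simp only [this]
      linarith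
  · have hu'' : ‖q.2.1‖ ^ 2 / 2 < R := lt_of_le_of_ne hu hu'
    refine ⟨{q | q ∈ space n ∧ logMapT t q.1 ∈ U} ∩ {q | ‖q.2.1‖ ^ 2 / 2 < R},
      fun q => ‖q.2.2‖ ^ 2 / 2 - R, hΩ.inter (isOpen_lt hcu continuous_const),
      ⟨⟨hqs, hqU⟩, hu''⟩, hFs.mono fun x hx => hx.1.1, hsv.contDiffOn, ?_, hPq,
      fun hv' => ⟨(0, -((-1 : ℝ) * q.2.1), (-1 : ℝ) * q.2.2), ?_, ?_⟩⟩
    · ext x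
      constructor
      · rintro ⟨⟨⟨-, h1⟩, h2⟩, h3⟩
        exact ⟨h3, h1, by linarith [((mem_box ht).1 h2).2.2.2]⟩
      · rintro ⟨h3, h1, h2⟩
        exact ⟨⟨⟨h3.1.1, h1⟩, (mem_box ht).2 ⟨h3.1.1, h3.1.2,
          le_of_lt (show _ < _ from h3.2), by linarith⟩⟩, h3⟩
    · rw [hFd _ fun h => absurd h.2 (by rw [sub_eq_zero.1 hv']; exact not_le.2 hR)]
      have := fderiv_mirrorFun_rotation (fan := fan) (lam := lam) (t := t) j hqs (-1)
      exact_mod_cast this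
    · rw [fderiv_normSq_snd]
      have : (q.2.2 * star ((-1 : ℝ) * q.2.2)).re = -‖q.2.2‖ ^ 2 := by
        rw [← Complex.normSq_eq_norm_sq, Complex.normSq_apply]; simp
      simp only [Complex.ofReal_neg, Complex.ofReal_one] at this ⊢
      rw [this]
      have := sub_eq_zero.1 hv'
      linarith [sq_nonneg ‖q.2.1‖]

end Submanifold

/-! ### The equation `exp ζ = 1 + r` with a small right hand side -/

section ExpEquation

/-- The derivative 1 − exp z has norm at most 2|z| ≤ 1/4 on the disc. -/
theorem norm_sub_exp_sub_le {a b : ℂ} (ha : a ∈ Metric.closedBall (0 : ℂ) (1 / 8))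
    (hb : b ∈ Metric.closedBall (0 : ℂ) (1 / 8)) :
    ‖(a - Complex.exp a) - (b - Complex.exp b)‖ ≤ 1 / 4 * ‖a - b‖ := by
  refine (convex_closedBall (0 : ℂ) (1 / 8)).norm_image_sub_le_of_norm_hasDerivWithin_le
    (f := fun z => z - Complex.exp z) (f' := fun z => 1 - Complex.exp z) (fun z _ =>
      ((hasDerivAt_id z).sub (Complex.hasDerivAt_exp z)).hasDerivWithinAt) (fun z hz => ?_) hb ha
  rw [mem_closedBall_zero_iff] at hz
  rw [norm_sub_rev]
  have := Complex.norm_exp_sub_one_le (x := z) (by linarith)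
  linarith

/-- The equation `exp ζ = 1 + r θ ζ` has a unique small solution, depending continuously on the
parameter. -/
theorem exists_continuousOn_exp_eq {X : Type*} [TopologicalSpace X] {S : Set X} {r : X → ℂ → ℂ}
    (hcont : ∀ ζ ∈ Metric.closedBall (0 : ℂ) (1 / 8), ContinuousOn (fun θ => r θ ζ) S)
    (hsmall : ∀ θ ∈ S, ‖r θ 0‖ ≤ 1 / 16)
    (hlip : ∀ θ ∈ S, ∀ a ∈ Metric.closedBall (0 : ℂ) (1 / 8),
      ∀ b ∈ Metric.closedBall (0 : ℂ) (1 / 8), ‖r θ a - r θ b‖ ≤ 1 / 4 * ‖a - b‖) :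
    ∃ ζ : X → ℂ, ContinuousOn ζ S ∧ ∀ θ ∈ S, ∀ a, ‖a‖ ≤ 1 / 8 →
      (Complex.exp a = 1 + r θ a ↔ a = ζ θ) ∧ ‖ζ θ‖ ≤ 1 / 8 := by
  set D := Metric.closedBall (0 : ℂ) (1 / 8) with hD
  -- Solutions are the fixed points of f, which contracts by 1/4 + 1/4. It preserves the disc of
  -- radius 1/8 since |f(0)| ≤ 1/16 and the contraction adds at most 1/16.
  let f : X → ℂ → ℂ := fun θ a => (a - Complex.exp a) + (1 + r θ a)
  have hf : ∀ θ ∈ S, ∀ a ∈ D, ∀ b ∈ D, ‖f θ a - f θ b‖ ≤ 1 / 2 * ‖a - b‖ := by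
    intro θ hθ a ha b hb
    have h1 := norm_sub_exp_sub_le ha hb
    have h2 := hlip θ hθ a ha b hb
    have h3 : f θ a - f θ b = ((a - Complex.exp a) - (b - Complex.exp b)) + (r θ a - r θ b) := by
      simp only [f]; ring
    rw [h3]
    refine (norm_add_le _ _).trans ?_
    linarith
  have h0 : (0 : ℂ) ∈ D := by simp [hD]
  have hex : ∀ θ ∈ S, ∃ a ∈ D, f θ a = a := by
    intro θ hθ
    have hm : MapsTo (f θ) D D := by
      intro a ha
      have h1 := hf θ hθ a ha 0 h0
      have h2 : f θ 0 = r θ 0 := by simp [f]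
      have h3 := hsmall θ hθ
      rw [hD, mem_closedBall_zero_iff] at ha ⊢
      rw [h2, sub_zero] at h1
      have h4 := norm_sub_norm_le (f θ a) (r θ 0)
      linarith
    have hc : ContractingWith (1 / 2) (hm.restrict (f θ) D D) := by
      refine ⟨?_, LipschitzWith.of_dist_le_mul fun a b => ?_⟩
      · rw [← NNReal.coe_lt_coe]; norm_num
      · have := hf θ hθ a a.2 b b.2
        simp only [Subtype.dist_eq, MapsTo.val_restrict_apply, dist_eq_norm]
        simpa using this
    obtain ⟨a, ha, h, -⟩ := ContractingWith.exists_fixedPoint' Metric.isClosed_closedBall.isComplete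
      hm hc h0 (edist_ne_top _ _)
    exact ⟨a, ha, h⟩
  have huniq : ∀ θ ∈ S, ∀ a ∈ D, ∀ b ∈ D, f θ a = a → f θ b = b → a = b := by
    intro θ hθ a ha b hb h1 h2
    have h := hf θ hθ a ha b hb
    rw [h1, h2] at h
    have : ‖a - b‖ = 0 := by linarith [norm_nonneg (a - b)]
    exact sub_eq_zero.1 (norm_eq_zero.1 this)
  choose! ζ hζD hζ using hex
  have hiff : ∀ θ a, f θ a = a ↔ Complex.exp a = 1 + r θ a := fun θ a => by
    simp only [f]
    constructor <;> intro h <;> linear_combination -h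
  refine ⟨ζ, fun θ₀ hθ₀ => ?_, fun θ hθ a ha => ⟨⟨fun h => ?_, fun h => ?_⟩, ?_⟩⟩
  -- A fixed point of a 1/2-contraction moves by at most 1/(1 − 1/2) = 2 times the change of the
  -- map.
  · have h1 : ∀ θ ∈ S, ‖ζ θ - ζ θ₀‖ ≤ 2 * ‖r θ (ζ θ₀) - r θ₀ (ζ θ₀)‖ := by
      intro θ hθ
      have e1 := hf θ hθ _ (hζD θ hθ) _ (hζD θ₀ hθ₀)
      have e2 : ζ θ - ζ θ₀ = (f θ (ζ θ) - f θ (ζ θ₀)) + (r θ (ζ θ₀) - r θ₀ (ζ θ₀)) := by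
        have : r θ (ζ θ₀) - r θ₀ (ζ θ₀) = f θ (ζ θ₀) - f θ₀ (ζ θ₀) := by simp only [f]; ring
        rw [this, hζ θ hθ, hζ θ₀ hθ₀]; ring
      have e3 := norm_add_le (f θ (ζ θ) - f θ (ζ θ₀)) (r θ (ζ θ₀) - r θ₀ (ζ θ₀))
      rw [← e2] at e3
      linarith
    rw [ContinuousWithinAt, tendsto_iff_norm_sub_tendsto_zero]
    refine squeeze_zero' (Filter.Eventually.of_forall fun _ => norm_nonneg _)
      (Filter.eventually_of_mem self_mem_nhdsWithin h1) ?_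
    have h2 := hcont (ζ θ₀) (hζD θ₀ hθ₀) θ₀ hθ₀
    have h3 := (h2.sub_const (r θ₀ (ζ θ₀))).norm.const_mul 2
    simpa using h3
  · exact huniq θ hθ a (by simpa [hD] using ha) _ (hζD θ hθ) ((hiff _ _).2 h) (hζ θ hθ)
  · rw [h]; exact (hiff _ _).1 (hζ θ hθ)
  · simpa [hD] using hζD θ hθ

end ExpEquation

/-! ### The amoeba near a facet -/

section Amoeba

variable {n p : ℕ} {fan : SmoothCompleteFan n p} {lam : Fin p → ℝ} {t : ℝ} {j : Fin p}

/-- A mean value inequality in logarithmic coordinates; the curves are orbits of a one-parameter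
group, so the derivative at time 0 gives it at every time. -/
theorem norm_logCurve_sub_le {F : Ambient n → ℂ} (hF : ∀ q ∈ space n, DifferentiableAt ℝ F q)
    {q ξ : Ambient n} (hq : q ∈ space n) {M : ℝ}
    (hM : ∀ s ∈ Icc (0 : ℝ) 1, ‖logForm F (logCurve q ξ s)‖ ≤ M) :
    ‖F (logCurve q ξ 1) - F q‖ ≤ M * ‖ξ‖ := by
  have hshift : ∀ s s' : ℝ, logCurve (logCurve q ξ s) ξ s' = logCurve q ξ (s + s') := by
    intro s s'
    refine Prod.ext (funext fun i => ?_) ?_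
    · simp only [logCurve]
      rw [mul_assoc, ← Complex.exp_add]
      push_cast
      ring_nf
    · simp only [logCurve, add_smul, add_assoc]
  have hd : ∀ s : ℝ, HasDerivAt (fun s => F (logCurve q ξ s))
      (logForm F (logCurve q ξ s) ξ) s := by
    intro s
    have h1 := hasDerivAt_comp_logCurve (hF _ (logCurve_mem_space hq ξ s)) ξ
    simp only [hshift] at h1
    have h2 := HasDerivAt.comp_sub_const s s (by rwa [sub_self])
      (f := fun s' => F (logCurve q ξ (s + s')))
    simpa using h2
  have := norm_image_sub_le_of_norm_deriv_le_segment_01' (f := fun s => F (logCurve q ξ s))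
    (fun s _ => (hd s).hasDerivWithinAt) (C := M * ‖ξ‖) fun s hs =>
      ContinuousLinearMap.le_of_opNorm_le _ (hM s ⟨hs.1, hs.2.le⟩) ξ
  simpa [logCurve_zero] using this

theorem term_exp (ht : 0 < t) (k : Fin p) (w : Fin n → ℂ) :
    term fan lam t k (fun i => Complex.exp (w i)) =
      Complex.exp (Real.log t * lam k + ∑ i, (fan.ray k i : ℂ) * w i) := by
  have h := term_mul_exp fan lam t k (fun _ => 1) w
  simp only [one_mul] at h
  rw [h, term, Real.rpow_def_of_pos ht, Complex.exp_add]
  simp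

variable (fan t j) in
/-- The points over the line through `x` in the direction of the ray `j`, in logarithmic
coordinates. -/
def linePoint (x θ : Fin n → ℝ) (ζ : ℂ) : Ambient n :=
  (fun i => Complex.exp (Real.log t * x i + θ i * Complex.I + ζ * (realRay fan j i / raySq fan j)),
    0, 0)

theorem linePoint_mem_space (x θ : Fin n → ℝ) (ζ : ℂ) : linePoint fan t j x θ ζ ∈ space n :=
  fun _ => Complex.exp_ne_zero _

theorem logMapT_linePoint (hlog : Real.log t ≠ 0) (x θ : Fin n → ℝ) (ζ : ℂ) :
    logMapT t (linePoint fan t j x θ ζ).1 =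
      x + (ζ.re / (raySq fan j * Real.log t)) • realRay fan j := by
  have := one_le_raySq fan j
  have hr : raySq fan j ≠ 0 := by linarith
  ext i
  simp only [logMapT, logMap, linePoint, Pi.smul_apply, Pi.add_apply, smul_eq_mul,
    Complex.norm_exp, Real.log_exp]
  have : (ζ * ((realRay fan j i : ℂ) / (raySq fan j : ℂ))).re =
      ζ.re * (realRay fan j i / raySq fan j) := by
    rw [← Complex.ofReal_div, Complex.re_mul_ofReal]
  rw [Complex.add_re, this]
  simp
  field_simp

theorem term_linePoint (ht : 0 < t) {x : Fin n → ℝ} (hx : chi fan lam j x = 0) {θ : Fin n → ℝ}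
    (hθ : pairing (fan.ray j) θ = Real.pi) (ζ : ℂ) :
    term fan lam t j (linePoint fan t j x θ ζ).1 = -Complex.exp ζ := by
  have := one_le_raySq fan j
  have hr : (raySq fan j : ℂ) ≠ 0 := by exact_mod_cast (by linarith : raySq fan j ≠ 0)
  simp only [linePoint]
  rw [term_exp ht]
  have e1 : ∑ i, (fan.ray j i : ℂ) * (Real.log t * x i + θ i * Complex.I +
      ζ * (realRay fan j i / raySq fan j)) = Real.log t * (pairing (fan.ray j) x : ℝ) +
        (pairing (fan.ray j) θ : ℝ) * Complex.I +
          ζ * ((pairing (fan.ray j) (realRay fan j) : ℝ) / raySq fan j) := by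
    simp only [pairing]
    push_cast
    simp only [Finset.mul_sum, Finset.sum_mul, Finset.sum_div, ← Finset.sum_add_distrib]
    exact Finset.sum_congr rfl fun i _ => by ring
  rw [e1, hθ, pairing_realRay, div_self hr, mul_one]
  have e2 : (Real.log t * lam j + (Real.log t * (pairing (fan.ray j) x : ℝ) +
      Real.pi * Complex.I + ζ) : ℂ) = ζ + Real.pi * Complex.I := by
    have : ((lam j + pairing (fan.ray j) x : ℝ) : ℂ) = 0 := by
      rw [← Complex.ofReal_zero]; exact congrArg _ hx
    push_cast at this
    linear_combination (Real.log t : ℂ) * this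
  rw [e2, Complex.exp_add, Complex.exp_pi_mul_I, mul_neg_one]

theorem norm_realRay_div_le (i : Fin n) : |realRay fan j i / raySq fan j| ≤ 1 := by
  have h1 := one_le_raySq fan j
  have h2 : |realRay fan j i| ≤ realRay fan j i ^ 2 := by
    have : |fan.ray j i| ≤ fan.ray j i ^ 2 := by
      rcases eq_or_ne (fan.ray j i) 0 with h | h
      · simp [h]
      · have := Int.one_le_abs h
        nlinarith [sq_abs (fan.ray j i)]
    simp only [realRay]
    exact_mod_cast this
  have h3 : realRay fan j i ^ 2 ≤ raySq fan j :=
    Finset.single_le_sum (f := fun i => (fan.ray j i : ℝ) ^ 2)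
      (fun i _ => sq_nonneg _) (Finset.mem_univ i)
  rw [abs_div, abs_of_pos (by linarith : 0 < raySq fan j)]
  exact div_le_one_of_le₀ (h2.trans h3) (by linarith)

theorem linePoint_eq_logCurve (x θ : Fin n → ℝ) (ζ w : ℂ) (s : ℝ) :
    linePoint fan t j x θ (ζ + s * w) = logCurve (linePoint fan t j x θ ζ)
      (fun i => w * (realRay fan j i / raySq fan j), 0, 0) s := by
  refine Prod.ext (funext fun i => ?_) ?_
  · simp only [linePoint, logCurve, ← Complex.exp_add]
    ring_nf
  · simp [linePoint, logCurve]

/-- Each point over the line satisfying the equation has logarithmic coordinates with argument in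
the affine hyperplane `⟨v, θ⟩ = π`. -/
theorem exists_eq_linePoint (ht : 0 < t) (hlog : Real.log t ≠ 0) {x : Fin n → ℝ}
    (hx : chi fan lam j x = 0) {z : Fin n → ℂ} (hz : z ∈ torus n) {s : ℝ}
    (hs : logMapT t z = x + s • realRay fan j) {ζ : ℂ}
    (hζ : term fan lam t j z = -Complex.exp ζ) :
    ∃ θ, pairing (fan.ray j) θ = Real.pi ∧ ((z, 0, 0) : Ambient n) = linePoint fan t j x θ ζ := by
  have hr1 := one_le_raySq fan j
  have hr : raySq fan j ≠ 0 := by linarith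
  have hrC : (raySq fan j : ℂ) ≠ 0 := by exact_mod_cast hr
  set θ₀ : Fin n → ℝ := fun i => (z i).arg
  have hzi : ∀ i, z i = Complex.exp (Real.log t * (x i + s * realRay fan j i) +
      θ₀ i * Complex.I) := by
    intro i
    have h1 := norm_eq_exp_logMapT hlog hz i
    rw [hs] at h1
    have h2 := Complex.norm_mul_exp_arg_mul_I (z i)
    rw [← h2, h1, Complex.exp_add]
    simp [θ₀]
  have hterm : term fan lam t j z = Complex.exp (Real.log t * s * raySq fan j +
      (pairing (fan.ray j) θ₀ : ℝ) * Complex.I) := by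
    rw [show z = fun i => Complex.exp (Real.log t * (x i + s * realRay fan j i) +
      θ₀ i * Complex.I) from funext hzi, term_exp ht]
    congr 1
    have e1 : ∑ i, (fan.ray j i : ℂ) * (Real.log t * (x i + s * realRay fan j i) +
        θ₀ i * Complex.I) = Real.log t * (pairing (fan.ray j) x : ℝ) + Real.log t * s *
          (pairing (fan.ray j) (realRay fan j) : ℝ) +
            (pairing (fan.ray j) θ₀ : ℝ) * Complex.I := by
      simp only [pairing]
      push_cast
      simp only [Finset.mul_sum, Finset.sum_mul, ← Finset.sum_add_distrib]
      exact Finset.sum_congr rfl fun i _ => by ring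
    have : ((lam j + pairing (fan.ray j) x : ℝ) : ℂ) = 0 := by
      rw [← Complex.ofReal_zero]; exact congrArg _ hx
    push_cast at this
    rw [e1, pairing_realRay]
    linear_combination (Real.log t : ℂ) * this
  have hexp : Complex.exp (Real.log t * s * raySq fan j +
      (pairing (fan.ray j) θ₀ : ℝ) * Complex.I) = Complex.exp (ζ + Real.pi * Complex.I) := by
    rw [← hterm, hζ, Complex.exp_add, Complex.exp_pi_mul_I, mul_neg_one]
  obtain ⟨m, hm⟩ := Complex.exp_eq_exp_iff_exists_int.1 hexp
  obtain ⟨l, hl⟩ := fan.exists_lattice_point j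
  have hre : Real.log t * s * raySq fan j = ζ.re := by
    have := congrArg Complex.re hm
    simpa using this
  have him : pairing (fan.ray j) θ₀ = ζ.im + Real.pi + m * (2 * Real.pi) := by
    have := congrArg Complex.im hm
    simpa using this
  -- The imaginary part of ζ is moved out of the argument along v_j, where `linePoint` supplies it.
  -- The excess 2πm is removed by a lattice vector l with ⟨v_j, l⟩ = 1, which does not change z.
  refine ⟨θ₀ + (-(ζ.im / raySq fan j)) • realRay fan j +
    (-(m * (2 * Real.pi))) • fun i => (l i : ℝ), ?_, ?_⟩
  · rw [pairing_add, pairing_add, pairing_smul, pairing_smul, pairing_realRay, pairing_intCast, hl,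
      him]
    field_simp
    push_cast
    ring
  · refine Prod.ext (funext fun i => ?_) rfl
    simp only [linePoint]
    rw [hzi i, Complex.exp_eq_exp_iff_exists_int]
    refine ⟨m * l i, ?_⟩
    have hζ' : (ζ : ℂ) = (Real.log t * s * raySq fan j : ℝ) + ζ.im * Complex.I := by
      rw [hre]; exact (Complex.re_add_im ζ).symm
    simp only [Pi.add_apply, Pi.smul_apply, smul_eq_mul]
    push_cast
    rw [hζ']
    push_cast
    simp
    field_simp
    ring

/-- The amoeba of a small perturbation of the binomial equation meets the lines in the direction of
the ray in connected sets. -/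
theorem isConnected_rayLine_inter_amoebaOf (ht : 0 < t) (hlog : Real.log t ≠ 0) {x : Fin n → ℝ}
    (hx : chi fan lam j x = 0) {U : Set (Fin n → ℝ)}
    (hU : ∀ s : ℝ, |s| * raySq fan j * |Real.log t| ≤ 1 / 8 → x + s • realRay fan j ∈ U)
    {F : Ambient n → ℂ} (hF : ∀ q ∈ space n, DifferentiableAt ℝ F q)
    (hFs : ∀ q ∈ space n, logMapT t q.1 ∈ U → ‖F q‖ ≤ 1 / 16)
    (hFd : ∀ q ∈ space n, logMapT t q.1 ∈ U → ‖logForm F q‖ ≤ 1 / 4) {S : Set (Ambient n)}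
    (hS : ∀ z ∈ torus n, ((z, 0, 0) : Ambient n) ∈ S ↔
      logMapT t z ∈ U ∧ 1 + term fan lam t j z + F (z, 0, 0) = 0) :
    IsConnected (rayLine fan j x ∩ amoebaOf t S) := by
  have hr1 := one_le_raySq fan j
  have hr : raySq fan j ≠ 0 := by linarith
  -- For ⟨v_j, θ⟩ = π the j-th term at `linePoint` is −exp ζ, so the equation becomes exp ζ = 1 + F.
  -- The parameter set is an affine hyperplane, hence connected.
  set Θ : Set (Fin n → ℝ) := {θ | pairing (fan.ray j) θ = Real.pi}
  have hΘ : IsConnected Θ := by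
    refine ⟨⟨(Real.pi / raySq fan j) • realRay fan j, ?_⟩, Convex.isPreconnected ?_⟩
    · change pairing _ _ = _
      rw [pairing_smul, pairing_realRay, div_mul_cancel₀ _ hr]
    · intro a ha b hb u v _ _ huv
      have ha : pairing _ a = _ := ha
      have hb : pairing _ b = _ := hb
      change pairing _ _ = _
      rw [pairing_add, pairing_smul, pairing_smul, ha, hb, ← add_mul, huv, one_mul]
  have hball : ∀ θ, ∀ ζ : ℂ, ‖ζ‖ ≤ 1 / 8 → logMapT t (linePoint fan t j x θ ζ).1 ∈ U := by
    intro θ ζ hζ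
    rw [logMapT_linePoint hlog]
    refine hU _ ?_
    have : |ζ.re / (raySq fan j * Real.log t)| * raySq fan j * |Real.log t| = |ζ.re| := by
      rw [abs_div, abs_mul, abs_of_pos (by linarith : 0 < raySq fan j)]
      have := abs_ne_zero.2 hlog
      field_simp
    rw [this]
    exact (Complex.abs_re_le_norm ζ).trans hζ
  obtain ⟨ζ, hζc, hζ⟩ := exists_continuousOn_exp_eq (S := Θ)
    (r := fun θ a => F (linePoint fan t j x θ a)) (fun a _ => by
      have hc : Continuous fun θ => linePoint fan t j x θ a := by
        unfold linePoint; fun_prop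
      refine Continuous.continuousOn (continuous_iff_continuousAt.2 fun θ => ?_)
      exact ContinuousAt.comp (f := fun θ => linePoint fan t j x θ a)
        (hF _ (linePoint_mem_space x θ a)).continuousAt hc.continuousAt)
    (fun θ _ => hFs _ (linePoint_mem_space x θ 0) (hball θ 0 (by simp)))
    (fun θ _ a ha b hb => by
      have h1 := norm_logCurve_sub_le hF (linePoint_mem_space (fan := fan) (t := t) (j := j) x θ b)
        (ξ := (fun i => (a - b) * (realRay fan j i / raySq fan j), 0, 0)) (M := 1 / 4)
        fun s hs => by
          rw [← linePoint_eq_logCurve]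
          refine hFd _ (linePoint_mem_space x θ _) (hball θ _ ?_)
          have := (convex_closedBall (0 : ℂ) (1 / 8)).add_smul_sub_mem hb ha hs
          rw [mem_closedBall_zero_iff] at this
          simpa using this
      rw [← linePoint_eq_logCurve] at h1
      have h2 : b + ((1 : ℝ) : ℂ) * (a - b) = a := by push_cast; ring
      rw [h2] at h1
      refine h1.trans ?_
      refine mul_le_mul_of_nonneg_left ?_ (by norm_num)
      refine norm_prod_le_iff.2 ⟨(pi_norm_le_iff_of_nonneg (norm_nonneg _)).2 fun i => ?_, by simp⟩
      rw [norm_mul, ← Complex.ofReal_div, Complex.norm_real, Real.norm_eq_abs]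
      exact mul_le_of_le_one_right (norm_nonneg _) (norm_realRay_div_le i))
  have himage : rayLine fan j x ∩ amoebaOf t S =
      (fun θ => x + ((ζ θ).re / (raySq fan j * Real.log t)) • realRay fan j) '' Θ := by
    ext y
    constructor
    · rintro ⟨⟨s, hs⟩, z, ⟨hz, hzS⟩, rfl⟩
      obtain ⟨hzU, heq⟩ := (hS z hz).1 hzS
      have hs : logMapT t z = x + s • realRay fan j := hs
      have hsm := hFs (z, 0, 0) hz hzU
      -- The principal logarithm has norm at most (3/2)(1/16) < 1/8, so it falls within the range of
      -- uniqueness.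
      set a := Complex.log (1 + F (z, 0, 0)) with ha
      have h1 : Complex.exp a = 1 + F (z, 0, 0) := by
        refine Complex.exp_log fun h => ?_
        have : F (z, 0, 0) = -1 := by linear_combination h
        rw [this] at hsm
        norm_num at hsm
      have h2 : ‖a‖ ≤ 1 / 8 := by
        have := Complex.norm_log_one_add_half_le_self (z := F (z, 0, 0)) (by linarith)
        linarith
      obtain ⟨θ, hθ, hzθ⟩ := exists_eq_linePoint ht hlog hx hz hs (ζ := a)
        (by rw [h1]; linear_combination heq)
      refine ⟨θ, hθ, ?_⟩
      have h3 := ((hζ θ hθ a h2).1).1 (by rw [h1, hzθ])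
      change x + _ = _
      rw [← h3, ← logMapT_linePoint hlog x θ a, ← hzθ]
    · rintro ⟨θ, hθ, rfl⟩
      have h1 := (hζ θ hθ 0 (by simp)).2
      have h2 := ((hζ θ hθ _ h1).1).2 rfl
      have h3 : (((linePoint fan t j x θ (ζ θ)).1, 0, 0) : Ambient n) =
        linePoint fan t j x θ (ζ θ) := rfl
      refine ⟨⟨_, rfl⟩, (linePoint fan t j x θ (ζ θ)).1, ⟨linePoint_mem_space x θ _, ?_⟩,
        logMapT_linePoint hlog x θ _⟩
      refine (hS _ (linePoint_mem_space x θ _)).2 ⟨hball θ _ h1, ?_⟩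
      rw [term_linePoint ht hx hθ, h2, h3]
      ring
  rw [himage]
  refine hΘ.image _ ?_
  have : ContinuousOn (fun θ => (ζ θ).re) Θ := Complex.continuous_re.comp_continuousOn hζc
  exact continuousOn_const.add ((this.div_const _).smul continuousOn_const)

end Amoeba

/-! ### Estimates near a facet -/

section Estimates

variable {n p : ℕ} {fan : SmoothCompleteFan n p} {lam : Fin p → ℝ} {t : ℝ} {j : Fin p}

theorem norm_term_le (ht : 0 < t) (hlog : Real.log t < 0) {k : Fin p} {z : Fin n → ℂ}
    (hz : z ∈ torus n) {δ : ℝ} (h : δ ≤ chi fan lam k (logMapT t z)) :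
    ‖term fan lam t k z‖ ≤ Real.exp (Real.log t * δ) := by
  rw [norm_term fan lam ht hlog.ne k hz]
  exact Real.exp_le_exp.2 (mul_le_mul_of_nonpos_left h hlog.le)

theorem norm_tail_le (ht : 0 < t) (hlog : Real.log t < 0) {q : Ambient n} (hq : q ∈ space n)
    {δ : ℝ} (h : ∀ k, k ≠ j → δ ≤ chi fan lam k (logMapT t q.1)) :
    ‖tail fan lam t j q‖ ≤ p * Real.exp (Real.log t * δ) := by
  refine (norm_sum_le_of_le _ fun k hk =>
    norm_term_le ht hlog hq (h k (Finset.ne_of_mem_erase hk))).trans ?_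
  rw [Finset.sum_const, nsmul_eq_mul]
  refine mul_le_mul_of_nonneg_right ?_ (Real.exp_pos _).le
  exact_mod_cast (Finset.card_le_univ _).trans (Fintype.card_fin p).le

variable (fan) in
/-- The sum of the norms of the linear forms of the rays. -/
def raySum : ℝ := ∑ k, ‖rayForm (fan.ray k)‖

theorem raySum_nonneg : 0 ≤ raySum fan := Finset.sum_nonneg fun _ _ => norm_nonneg _

theorem norm_logForm_tail_le (ht : 0 < t) (hlog : Real.log t < 0) {q : Ambient n}
    (hq : q ∈ space n) {δ : ℝ} (h : ∀ k, k ≠ j → δ ≤ chi fan lam k (logMapT t q.1)) :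
    ‖logForm (tail fan lam t j) q‖ ≤ raySum fan * Real.exp (Real.log t * δ) := by
  rw [logForm_tail fan lam t j hq, raySum, Finset.sum_mul]
  refine (norm_sum_le_of_le _ (f := fun k => term fan lam t k q.1 • rayForm (fan.ray k))
    (n := fun k => ‖rayForm (fan.ray k)‖ * Real.exp (Real.log t * δ)) fun k hk => ?_).trans
    (Finset.sum_le_sum_of_subset_of_nonneg (Finset.subset_univ _) fun k _ _ => by positivity)
  rw [norm_smul, mul_comm]
  exact mul_le_mul_of_nonneg_left (norm_term_le ht hlog hq (h k (Finset.ne_of_mem_erase hk)))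
    (norm_nonneg _)

theorem chi_eq_pairing_sub {x₀ : Fin n → ℝ} (hx₀ : chi fan lam j x₀ = 0) (x : Fin n → ℝ) :
    chi fan lam j x = pairing (fan.ray j) (x - x₀) := by
  have h := pairing_add (fan.ray j) (x - x₀) x₀
  rw [sub_add_cancel] at h
  rw [chi] at hx₀ ⊢
  linarith

/-- On the cylinder χ_j > −r and the other χ_k are nonnegative, so each term is at most t^{−r} and
the supremum is finite. -/
theorem exists_isLUB_terms (ht : 0 < t) (hlog : Real.log t < 0) {x₀ : Fin n → ℝ}
    (hx₀ : chi fan lam j x₀ = 0) {δ r : ℝ} (hr : 0 < r) (hδ : 0 ≤ δ)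
    (h : ∀ x ∈ cyl fan j x₀ r, ∀ k, k ≠ j → δ ≤ chi fan lam k x) :
    ∃ B : ℝ, 1 ≤ B ∧ IsLUB ((fun z : Fin n → ℂ => 1 + ∑ k, ‖term fan lam t k z‖) ''
      {z | z ∈ torus n ∧ logMapT t z ∈ cyl fan j x₀ r}) B := by
  have hne : ((fun z : Fin n → ℂ => 1 + ∑ k, ‖term fan lam t k z‖) ''
      {z | z ∈ torus n ∧ logMapT t z ∈ cyl fan j x₀ r}).Nonempty := by
    refine ⟨_, (linePoint fan t j x₀ 0 0).1, ⟨linePoint_mem_space x₀ 0 0, ?_⟩, rfl⟩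
    rw [logMapT_linePoint hlog.ne]
    simpa using center_mem_cyl fan j x₀ hr
  have hb : BddAbove ((fun z : Fin n → ℂ => 1 + ∑ k, ‖term fan lam t k z‖) ''
      {z | z ∈ torus n ∧ logMapT t z ∈ cyl fan j x₀ r}) := by
    refine ⟨1 + ∑ _k : Fin p, Real.exp (-(Real.log t * r)), ?_⟩
    rintro _ ⟨z, ⟨hz, hzU⟩, rfl⟩
    refine add_le_add le_rfl (Finset.sum_le_sum fun k _ => ?_)
    rw [← mul_neg]
    refine norm_term_le ht hlog hz ?_
    by_cases hk : k = j
    · rw [hk, chi_eq_pairing_sub hx₀]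
      have := (max_lt_iff.1 (show max _ _ < r from hzU)).1
      exact (abs_le.1 this.le).1
    · linarith [h _ hzU k hk]
  refine ⟨_, ?_, isLUB_csSup hne hb⟩
  obtain ⟨_, z, hz, rfl⟩ := hne
  refine le_trans ?_ (le_csSup hb ⟨z, hz, rfl⟩)
  have : 0 ≤ ∑ k, ‖term fan lam t k z‖ := Finset.sum_nonneg fun _ _ => norm_nonneg _
  simpa using this

/-- The equation reads uv = 1 + w + m · tail with |m| ≤ 1. This is where the supremum of the terms
enters, as the bound that excludes corners. -/
theorem norm_mul_norm_le_of_family_eq_zero {τ : ℂ × ℂ → ℝ} (hτ : ∀ w, τ w ∈ Icc (0 : ℝ) 1)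
    {ρ : (Fin n → ℂ) → ℝ} (hρ : ∀ z, ρ z ∈ Icc (0 : ℝ) 1) {s : ℝ} (hs : s ∈ Icc (0 : ℝ) 1)
    {q : Ambient n} (h : family (mirrorFun fan lam t) (pert fan lam t j τ ρ) s q = 0) :
    ‖q.2.1‖ * ‖q.2.2‖ ≤ 1 + ∑ k, ‖term fan lam t k q.1‖ := by
  set m : ℝ := 1 - s * (τ q.2 * ρ q.1) with hm
  have hm1 : |m| ≤ 1 := by
    have a1 := hτ q.2; have a2 := hρ q.1
    have p1 : 0 ≤ s * (τ q.2 * ρ q.1) := mul_nonneg hs.1 (mul_nonneg a1.1 a2.1)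
    have p2 : s * (τ q.2 * ρ q.1) ≤ 1 :=
      mul_le_one₀ hs.2 (mul_nonneg a1.1 a2.1) (mul_le_one₀ a1.2 a2.1 a2.2)
    rw [abs_le]; constructor <;> linarith
  have e : q.2.1 * q.2.2 = 1 + term fan lam t j q.1 + m * tail fan lam t j q := by
    rw [family, mirrorFun, potential_eq fan lam t j, pert] at h
    rw [hm]; push_cast
    linear_combination h
  have e2 : ‖(m : ℂ) * tail fan lam t j q‖ ≤
      ∑ k ∈ Finset.univ.erase j, ‖term fan lam t k q.1‖ := by
    rw [norm_mul, Complex.norm_real, Real.norm_eq_abs]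
    exact (mul_le_of_le_one_left (norm_nonneg _) hm1).trans (norm_sum_le _ _)
  rw [← norm_mul, e, ← Finset.add_sum_erase _ (fun k => ‖term fan lam t k q.1‖)
    (Finset.mem_univ j)]
  refine norm_add₃_le.trans ?_
  rw [norm_one]
  linarith

theorem exists_log_lt_and_exp_le {δ κ : ℝ} (hδ : 0 < δ) (hκ : 0 < κ) (L : ℝ) :
    ∃ t₀ : ℝ, 0 < t₀ ∧ ∀ t, 0 < t → t < t₀ →
      Real.log t < -L ∧ Real.exp (Real.log t * δ) ≤ κ := by
  refine ⟨Real.exp (-max L (-(Real.log κ / δ))), Real.exp_pos _, fun t ht htt => ?_⟩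
  have h := (Real.log_lt_iff_lt_exp ht).2 htt
  have h1 := le_max_left L (-(Real.log κ / δ))
  have h2 := le_max_right L (-(Real.log κ / δ))
  refine ⟨by linarith, ?_⟩
  rw [← Real.le_log_iff_exp_le hκ, ← le_div_iff₀ hδ]
  linarith

end Estimates

/-! ### The cutoff function on the fibre -/

section FiberCutoff

theorem isCompact_bidisc (a : ℝ) :
    IsCompact {w : ℂ × ℂ | ‖w.1‖ ^ 2 / 2 ≤ a ∧ ‖w.2‖ ^ 2 / 2 ≤ a} := by
  refine (isCompact_closedBall (0 : ℂ × ℂ) (a + 1)).of_isClosed_subset ?_ fun w hw => ?_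
  · have h1 : Continuous fun w : ℂ × ℂ => ‖w.1‖ ^ 2 / 2 := by fun_prop
    have h2 : Continuous fun w : ℂ × ℂ => ‖w.2‖ ^ 2 / 2 := by fun_prop
    exact (isClosed_le h1 continuous_const).inter (isClosed_le h2 continuous_const)
  · have h : ∀ b : ℝ, 0 ≤ b → b ^ 2 / 2 ≤ a → b ≤ a + 1 := fun b hb hba => by
      nlinarith [sq_nonneg (b - 1)]
    rw [mem_closedBall_zero_iff]
    exact norm_prod_le_iff.2 ⟨h _ (norm_nonneg _) hw.1, h _ (norm_nonneg _) hw.2⟩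

theorem exists_fiber_cutoff : ∃ (θ : ℂ × ℂ → ℝ) (C : ℝ), IsFiberCutoff 1 2 θ ∧ 0 ≤ C ∧
    ∀ w, ‖fderiv ℝ θ w‖ ≤ C := by
  have c1 : Continuous fun w : ℂ × ℂ => ‖w.1‖ ^ 2 / 2 := by fun_prop
  have c2 : Continuous fun w : ℂ × ℂ => ‖w.2‖ ^ 2 / 2 := by fun_prop
  obtain ⟨θ, C, hθ, hI, h1, h0, hC0, hC⟩ := exists_smooth_cutoff (isCompact_bidisc 1).isClosed
    (O := {w : ℂ × ℂ | ‖w.1‖ ^ 2 / 2 < 2} ∩ {w : ℂ × ℂ | ‖w.2‖ ^ 2 / 2 < 2})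
    ((isOpen_lt c1 continuous_const).inter (isOpen_lt c2 continuous_const))
    (fun w hw => ⟨lt_of_le_of_lt (show ‖w.1‖ ^ 2 / 2 ≤ 1 from hw.1) one_lt_two,
      lt_of_le_of_lt (show ‖w.2‖ ^ 2 / 2 ≤ 1 from hw.2) one_lt_two⟩)
    (K := {w | ‖w.1‖ ^ 2 / 2 ≤ 2 ∧ ‖w.2‖ ^ 2 / 2 ≤ 2})
    (fun w hw => ⟨(show _ < _ from hw.1).le, (show _ < _ from hw.2).le⟩) (isCompact_bidisc 2)
  exact ⟨θ, C, ⟨hθ, hI, fun w hu hv => h1 w ⟨hu, hv⟩, fun w hw => h0 w fun h =>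
    hw ⟨(show _ < _ from h.1).le, (show _ < _ from h.2).le⟩⟩, hC0, hC⟩

/-- The radius needed depends on t, but for a ≥ 1 the dilation of a fixed model does not increase
derivatives, so one bound serves for every t. -/
theorem IsFiberCutoff.rescale {θ : ℂ × ℂ → ℝ} (h : IsFiberCutoff 1 2 θ) {a : ℝ} (ha : 0 < a) :
    IsFiberCutoff a (2 * a) fun w => θ ((Real.sqrt a)⁻¹ • w) := by
  have hs : ∀ u : ℂ, ‖(Real.sqrt a)⁻¹ • u‖ ^ 2 / 2 = ‖u‖ ^ 2 / 2 / a := fun u => by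
    rw [norm_smul, mul_pow, norm_inv, Real.norm_of_nonneg (Real.sqrt_nonneg a), inv_pow,
      Real.sq_sqrt ha.le]
    ring
  refine ⟨h.smooth.comp (contDiff_id.const_smul _), fun w => h.mem_Icc _, fun w hu hv => ?_,
    fun w hw => ?_⟩
  · refine h.eq_one _ ?_ ?_
    · rw [Prod.smul_fst, hs, div_le_one ha]; exact hu
    · rw [Prod.smul_snd, hs, div_le_one ha]; exact hv
  · refine h.eq_zero _ fun h' => hw ?_
    rwa [Prod.smul_fst, hs, div_le_iff₀ ha, Prod.smul_snd, hs, div_le_iff₀ ha] at h'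

end FiberCutoff

/-! ### The localization for a small parameter -/

section Localization

variable {n p : ℕ} {fan : SmoothCompleteFan n p} {lam : Fin p → ℝ} {t : ℝ} {j : Fin p}

/-- Injectivity, together with being the identity off K, prevents a point of K from leaving K. -/
theorem IsSupportedSymplecto.mem_iff {K : Set (Ambient n)} {Φ Ψ : Ambient n → Ambient n}
    (h : IsSupportedSymplecto K Φ Ψ) {S : Set (Ambient n)} (hS : K ⊆ S) (q : Ambient n) :
    Φ q ∈ S ↔ q ∈ S := by
  by_cases hq : q ∈ K
  · refine iff_of_true (hS ?_) (hS hq)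
    by_contra hn
    have := h.left_inv.injective (h.eq_self _ hn)
    rw [this] at hn
    exact hn hq
  · rw [h.eq_self q hq]

theorem cutMirror_inter_box_eq {τ : ℂ × ℂ → ℝ} {ρ : (Fin n → ℂ) → ℝ} {R R' R'' : ℝ}
    {U U' U'' : Set (Fin n → ℝ)} (hlog : Real.log t ≠ 0) (hR : R'' ≤ R) (hU : U'' ⊆ U)
    (hτ : IsFiberCutoff R'' R' τ) (hρ : IsBaseCutoff t U'' U' ρ) :
    cutMirror fan lam t j τ ρ ∩ box t R U ∩ box t R'' U'' =
      binomialLocus fan lam t j ∩ box t R'' U'' := by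
  have key : ∀ q ∈ box t R'' U'',
      cutPotential fan lam t j τ ρ q = 1 + term fan lam t j q.1 := by
    intro q hq
    obtain ⟨hqs, hqU, hu, hv⟩ := (mem_box hlog).1 hq
    rw [cutPotential, potential_eq fan lam t j, hτ.eq_one _ hu hv, hρ.eq_one _ hqs hqU, tail]
    push_cast
    ring
  ext q
  constructor
  · rintro ⟨⟨⟨h1, h2⟩, -⟩, h3⟩
    exact ⟨⟨h1, by rw [h2, key q h3]⟩, h3⟩
  · rintro ⟨⟨h1, h2⟩, h3⟩
    refine ⟨⟨⟨h1, by rw [h2, key q h3]⟩, ?_⟩, h3⟩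
    obtain ⟨hqs, hqU, hu, hv⟩ := (mem_box hlog).1 h3
    exact (mem_box hlog).2 ⟨hqs, hU hqU, hu.trans hR, hv.trans hR⟩

/-- The simplified mirror has connected amoeba along the lines in the direction of the ray. -/
theorem isConnected_rayLine_inter_amoebaOf_cutMirror (ht : 0 < t) (hlog : Real.log t < 0)
    (hlog1 : 1 ≤ |Real.log t|) {x : Fin n → ℝ} (hx : chi fan lam j x = 0)
    {U : Set (Fin n → ℝ)}
    (hU : ∀ s : ℝ, |s| * raySq fan j * |Real.log t| ≤ 1 / 8 → x + s • realRay fan j ∈ U)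
    {δ : ℝ} (hδ : ∀ x ∈ U, ∀ k, k ≠ j → δ ≤ chi fan lam k x) {τ : ℂ × ℂ → ℝ}
    (hτ : τ 0 = 1) {f : (Fin n → ℝ) → ℝ} (hf : ContDiff ℝ ∞ f)
    (hfI : ∀ x, f x ∈ Icc (0 : ℝ) 1) {C : ℝ} (hC0 : 0 ≤ C) (hC : ∀ x, ‖fderiv ℝ f x‖ ≤ C)
    {R : ℝ} (hR : 0 ≤ R) (h1 : p * Real.exp (Real.log t * δ) ≤ 1 / 16)
    (h2 : (raySum fan + p * C) * Real.exp (Real.log t * δ) ≤ 1 / 4) :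
    IsConnected (rayLine fan j x ∩
      amoebaOf t (cutMirror fan lam t j τ (baseCut t f) ∩ box t R U)) := by
  -- At u = v = 0 the fibre cutoff is 1, so the cut equation is 1 + w + (1 − ρ) · tail = 0.
  let m : Ambient n → ℂ := fun q => 1 - (baseCut t f q.1 : ℂ)
  have hm : ∀ q, ‖m q‖ ≤ 1 := fun q => by
    have h := baseCut_mem_Icc (t := t) hfI q.1
    simp only [m]
    rw [← Complex.ofReal_one, ← Complex.ofReal_sub, Complex.norm_real, Real.norm_eq_abs,
      abs_of_nonneg (by linarith [h.2])]
    linarith [h.1]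
  have dm : ∀ q ∈ space n, DifferentiableAt ℝ m q := fun q hq =>
    (differentiableAt_of_contDiffOn_space (contDiffOn_baseCut_fst t hf) hq).const_sub 1
  have dt : ∀ q ∈ space n, DifferentiableAt ℝ (tail fan lam t j) q := fun q hq =>
    differentiableAt_of_contDiffOn_space (contDiffOn_tail fan lam t j) hq
  have hmd : ∀ q ∈ space n, ‖logForm m q‖ ≤ C := fun q hq => by
    have h := norm_logForm_baseCut_le hlog1 hf hC0 hC hq
    have e : logForm m q = -logForm (fun q : Ambient n => (baseCut t f q.1 : ℂ)) q := by
      simp only [logForm, m]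
      rw [fderiv_const_sub, ContinuousLinearMap.neg_comp]
    rwa [e, norm_neg]
  refine isConnected_rayLine_inter_amoebaOf ht hlog.ne hx hU
    (F := fun q => m q * tail fan lam t j q) (fun q hq => (dm q hq).mul (dt q hq))
    (fun q hq hqU => ?_) (fun q hq hqU => ?_) (fun z hz => ?_)
  · rw [norm_mul]
    exact ((mul_le_of_le_one_left (norm_nonneg _) (hm q)).trans
      (norm_tail_le ht hlog hq (hδ _ hqU))).trans h1
  · refine (norm_logForm_mul_le (dm q hq) (dt q hq) (hm q)
      (norm_tail_le ht hlog hq (hδ _ hqU)) (hmd q hq)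
      (norm_logForm_tail_le ht hlog hq (hδ _ hqU))).trans ?_
    linarith
  · have hz' : ((z, 0, 0) : Ambient n) ∈ space n := hz
    have e : (cutPotential fan lam t j τ (baseCut t f) (z, 0, 0) : ℂ) =
        1 + term fan lam t j z + m (z, 0, 0) * tail fan lam t j (z, 0, 0) := by
      have := potential_eq fan lam t j (z, 0, 0)
      simp only at this
      simp only [cutPotential, this, m, tail]
      rw [show τ ((0 : ℂ), (0 : ℂ)) = 1 from hτ]
      push_cast
      ring
    constructor
    · rintro ⟨⟨-, ha⟩, hb⟩
      refine ⟨((mem_box hlog.ne).1 hb).2.1, ?_⟩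
      rw [← e, ← ha]; simp
    · rintro ⟨ha, hb⟩
      refine ⟨⟨hz, ?_⟩, (mem_box hlog.ne).2 ⟨hz', ha, by simpa using hR, by simpa using hR⟩⟩
      rw [e, hb]; simp

end Localization

/-! ### The symplectomorphism for a small parameter -/

section Symplectomorphism

variable {n p : ℕ} {fan : SmoothCompleteFan n p} {lam : Fin p → ℝ} {t : ℝ} {j : Fin p}

/-- The mirror and its simplification are symplectomorphic by a map supported over the supports of
the cutoff functions. -/
theorem exists_isSymplectomorphism_cutMirror (ht : 0 < t) (hlog : Real.log t < 0)
    (hlog1 : 1 ≤ |Real.log t|) {ε : ℝ}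
    (hε : ∀ (l : Ambient n) (L : Ambient n →L[ℝ] ℂ),
      1 / 4 ≤ coeffSq l → ‖L‖ ≤ ε → 1 / 8 ≤ poisson (complexForm l + L))
    {U U' A : Set (Fin n → ℝ)} (hUo : IsOpen U) (hA : IsCompact A) (hAU' : A ⊆ U') (hU' : U' ⊆ U)
    {δ : ℝ} (hδ : ∀ x ∈ U, ∀ k, k ≠ j → δ ≤ chi fan lam k x)
    {θ : ℂ × ℂ → ℝ} {c r R R' : ℝ} (hθ : ContDiff ℝ ∞ θ) (hc0 : 0 ≤ c) (hc1 : c ≤ 1)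
    (hθc : IsFiberCutoff r R' fun w => θ (c • w)) {C₁ : ℝ} (hC₁ : 0 ≤ C₁)
    (hθC : ∀ w, ‖fderiv ℝ θ w‖ ≤ C₁)
    {f : (Fin n → ℝ) → ℝ} (hf : ContDiff ℝ ∞ f) (hfI : ∀ x, f x ∈ Icc (0 : ℝ) 1)
    (hfA : ∀ x, x ∉ A → f x = 0) {C₂ : ℝ} (hC₂ : 0 ≤ C₂) (hfC : ∀ x, ‖fderiv ℝ f x‖ ≤ C₂)
    {B : ℝ} (hB0 : 0 ≤ B) (hBR : B < 2 * R) (hR : R' < R)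
    (hB : ∀ z ∈ torus n, logMapT t z ∈ U → 1 + ∑ k, ‖term fan lam t k z‖ ≤ B)
    (h1 : p * Real.exp (Real.log t * δ) ≤ 1 / 16)
    (h2 : (2 * raySum fan + p * (C₁ + C₂)) * Real.exp (Real.log t * δ) ≤ ε) :
    ∃ Φ : Ambient n → Ambient n,
      IsSymplectomorphism (mirror fan lam t ∩ box t R U)
        (cutMirror fan lam t j (fun w => θ (c • w)) (baseCut t f) ∩ box t R U) Φ ∧
      ∀ q, q ∉ box t R' U' → Φ q = q := by
  set τ : ℂ × ℂ → ℝ := fun w => θ (c • w) with hτ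
  set D : Set (ℂ × ℂ) := {w | ‖w.1‖ ^ 2 / 2 ≤ R' ∧ ‖w.2‖ ^ 2 / 2 ≤ R'} with hD
  set N := pert fan lam t j τ (baseCut t f) with hN
  have hdata : IsTransportData (mirrorFun fan lam t) N (tube t A D) :=
    isTransportData_pert hθc.smooth hf hA hfA (isCompact_bidisc R') hθc.eq_zero hlog.ne
  -- The bound is proved over all of U: on the support of N it drives the transport, and elsewhere
  -- it is still needed for the hypersurfaces to be symplectic.
  have hP : ∀ s ∈ Icc (0 : ℝ) 1, ∀ q ∈ space n, logMapT t q.1 ∈ U →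
      ‖family (mirrorFun fan lam t) N s q‖ ≤ 1 / 8 →
      1 / 8 ≤ poisson (logForm (family (mirrorFun fan lam t) N s) q) := by
    intro s hs q hq hqU hfam
    have e1 := norm_tail_le ht hlog hq (hδ _ hqU)
    have e2 := norm_logForm_tail_le ht hlog hq (hδ _ hqU)
    refine poisson_family_ge hε hθc.mem_Icc (baseCut_mem_Icc hfI) hdata.smooth_pert hq
      (e1.trans h1) e2 (norm_logForm_pert_le hθc.smooth hθc.mem_Icc hf hfI hq
        (norm_logForm_fiberCut_le hθ hC₁ hθC hc0 hc1 q)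
        (norm_logForm_baseCut_le hlog1 hf hC₂ hfC hq) e1 e2) ?_ hs hfam
    linarith
  obtain ⟨Φ, Ψ, hΦ, hz⟩ := hdata.transports (c := 1 / 8) (η := 1 / 8) (by norm_num) (by norm_num)
    fun s hs q hq hfam => hP s hs q hq.1 (hU' (hAU' hq.2.1)) hfam.le
  have hKbox : tube t A D ⊆ box t R' U' := fun q hq =>
    (mem_box hlog.ne).2 ⟨hq.1, hAU' hq.2.1, hq.2.2.1, hq.2.2.2⟩
  have hKbox' : tube t A D ⊆ box t R U := fun q hq =>
    (mem_box hlog.ne).2 ⟨hq.1, hU' (hAU' hq.2.1), hq.2.2.1.trans hR.le, hq.2.2.2.trans hR.le⟩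
  have hsub : ∀ s ∈ Icc (0 : ℝ) 1, IsSymplecticSubmanifold
      ({q | q ∈ space n ∧ family (mirrorFun fan lam t) N s q = 0} ∩ box t R U) := by
    intro s hs
    refine isSymplecticSubmanifold_family j hlog.ne hdata.smooth_pert hUo hB0 hBR hR
      (fun q hq => ?_) (fun q hq hqU h0 => ?_) (fun q hq hqU h0 => ?_)
    · have : τ q.2 = 0 := hθc.eq_zero q.2 hq
      simp [hN, pert, this]
    · have := hP s hs q hq hqU (by rw [h0, norm_zero]; norm_num)
      linarith
    · exact (norm_mul_norm_le_of_family_eq_zero hθc.mem_Icc (baseCut_mem_Icc hfI) hs h0).trans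
        (hB q.1 hq hqU)
  refine ⟨Φ, ?_, fun q hq => hΦ.eq_self q fun h => hq (hKbox h)⟩
  rw [mirror_eq (j := j) τ (baseCut t f), cutMirror_eq]
  refine hΦ.isSymplectomorphism (hsub 0 ⟨le_rfl, zero_le_one⟩) (hsub 1 ⟨zero_le_one, le_rfl⟩)
    fun q => and_congr ?_ (hΦ.mem_iff hKbox' q).symm
  have hs := hΦ.mem_iff (fun q hq => hq.1 : tube t A D ⊆ space n) q
  constructor
  · rintro ⟨ha, hb⟩
    exact ⟨hs.2 ha, (hz q ha).1 hb⟩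
  · rintro ⟨ha, hb⟩
    exact ⟨hs.1 ha, (hz q (hs.1 ha)).2 hb⟩

end Symplectomorphism

end HoriVafa

end

/-! ### Choice of the neighbourhoods and constants -/

open HoriVafa in
theorem mainTheorem5 {n p : ℕ} (fan : HoriVafa.SmoothCompleteFan n p) (lam : Fin p → ℝ)
    (hlam : fan.IsAmple lam) (j : Fin p) :
    ∃ U U' U'' : Set (Fin n → ℝ),
      IsOpen U ∧ IsOpen U' ∧ IsOpen U'' ∧
      HoriVafa.RelCompactIn U'' U' ∧ HoriVafa.RelCompactIn U' U ∧
      (∃ O : Set (Fin n → ℝ), IsOpen O ∧ (O ∩ HoriVafa.facet fan lam j).Nonempty ∧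
        O ∩ HoriVafa.facet fan lam j ⊆ U'') ∧
      ∃ t₀ : ℝ, 0 < t₀ ∧ ∀ t : ℝ, 0 < t → t < t₀ →
        ∃ R R' R'' B : ℝ,
          IsLUB ((fun z : Fin n → ℂ => 1 + ∑ k, ‖HoriVafa.term fan lam t k z‖) ''
            {z | z ∈ HoriVafa.torus n ∧ HoriVafa.logMapT t z ∈ U}) B ∧
          max (1 / 2 * B) 1 < R'' ∧ R'' < R' ∧ R' < R ∧
          ∃ (Yj Yjsimple : Set (HoriVafa.Ambient n)) (τ : ℂ × ℂ → ℝ) (ρ : (Fin n → ℂ) → ℝ)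
            (Φ : HoriVafa.Ambient n → HoriVafa.Ambient n),
            Yj = HoriVafa.mirror fan lam t ∩ HoriVafa.box t R U ∧
            HoriVafa.IsFiberCutoff R'' R' τ ∧ HoriVafa.IsBaseCutoff t U'' U' ρ ∧
            Yjsimple = HoriVafa.cutMirror fan lam t j τ ρ ∩ HoriVafa.box t R U ∧
            HoriVafa.IsSymplectomorphism Yj Yjsimple Φ ∧
            Yjsimple ∩ HoriVafa.box t R'' U'' =
              HoriVafa.binomialLocus fan lam t j ∩ HoriVafa.box t R'' U'' ∧
            (∀ q ∈ Yj \ HoriVafa.box t R' U', Φ q = q) ∧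
            ∀ x ∈ U ∩ HoriVafa.facet fan lam j,
              IsConnected (HoriVafa.rayLine fan j x ∩ HoriVafa.amoebaOf t Yjsimple) := by
  obtain ⟨x₀, hx₀, hpos⟩ := fan.exists_facet_point hlam j
  obtain ⟨δ, hδ, hδx⟩ : ∃ δ : ℝ, 0 < δ ∧ ∀ k, k ≠ j → δ < chi fan lam k x₀ := by
    have h : ∀ᶠ δ in nhdsWithin (0 : ℝ) (Ioi 0), ∀ k, k ≠ j → δ < chi fan lam k x₀ := by
      rw [Filter.eventually_all]
      intro k
      by_cases hk : k = j
      · exact Filter.Eventually.of_forall fun _ h => absurd hk h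
      · filter_upwards [nhdsWithin_le_nhds (eventually_lt_nhds (hpos k hk))] with δ h _ using h
    obtain ⟨δ, h, h0⟩ := (h.and self_mem_nhdsWithin).exists
    exact ⟨δ, h0, h⟩
  obtain ⟨r₀, hr₀, hcyl⟩ := exists_cyl_subset fan j x₀
    (S := {x | ∀ k, k ≠ j → δ ≤ chi fan lam k x}) (by
      have h : ∀ᶠ x in nhds x₀, ∀ k, k ≠ j → δ ≤ chi fan lam k x := by
        rw [Filter.eventually_all]
        intro k
        by_cases hk : k = j
        · exact Filter.Eventually.of_forall fun _ h => absurd hk h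
        · have hc : Continuous (chi fan lam k) := continuous_const.add (continuous_pairing _)
          filter_upwards [hc.continuousAt.eventually_const_lt (hδx k hk)] with x h _ using h.le
      exact h)
  obtain ⟨r, hr, rfl⟩ : ∃ r : ℝ, 0 < r ∧ 4 * r = r₀ := ⟨r₀ / 4, by positivity, by ring⟩
  -- The base cutoff lives on ℝⁿ, before t is chosen, so its derivative bound is independent of t.
  -- The radii r, 2r, 3r, 4r serve for U'', the support of f, U' and U.
  obtain ⟨f, C₂, hf, hfI, hf1, hf0, hC₂, hfC⟩ := exists_smooth_cutoff
    (isCompact_closedCyl fan j x₀ r).isClosed (isOpen_cyl fan j x₀ (2 * r))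
    (fun x hx => (show cylGauge fan j x₀ x ≤ r from hx).trans_lt (by linarith))
    (fun x hx => (show cylGauge fan j x₀ x < 2 * r from hx).le)
    (isCompact_closedCyl fan j x₀ (2 * r))
  obtain ⟨θ, C₁, hθ, hC₁, hθC⟩ := exists_fiber_cutoff
  obtain ⟨ε, hε0, hε⟩ := exists_poisson_pos n
  have hray := raySum_nonneg (fan := fan)
  -- Q dominates every coefficient that multiplies t^δ in the estimates below.
  set Q : ℝ := 2 * raySum fan + p * (C₁ + C₂) + p + 1 with hQ
  have hp0 : (0 : ℝ) ≤ p := Nat.cast_nonneg p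
  have hpC₁ : 0 ≤ p * C₁ := mul_nonneg hp0 hC₁
  have hpC₂ : 0 ≤ p * C₂ := mul_nonneg hp0 hC₂
  have hQ0 : 0 < Q := by rw [hQ]; linarith
  -- The condition |log t| > 1 + 1/r bounds the derivative of the base cutoff and leaves room along
  -- v_j in the amoeba argument.
  obtain ⟨t₀, ht₀, hsmall⟩ := exists_log_lt_and_exp_le hδ
    (div_pos (lt_min hε0 (by norm_num : (0 : ℝ) < 1 / 16)) hQ0) (1 + 1 / r)
  refine ⟨cyl fan j x₀ (4 * r), cyl fan j x₀ (3 * r), cyl fan j x₀ r, isOpen_cyl _ _ _ _,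
    isOpen_cyl _ _ _ _, isOpen_cyl _ _ _ _, relCompactIn_cyl fan j x₀ (by linarith),
    relCompactIn_cyl fan j x₀ (by linarith), ⟨cyl fan j x₀ r, isOpen_cyl _ _ _ _,
      ⟨x₀, center_mem_cyl fan j x₀ hr, fun k => ?_, hx₀⟩, inter_subset_left⟩, t₀, ht₀,
    fun t ht htt => ?_⟩
  · by_cases hk : k = j
    · rw [hk, hx₀]
    · exact (hpos k hk).le
  have hr1 : 0 < 1 / r := by positivity
  obtain ⟨hlt, hexp⟩ := hsmall t ht htt
  have hlog : Real.log t < 0 := by linarith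
  have hlogabs : |Real.log t| = -Real.log t := abs_of_neg hlog
  have hlog1 : 1 ≤ |Real.log t| := by rw [hlogabs]; linarith
  set e := Real.exp (Real.log t * δ) with he
  have he0 : 0 < e := Real.exp_pos _
  rw [le_div_iff₀ hQ0] at hexp
  have hbound : ∀ a : ℝ, a ≤ Q → a * e ≤ min ε (1 / 16) := fun a ha =>
    (by rw [mul_comm a]; exact mul_le_mul_of_nonneg_left ha he0.le : a * e ≤ e * Q).trans hexp
  obtain ⟨B, hB1, hB⟩ := exists_isLUB_terms (t := t) ht hlog hx₀ (by positivity : 0 < 4 * r)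
    hδ.le hcyl
  -- The radii are R'' = B + 2, R' = 2R'' and R = R' + 1; B ≥ 1 makes the rescaling factor at most
  -- 1.
  have hR'' : 0 < B + 2 := by linarith
  have hτ := hθ.rescale hR''
  have hρ : IsBaseCutoff t (cyl fan j x₀ r) (cyl fan j x₀ (3 * r)) (baseCut t f) :=
    ⟨contDiffOn_baseCut t hf, fun z _ => baseCut_mem_Icc hfI z, fun z hz hzU => by
      rw [baseCut_of_mem t f hz]
      exact hf1 _ (show cylGauge fan j x₀ _ < r from hzU).le, fun z hz hzU => by
      rw [baseCut_of_mem t f hz]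
      exact hf0 _ fun h => hzU ((show cylGauge fan j x₀ _ < 2 * r from h).trans (by linarith))⟩
  have hmono : ∀ {a b : ℝ}, a ≤ b → cyl fan j x₀ a ⊆ cyl fan j x₀ b := fun hab x hx =>
    (show cylGauge fan j x₀ x < _ from hx).trans_le hab
  have hsqrt : 1 ≤ Real.sqrt (B + 2) := Real.one_le_sqrt.2 (by linarith)
  obtain ⟨Φ, hΦ, hΦid⟩ := exists_isSymplectomorphism_cutMirror ht hlog hlog1 hε
    (isOpen_cyl fan j x₀ (4 * r)) (isCompact_closedCyl fan j x₀ (2 * r))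
    (fun x hx => (show cylGauge fan j x₀ x ≤ 2 * r from hx).trans_lt (by linarith))
    (hmono (by linarith : 3 * r ≤ 4 * r)) hcyl hθ.smooth (inv_nonneg.2 (Real.sqrt_nonneg (B + 2)))
    (inv_le_one_of_one_le₀ hsqrt) hτ hC₁ hθC hf hfI
    (fun x hx => hf0 x fun h => hx (show cylGauge fan j x₀ x < 2 * r from h).le) hC₂ hfC
    (B := B) (R := 2 * (B + 2) + 1) (by linarith) (by linarith) (by linarith)
    (fun z hz hzU => hB.1 ⟨z, ⟨hz, hzU⟩, rfl⟩)
    ((hbound p (by rw [hQ]; linarith)).trans (min_le_right _ _))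
    ((hbound _ (by rw [hQ]; linarith)).trans (min_le_left _ _))
  refine ⟨2 * (B + 2) + 1, 2 * (B + 2), B + 2, B, hB, max_lt (by linarith) (by linarith),
    by linarith, by linarith, _, _, _, baseCut t f, Φ, rfl, hτ, hρ, rfl, hΦ,
    cutMirror_inter_box_eq hlog.ne (by linarith) (hmono (by linarith)) hτ hρ,
    fun q hq => hΦid q hq.2, ?_⟩
  rintro x ⟨hxU, hxF⟩
  refine isConnected_rayLine_inter_amoebaOf_cutMirror ht hlog hlog1 hxF.2 (fun s hs => ?_) hcyl
    (hτ.eq_one 0 (by simpa using hR''.le) (by simpa using hR''.le)) hf hfI hC₂ hfC (by linarith)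
    ((hbound p (by rw [hQ]; linarith)).trans (min_le_right _ _))
    ((hbound _ (by rw [hQ]; linarith)).trans ((min_le_right _ _).trans (by norm_num)))
  refine add_smul_mem_cyl fan j x₀ hxU ?_ ?_
  · rw [← chi_eq_pairing_sub hx₀]; exact hxF.2
  -- From |s||v_j|²|log t| ≤ 1/8 and r|log t| > 1 the axial shift is below r/8, well within 4r.
  · have h1 : 1 / r < |Real.log t| := by rw [hlogabs]; linarith
    rw [div_lt_iff₀ hr] at h1
    have h2 : 0 ≤ |s| * raySq fan j :=
      mul_nonneg (abs_nonneg s) (by linarith [one_le_raySq fan j])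
    by_contra hcon
    rw [not_lt] at hcon
    nlinarith [mul_le_mul_of_nonneg_right hcon (abs_nonneg (Real.log t))]
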